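/- **Setting.** A complex is a finite simplicial complex $K$ of dimension at most $2$, embedded in some Euclidean space $\mathbb{R}^N$ ($N$ arbitrary; different embeddings count as different complexes). Angles are normalized so that the full circle has angle $1$; $\angle_v\sigma$ is the angle at $v$ of a $2$-simplex $\sigma\ni v$. $\mathrm{lk}(v,K)$ and $\mathrm{st}(v,K)$ are the link and the (closed) star of a vertex $v$, $|K|$ is the underlying space, and the order $\mathrm{ord}(e)$ of an edge $e$ is the number of $2$-simplices that contain it. A vertex-supported function $\phi$ assigns a real number $\phi(v,K)$ to every complex $K$ and every vertex $v$ of $K$; a complex-supported function $\Lambda$ assigns a real number $\Lambda(K)$ to every complex $K$. The function $\phi$ is *invariant under simplicial isometries of stars* if $\phi(v,K)=\phi(w,L)$ whenever there is a simplicial isomorphism $\mathrm{st}(v,K)\to\mathrm{st}(w,L)$ that takes $v$ to $w$ and preserves the lengths of edges ($K$ and $L$ may lie in different Euclidean spaces). It is *invariant under subdivision* if $\phi(v,K)=\phi(v,J)$ for every subdivision $J$ of $K$ and every vertex $v$ of $K$. It is *continuous* if $\phi(v_n,K_n)\to\phi(v,K)$ for every vertex $v$ of $K$ whenever $K$ and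 $K_1,K_2,\dots$ lie in the same Euclidean space, are combinatorially equivalent, and the vertices $u_n$ of $K_n$ that correspond to $u$ converge to $u$, for every vertex $u$ of $K$. It *satisfies the Descartes–Gauss–Bonnet Theorem with respect to* $\Lambda$ if $\sum_{v}\phi(v,K)=\Lambda(K)$ for every $K$, the sum being over the vertices of $K$. *Standard (Banchoff) curvature* is $\kappa(v,K)=\sum_{\eta\ni v}(-1)^{\dim\eta}\,\mathrm{ext}_v(\eta)$, the sum being over the simplices $\eta$ of $K$ that contain $v$, where the exterior angle $\mathrm{ext}_v(\eta)$ is $1$, $\tfrac12$, $\tfrac12-\angle_v\eta$ for $\dim\eta=0,1,2$. The *Euler characteristic* is $\chi(K)=\sum_{\eta\in K}(-1)^{\dim\eta}$. The *generalized angle defect* is a measure of flatness at $v$, which depends only on the homeomorphism type of the link of $v$, minus the sum of the angles at $v$. Let $c$ be any function from homeomorphism types of spaces to $\mathbb{R}$. If $|\mathrm{lk}(v,K)|$ is homeomorphic to the suspension of $m$ points for some $m\ge 0$ (that is, near $v$ the complex is homeomorphic to $m$ half-planes glued along their common boundary line), then put $a_c(v,K)=\tfrac m2$; otherwise put $a_c(v,K)=c(|\mathrm{lk}(v,K)|)$.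 The generalized angle defect $D_c$ and the stratified Euler characteristic $\chi^s_c$ with the values $c$ at the remaining vertices are $$D_c(v,K)=a_c(v,K)-\sum_{\sigma\ni v}\angle_v\sigma,\qquad \chi^s_c(K)=\sum_{v}a_c(v,K)-\sum_{e}\tfrac12\,\mathrm{ord}(e)+f_2(K),$$ where $\sigma$ runs over the $2$-simplices of $K$ that contain $v$, $v$ and $e$ in the second formula over the vertices and the edges of $K$, and $f_2(K)$ is the number of $2$-simplices of $K$. **Theorem 2.4.** Let $\phi$ be a vertex-supported function on the set of all complexes. (a) $\phi$ is standard curvature if and only if $\phi$ is invariant under simplicial isometries of stars and under subdivision, is continuous, and satisfies the Descartes–Gauss–Bonnet Theorem with respect to the Euler characteristic. (b) For every choice of $c$: $\phi$ is the generalized angle defect $D_c$ if and only if $\phi$ is invariant under simplicial isometries of stars and under subdivision, is continuous, and satisfies the Descartes–Gauss–Bonnet Theorem with respect to the stratified Euler characteristic $\chi^s_c$. -/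

import Mathlib

open scoped Topology
open Filter

/-- The Euclidean spaces in which the complexes are embedded. -/
abbrev E (N : ℕ) : Type := EuclideanSpace ℝ (Fin N)

/-- A finite simplicial complex of dimension at most `2`, embedded in `E N`. Its simplices are given
by their vertex sets, so an `i`-simplex is a face with `i + 1` elements. -/
structure TwoComplex (N : ℕ) extends Geometry.SimplicialComplex ℝ (E N) where
  finite_faces : toSimplicialComplex.faces.Finite
  card_le_three : ∀ s ∈ toSimplicialComplex.faces, s.card ≤ 3

namespace TwoComplex

variable {N M : ℕ}

/-- The vertex set of `K`. -/
abbrev vertices (K : TwoComplex N) : Set (E N) := K.toSimplicialComplex.vertices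

/-- The underlying space `|K|`. -/
abbrev space (K : TwoComplex N) : Set (E N) := K.toSimplicialComplex.space

/-- The finite set of all simplices of `K`. -/
noncomputable def simplices (K : TwoComplex N) : Finset (Finset (E N)) := K.finite_faces.toFinset

theorem finite_vertices (K : TwoComplex N) : K.vertices.Finite :=
  Set.Finite.of_finite_image (f := fun x : E N => ({x} : Finset (E N)))
    (K.finite_faces.subset (by rintro _ ⟨x, hx, rfl⟩; exact hx))
    (fun _ _ _ _ h => Finset.singleton_injective h)

noncomputable instance (K : TwoComplex N) : Fintype K.vertices := K.finite_vertices.fintype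

open Classical in
/-- The (closed) star of `v` in `K`: all faces of simplices of `K` that contain `v`. -/
noncomputable def star (K : TwoComplex N) (v : E N) : TwoComplex N where
  faces := {t ∈ K.faces | insert v t ∈ K.faces}
  isRelLowerSet_faces := by
    intro t ht
    refine ⟨K.isRelLowerSet_faces ht.1 |>.1, fun u hu hne => ⟨K.down_closed ht.1 hu hne, ?_⟩⟩
    exact K.down_closed ht.2 (Finset.insert_subset_insert v hu) (Finset.insert_nonempty v u)
  indep := fun hs => K.indep hs.1
  inter_subset_convexHull := fun hs ht => K.inter_subset_convexHull hs.1 ht.1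
  finite_faces := K.finite_faces.subset (fun _ h => h.1)
  card_le_three := fun s hs => K.card_le_three s hs.1

theorem mem_star_vertices (K : TwoComplex N) (v : K.vertices) :
    (v : E N) ∈ (K.star v).vertices := by
  have hv : ({(v : E N)} : Finset (E N)) ∈ K.faces := v.2
  exact ⟨hv, by simpa using hv⟩

open Classical in
/-- The link of `v` in `K`: all simplices `t` of `K` that do not contain `v` and for which `v` and `t`
span a simplex of `K`. -/
noncomputable def link (K : TwoComplex N) (v : E N) : TwoComplex N where
  faces := {t ∈ K.faces | v ∉ t ∧ insert v t ∈ K.faces}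
  isRelLowerSet_faces := by
    intro t ht
    refine ⟨K.isRelLowerSet_faces ht.1 |>.1, fun u hu hne => ⟨K.down_closed ht.1 hu hne, ?_, ?_⟩⟩
    · exact fun h => ht.2.1 (hu h)
    · exact K.down_closed ht.2.2 (Finset.insert_subset_insert v hu) (Finset.insert_nonempty v u)
  indep := fun hs => K.indep hs.1
  inter_subset_convexHull := fun hs ht => K.inter_subset_convexHull hs.1 ht.1
  finite_faces := K.finite_faces.subset (fun _ h => h.1)
  card_le_three := fun s hs => K.card_le_three s hs.1

open Classical in
/-- The order of an edge `e` of `K`: the number of `2`-simplices of `K` that contain it. -/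
noncomputable def order (K : TwoComplex N) (e : Finset (E N)) : ℕ :=
  (K.simplices.filter fun t => e ⊆ t ∧ t.card = 3).card

/-- The vertex `v` of `K`, as a vertex of its own star. -/
noncomputable def starCenter (K : TwoComplex N) (v : K.vertices) : (K.star v).vertices :=
  ⟨v, K.mem_star_vertices v⟩

/-- `J` is a subdivision of `K`. -/
def IsSubdivision (J K : TwoComplex N) : Prop :=
  J.space = K.space ∧
    ∀ t ∈ J.faces, ∃ s ∈ K.faces, convexHull ℝ (t : Set (E N)) ⊆ convexHull ℝ (s : Set (E N))

end TwoComplex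

/-- A combinatorial equivalence (simplicial isomorphism) of complexes, possibly embedded in different
Euclidean spaces: a bijection of the vertices under which simplices correspond to simplices. -/
structure SimplicialEquiv {N M : ℕ} (K : TwoComplex N) (L : TwoComplex M) where
  toEquiv : K.vertices ≃ L.vertices
  map_faces : ∀ s : Finset K.vertices,
    s.map (Function.Embedding.subtype _) ∈ K.faces ↔
      (s.map toEquiv.toEmbedding).map (Function.Embedding.subtype _) ∈ L.faces

/-- The stars of `v` in `K` and of `w` in `L` are simplicially isometric: there is a simplicial
isomorphism of the stars that takes `v` to `w` and preserves the lengths of all edges. -/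
def StarIsometric {N M : ℕ} (K : TwoComplex N) (v : K.vertices) (L : TwoComplex M)
    (w : L.vertices) : Prop :=
  ∃ e : SimplicialEquiv (K.star v) (L.star w),
    e.toEquiv (K.starCenter v) = L.starCenter w ∧
    ∀ x y : (K.star v).vertices,
      ({x, y} : Finset (K.star v).vertices).map (Function.Embedding.subtype _) ∈
          (K.star v).faces →
        dist (e.toEquiv x : E M) (e.toEquiv y : E M) = dist (x : E N) (y : E N)

/-- A vertex-supported function on the set of all complexes of dimension at most two. -/
abbrev VertexFunction : Type := ∀ ⦃N : ℕ⦄ (K : TwoComplex N), K.vertices → ℝ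

/-- A simplicial-complex-supported function on the set of all complexes of dimension at most two. -/
abbrev ComplexFunction : Type := ∀ ⦃N : ℕ⦄, TwoComplex N → ℝ

namespace VertexFunction

def InvariantUnderSubdivision (φ : VertexFunction) : Prop :=
  ∀ ⦃N : ℕ⦄ (K J : TwoComplex N), J.IsSubdivision K →
    ∀ (v : E N) (hK : v ∈ K.vertices) (hJ : v ∈ J.vertices), φ K ⟨v, hK⟩ = φ J ⟨v, hJ⟩

def InvariantUnderStarIsometry (φ : VertexFunction) : Prop :=
  ∀ ⦃N M : ℕ⦄ (K : TwoComplex N) (L : TwoComplex M) (v : K.vertices) (w : L.vertices),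
    StarIsometric K v L w → φ K v = φ L w

/-- Continuity: if `K n`, in the same Euclidean space as `K` and combinatorially equivalent to it,
converge to `K` vertex by vertex, then the values at corresponding vertices converge. -/
def IsContinuous (φ : VertexFunction) : Prop :=
  ∀ ⦃N : ℕ⦄ (K : TwoComplex N) (Ks : ℕ → TwoComplex N) (e : ∀ n, SimplicialEquiv K (Ks n)),
    (∀ v : K.vertices,
      Tendsto (fun n => ((e n).toEquiv v : E N)) atTop (𝓝 (v : E N))) →
    ∀ v : K.vertices, Tendsto (fun n => φ (Ks n) ((e n).toEquiv v)) atTop (𝓝 (φ K v))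

/-- The Descartes-Gauss-Bonnet Theorem with respect to `Λ`. -/
def SatisfiesDGB (φ : VertexFunction) (Λ : ComplexFunction) : Prop :=
  ∀ ⦃N : ℕ⦄ (K : TwoComplex N), ∑ v : K.vertices, φ K v = Λ K

end VertexFunction

/-- The Euler characteristic. -/
noncomputable def eulerChar : ComplexFunction :=
  fun _ K => ∑ s ∈ K.simplices, (-1 : ℝ) ^ (s.card - 1)

open Classical in
/-- The interior angle at the vertex `v` of the `2`-simplex with vertex set `t`, where the full circle
has angle `1`. If `a`, `b` are the other two vertices then the sum has the two equal terms
`∠ a v b` and `∠ b v a`. -/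
noncomputable def interiorAngle {N : ℕ} (v : E N) (t : Finset (E N)) : ℝ :=
  (∑ p ∈ (t.erase v).offDiag, EuclideanGeometry.angle p.1 v p.2) / 2 / (2 * Real.pi)

/-- The exterior angle at the vertex `v` of the simplex with vertex set `t`, of dimension at most
two, where the full circle has angle `1`. -/
noncomputable def exteriorAngle {N : ℕ} (v : E N) (t : Finset (E N)) : ℝ :=
  if t.card = 1 then 1 else if t.card = 2 then 1 / 2 else 1 / 2 - interiorAngle v t

open Classical in
/-- The sum of the angles at `v` of all `2`-simplices of `K` that contain `v`. -/
noncomputable def angleSum {N : ℕ} (K : TwoComplex N) (v : K.vertices) : ℝ :=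
  ∑ t ∈ K.simplices with (v : E N) ∈ t ∧ t.card = 3, interiorAngle (v : E N) t

open Classical in
/-- Standard (Banchoff) curvature: the alternating sum of the exterior angles at `v` of all simplices
of `K` that contain `v`. -/
noncomputable def standardCurvature : VertexFunction :=
  fun _ K v => ∑ t ∈ K.simplices with (v : E _) ∈ t,
    (-1 : ℝ) ^ (t.card - 1) * exteriorAngle (v : E _) t

/-- The suspension of `m` points: two poles `(1, 0)` and `(-1, 0)` joined by `m` disjoint open arcs.
It is a pair of points for `m = 0`, an arc for `m = 1` and a circle for `m = 2`. A vertex has a link of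
this type iff near the vertex the complex is homeomorphic to `m` half-planes that are glued along their
common boundary line. -/
abbrev SuspendedPoints (m : ℕ) : Type :=
  {p : ℝ × (Fin m → ℝ) // (∀ i, 0 ≤ p.2 i) ∧ (∀ i j, i ≠ j → p.2 i = 0 ∨ p.2 j = 0) ∧
    |p.1| + ∑ i, p.2 i = 1}

/-- Homeomorphism types of topological spaces. -/
abbrev HomeoType : Type 1 := Quotient (CategoryTheory.isIsomorphicSetoid TopCat.{0})

open Classical in
/-- The measure of flatness of a vertex with link `X`, replacing the full angle `1` at a vertex of a
surface. Where `m` half-planes meet along a line it is the angle sum `m / 2` of `m` flat half-planes.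
At the remaining (isolated) vertices it is the value that `c` prescribes for the homeomorphism type
of the link. -/
noncomputable def flatness (c : HomeoType → ℝ) (X : Type) [TopologicalSpace X] : ℝ :=
  if h : ∃ m : ℕ, Nonempty (X ≃ₜ SuspendedPoints m) then (Nat.find h : ℝ) / 2
  else c (Quotient.mk _ (TopCat.of X))

/-- The generalized angle defect: the measure of flatness at a vertex minus the sum of the angles. -/
noncomputable def generalizedAngleDefect (c : HomeoType → ℝ) : VertexFunction :=
  fun _ K v => flatness c (K.link v).space - angleSum K v

open Classical in
/-- The stratified Euler characteristic: the alternating sum over all simplices of `K`, each counted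
with the measure of flatness of its interior points. For an edge this is half of its order, for a
`2`-simplex it is `1`. -/
noncomputable def stratifiedEulerChar (c : HomeoType → ℝ) : ComplexFunction :=
  fun _ K => ∑ v : K.vertices, flatness c (K.link v).space
    - ∑ e ∈ K.simplices with e.card = 2, (K.order e : ℝ) / 2
    + ∑ t ∈ K.simplices with t.card = 3, (1 : ℝ)

/-! Both parts share one uniqueness argument. If two functions have the four properties with the
same `Λ`, then their difference `ψ` has the three invariance properties and sums to zero on every
complex (`IsNull.of_sub`). It suffices to show that such a `ψ` vanishes, and that the two given
curvatures have the properties.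

Vanishing works from simple stars to general ones. Since `ψ` depends only on the star, its zero sum
can be applied to a star alone. Subdividing an edge at `u` moves the other end point towards `u`
without changing the value there, so the edge lengths at `u` can be reduced independently. Hence the
value at the corner of a single triangle is a function `cornerValue` of the angle. An isosceles
triangle gives `2 c(θ) + c(π - 2θ) = 0` for acute `θ`; a triangle split into two pages, shrunk so
that both are isosceles, then gives `c(θ₁ + θ₂) = c(θ₁) + c(θ₂)`. So `c` vanishes at `π / 2`, at its
dyadic fractions and their multiples, and by continuity everywhere on `(0, π)`.

A book consists of triangles that share an edge. If all its angles at one end of the spine are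
acute, isosceles pages make the two ends isometric and the zero sum kills both
(`IsNull.eval_acute_book`). With all edges at `u` of equal length the angles at the other end are
acute, which settles every book (`IsNull.eval_book`). In the star of `v` every neighbor of `v` has a
book as its star (`IsNull.star_isBook`), so the zero sum leaves only the value at `v`.

Conversely, isometry invariance and continuity concern only angles and the link, and Gauss–Bonnet is
double counting together with the angle sum of a triangle. For subdivision, a sector at `v` is
parametrized by its opposite side: the angles telescope, and a sector cut into `k` pieces gains `k -
1` edges. The link is the set of directions from `v` into the underlying space, which a subdivision
does not change. -/

open scoped Classical

set_option linter.unusedSectionVars false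

/-! ### Barycentric weights -/

section Weights

variable {V : Type*} [AddCommGroup V] [Module ℝ V]

/-- The point with given (finitely supported) barycentric weights. -/
noncomputable def bary : (V →₀ ℝ) →ₗ[ℝ] V := Finsupp.linearCombination ℝ id

/-- The total weight. -/
noncomputable def mass : (V →₀ ℝ) →ₗ[ℝ] ℝ := Finsupp.linearCombination ℝ (fun _ => (1 : ℝ))

@[simp] theorem bary_single (x : V) (a : ℝ) : bary (Finsupp.single x a) = a • x := by
  simp [bary]

@[simp] theorem mass_single (x : V) (a : ℝ) : mass (Finsupp.single x a) = a := by
  simp [mass]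

theorem bary_eq_sum {c : V →₀ ℝ} {s : Finset V} (h : c.support ⊆ s) :
    bary c = ∑ y ∈ s, c y • y := by
  rw [bary, Finsupp.linearCombination_apply, Finsupp.sum_of_support_subset _ h]
  · rfl
  · simp

theorem mass_eq_sum {c : V →₀ ℝ} {s : Finset V} (h : c.support ⊆ s) :
    mass c = ∑ y ∈ s, c y := by
  rw [mass, Finsupp.linearCombination_apply, Finsupp.sum_of_support_subset _ h]
  · simp
  · simp

/-- `c` is a system of convex weights on the finite set `s`. -/
structure IsConvexWeight (c : V →₀ ℝ) (s : Finset V) : Prop where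
  nonneg : ∀ y, 0 ≤ c y
  supp : c.support ⊆ s
  mass_eq : mass c = 1

theorem IsConvexWeight.eq_zero {c : V →₀ ℝ} {s : Finset V} (h : IsConvexWeight c s) {y : V}
    (hy : y ∉ s) : c y = 0 := by
  by_contra h0
  exact hy (h.supp (Finsupp.mem_support_iff.2 h0))

theorem mem_convexHull_iff_weight {s : Finset V} {x : V} :
    x ∈ convexHull ℝ (s : Set V) ↔ ∃ c, IsConvexWeight c s ∧ bary c = x := by
  rw [Finset.mem_convexHull']
  constructor
  · rintro ⟨w, h0, h1, h2⟩
    have hs : (Finsupp.onFinset s (fun y => if y ∈ s then w y else 0)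
        (by intro a; simp +contextual)).support ⊆ s := Finsupp.support_onFinset_subset
    refine ⟨Finsupp.onFinset s (fun y => if y ∈ s then w y else 0)
        (by intro a; simp +contextual), ⟨?_, hs, ?_⟩, ?_⟩
    · intro y
      simp only [Finsupp.onFinset_apply]
      split_ifs with hy
      · exact h0 y hy
      · exact le_rfl
    · rw [mass_eq_sum hs, ← h1]
      exact Finset.sum_congr rfl (by simp +contextual)
    · rw [bary_eq_sum hs, ← h2]
      exact Finset.sum_congr rfl (by simp +contextual)
  · rintro ⟨c, hc, rfl⟩
    exact ⟨c, fun y _ => hc.nonneg y, by rw [← mass_eq_sum hc.supp, hc.mass_eq],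
      (bary_eq_sum hc.supp).symm⟩

theorem AffineIndependent.weight_unique {s : Finset V} (hs : AffineIndependent ℝ ((↑) : s → V))
    {c d : V →₀ ℝ} (hc : c.support ⊆ s) (hd : d.support ⊆ s) (hm : mass c = mass d)
    (hb : bary c = bary d) : c = d := by
  have key := affineIndependent_iff.1 hs s.attach (fun i => c i - d i)
    (by rw [Finset.sum_attach s (fun i => c i - d i), Finset.sum_sub_distrib, ← mass_eq_sum hc,
          ← mass_eq_sum hd, hm, sub_self])
    (by rw [Finset.sum_attach s (fun i => (c i - d i) • i)]
        simp only [sub_smul]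
        rw [Finset.sum_sub_distrib, ← bary_eq_sum hc, ← bary_eq_sum hd, hb, sub_self])
  ext y
  by_cases hy : y ∈ s
  · exact sub_eq_zero.1 (key ⟨y, hy⟩ (Finset.mem_attach _ _))
  · rw [Finsupp.notMem_support_iff.1 fun h => hy (hc h),
      Finsupp.notMem_support_iff.1 fun h => hy (hd h)]

/-- The common point lies in the hull of `s ∩ t`. Weights for it there are, extended by zero,
weights on `s` and on `t`, and affine independence of each simplex identifies all three systems.
Weights on the whole space make systems on different simplices comparable. -/
theorem Geometry.SimplicialComplex.weight_unique (K : Geometry.SimplicialComplex ℝ V)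
    {s t : Finset V} (hs : s ∈ K.faces) (ht : t ∈ K.faces) {c d : V →₀ ℝ}
    (hc : IsConvexWeight c s) (hd : IsConvexWeight d t) (h : bary c = bary d) : c = d := by
  have hx := K.inter_subset_convexHull hs ht
    ⟨mem_convexHull_iff_weight.2 ⟨c, hc, rfl⟩, mem_convexHull_iff_weight.2 ⟨d, hd, h.symm⟩⟩
  rw [← Finset.coe_inter, mem_convexHull_iff_weight] at hx
  obtain ⟨e, he, hec⟩ := hx
  have h1 : e = c := (K.indep hs).weight_unique (he.supp.trans Finset.inter_subset_left) hc.supp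
    (by rw [he.mass_eq, hc.mass_eq]) hec
  have h2 : e = d := (K.indep ht).weight_unique (he.supp.trans Finset.inter_subset_right) hd.supp
    (by rw [he.mass_eq, hd.mass_eq]) (hec.trans h)
  rw [← h1, h2]

/-- Uniqueness of convex weights on `s` forces affine independence. -/
theorem affineIndependent_of_weight_unique {s : Finset V}
    (h : ∀ c d : V →₀ ℝ, IsConvexWeight c s → IsConvexWeight d s → bary c = bary d → c = d) :
    AffineIndependent ℝ ((↑) : s → V) := by
  rw [affineIndependent_iff]
  intro t w h0 h1 e he
  -- The positive and negative parts of an affine dependence have equal mass and represent equal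
  -- vectors, so after division by the mass they are convex weights of one point.
  set P : V →₀ ℝ := ∑ i ∈ t, Finsupp.single (i : V) (w i ⊔ 0) with hP
  set Q : V →₀ ℝ := ∑ i ∈ t, Finsupp.single (i : V) ((-w i) ⊔ 0) with hQ
  have app : ∀ (f : s → ℝ) (j : s), j ∈ t →
      (∑ i ∈ t, Finsupp.single (i : V) (f i)) (j : V) = f j := by
    intro f j hj
    rw [Finsupp.finsetSum_apply, Finset.sum_eq_single j]
    · simp
    · intro i _ hij
      rw [Finsupp.single_apply, if_neg (fun h => hij (Subtype.ext h))]
    · exact fun h => absurd hj h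
  have supp : ∀ (f : s → ℝ), (∑ i ∈ t, Finsupp.single (i : V) (f i)).support ⊆ s := by
    intro f
    refine Finsupp.support_finsetSum.trans ?_
    intro y hy
    obtain ⟨i, -, hi⟩ := Finset.mem_biUnion.1 hy
    have := Finsupp.support_single_subset hi
    rw [Finset.mem_singleton.1 this]
    exact i.2
  have nn : ∀ (f : s → ℝ), (∀ i, 0 ≤ f i) →
      ∀ y, 0 ≤ (∑ i ∈ t, Finsupp.single (i : V) (f i)) y := by
    intro f hf y
    rw [Finsupp.finsetSum_apply]
    refine Finset.sum_nonneg fun i _ => ?_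
    rw [Finsupp.single_apply]
    split_ifs
    · exact hf i
    · exact le_rfl
  have e1 : ∀ a : ℝ, a ⊔ 0 - (-a) ⊔ 0 = a := by
    intro a
    rcases le_total a 0 with h | h
    · rw [max_eq_right h, max_eq_left (by linarith)]; ring
    · rw [max_eq_left h, max_eq_right (by linarith)]; ring
  have hm : mass P = mass Q := by
    rw [← sub_eq_zero, hP, hQ, map_sum, map_sum, ← Finset.sum_sub_distrib]
    simpa only [mass_single, e1] using h0
  have hb : bary P = bary Q := by
    rw [← sub_eq_zero, hP, hQ, map_sum, map_sum, ← Finset.sum_sub_distrib]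
    simpa only [bary_single, ← sub_smul, e1] using h1
  have hPQ : P e - Q e = w e := by
    rw [hP, hQ, app (fun i => w i ⊔ 0) e he, app (fun i => (-w i) ⊔ 0) e he, e1]
  have hP0 := nn (fun i => w i ⊔ 0) (fun i => le_max_right _ _)
  have hQ0 := nn (fun i => (-w i) ⊔ 0) (fun i => le_max_right _ _)
  have hmP : mass P = ∑ y ∈ s, P y := mass_eq_sum (supp _)
  have hmQ : mass Q = ∑ y ∈ s, Q y := mass_eq_sum (supp _)
  -- Mass zero cannot be normalized, but then nonnegativity makes all weights vanish.
  rcases (Finset.sum_nonneg fun y (_ : y ∈ s) => hP0 y).eq_or_lt with hz | hz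
  · have hz1 := (Finset.sum_eq_zero_iff_of_nonneg fun y _ => hP0 y).1 hz.symm e e.2
    have hz2 := (Finset.sum_eq_zero_iff_of_nonneg fun y _ => hQ0 y).1
      (by rw [← hmQ, ← hm, hmP]; exact hz.symm) e e.2
    rw [← hPQ]
    change P e - Q e = 0
    rw [hP, hQ, hz1, hz2, sub_zero]
  · rw [← hP, ← hmP] at hz
    have := h ((mass P)⁻¹ • P) ((mass P)⁻¹ • Q)
      ⟨fun y => mul_nonneg (inv_nonneg.2 hz.le) (hP0 y),
        Finsupp.support_smul.trans (supp _), by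
          rw [map_smul, smul_eq_mul, inv_mul_cancel₀ hz.ne']⟩
      ⟨fun y => mul_nonneg (inv_nonneg.2 hz.le) (hQ0 y),
        Finsupp.support_smul.trans (supp _), by
          rw [map_smul, ← hm, smul_eq_mul, inv_mul_cancel₀ hz.ne']⟩
      (by rw [map_smul, map_smul, hb])
    have h2 := congrArg (fun f => f (e : V)) this
    simp only [Finsupp.smul_apply, smul_eq_mul] at h2
    have h3 := mul_left_cancel₀ (inv_ne_zero hz.ne') h2
    rw [← hPQ, h3, sub_self]

end Weights

/-! ### Complexes from unique weights, stars and links -/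

namespace TwoComplex

variable {N M : ℕ}

/-- A family of finite sets in which convex weights are determined by the point they represent is a
geometric simplicial complex. -/
noncomputable def ofWeightUnique (F : Set (Finset (E N))) (hne : ∀ s ∈ F, s.Nonempty)
    (hdown : ∀ s ∈ F, ∀ t ⊆ s, t.Nonempty → t ∈ F) (hfin : F.Finite) (hcard : ∀ s ∈ F, s.card ≤ 3)
    (huniq : ∀ s ∈ F, ∀ t ∈ F, ∀ c d : E N →₀ ℝ, IsConvexWeight c s → IsConvexWeight d t →
      bary c = bary d → c = d) : TwoComplex N where
  faces := F
  isRelLowerSet_faces := fun {s} hs => ⟨hne s hs, fun {t} hts ht => hdown s hs t hts ht⟩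
  indep := fun {s} hs => affineIndependent_of_weight_unique fun c d hc hd h =>
    huniq s hs s hs c d hc hd h
  inter_subset_convexHull := by
    rintro s t hs ht x ⟨hxs, hxt⟩
    obtain ⟨c, hc, hcx⟩ := mem_convexHull_iff_weight.1 hxs
    obtain ⟨d, hd, hdx⟩ := mem_convexHull_iff_weight.1 hxt
    have hcd := huniq s hs t ht c d hc hd (hcx.trans hdx.symm)
    rw [← Finset.coe_inter]
    exact mem_convexHull_iff_weight.2 ⟨c, ⟨hc.nonneg,
      Finset.subset_inter hc.supp (hcd ▸ hd.supp), hc.mass_eq⟩, hcx⟩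
  finite_faces := hfin
  card_le_three := hcard

theorem mem_simplices {K : TwoComplex N} {s : Finset (E N)} : s ∈ K.simplices ↔ s ∈ K.faces := by
  simp [simplices]

theorem nonempty_of_mem (K : TwoComplex N) {s : Finset (E N)} (hs : s ∈ K.faces) : s.Nonempty :=
  K.toSimplicialComplex.nonempty_of_mem_faces hs

theorem subset_vertices (K : TwoComplex N) {s : Finset (E N)} (hs : s ∈ K.faces) :
    (s : Set (E N)) ⊆ K.vertices := fun _ hx =>
  K.down_closed hs (Finset.singleton_subset_iff.2 hx) (Finset.singleton_nonempty _)

theorem ext_faces {K L : TwoComplex N} (h : ∀ s, s ∈ K.faces ↔ s ∈ L.faces) : K = L := by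
  rcases K with ⟨⟨⟨F, hF⟩, h1, h2⟩, h3, h4⟩
  rcases L with ⟨⟨⟨G, hG⟩, h5, h6⟩, h7, h8⟩
  have : F = G := Set.ext h
  subst this
  rfl

theorem mem_star {K : TwoComplex N} {v : E N} {t : Finset (E N)} :
    t ∈ (K.star v).faces ↔ t ∈ K.faces ∧ insert v t ∈ K.faces := Iff.rfl

theorem mem_link {K : TwoComplex N} {v : E N} {t : Finset (E N)} :
    t ∈ (K.link v).faces ↔ t ∈ K.faces ∧ v ∉ t ∧ insert v t ∈ K.faces := Iff.rfl

theorem mem_link_iff_star {K : TwoComplex N} {v : E N} {t : Finset (E N)} :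
    t ∈ (K.link v).faces ↔ t ∈ (K.star v).faces ∧ v ∉ t := by
  rw [mem_link, mem_star]; tauto

theorem star_star (K : TwoComplex N) (v : E N) : (K.star v).star v = K.star v := by
  refine ext_faces fun s => ?_
  simp only [mem_star, Finset.insert_idem]
  tauto

end TwoComplex

/-! ### Simplicial isomorphisms as maps of the ambient spaces -/

/-- `f` restricts to a simplicial isomorphism from `K` to `L`. -/
structure IsSimplicialIso {N M : ℕ} (f : E N → E M) (K : TwoComplex N) (L : TwoComplex M) :
    Prop where
  injOn : Set.InjOn f K.vertices
  mem_iff : ∀ t, t ∈ L.faces ↔ ∃ s ∈ K.faces, s.image f = t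

theorem Finset.image_injOn_subset {α β : Type*} [DecidableEq β] {f : α → β} {S : Set α}
    (hf : Set.InjOn f S)
    {s t : Finset α} (hs : (s : Set α) ⊆ S) (ht : (t : Set α) ⊆ S)
    (h : s.image f = t.image f) : s = t := by
  rw [← Finset.coe_inj, Finset.coe_image, Finset.coe_image] at h
  exact Finset.coe_injective ((hf.image_eq_image_iff hs ht).1 h)

namespace IsSimplicialIso

variable {N M : ℕ} {f : E N → E M} {K : TwoComplex N} {L : TwoComplex M}

theorem image_mem (h : IsSimplicialIso f K L) {s : Finset (E N)} (hs : s ∈ K.faces) :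
    s.image f ∈ L.faces := (h.mem_iff _).2 ⟨s, hs, rfl⟩

theorem image_mem_iff (h : IsSimplicialIso f K L) {s : Finset (E N)}
    (hs : (s : Set (E N)) ⊆ K.vertices) : s.image f ∈ L.faces ↔ s ∈ K.faces := by
  refine ⟨fun H => ?_, h.image_mem⟩
  obtain ⟨t, ht, hts⟩ := (h.mem_iff _).1 H
  rw [← Finset.image_injOn_subset h.injOn (K.subset_vertices ht) hs hts]
  exact ht

theorem mem_vertices (h : IsSimplicialIso f K L) {x : E N} (hx : x ∈ K.vertices) :
    f x ∈ L.vertices := by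
  have := h.image_mem (s := {x}) hx
  rwa [Finset.image_singleton] at this

theorem exists_of_mem_vertices (h : IsSimplicialIso f K L) {y : E M} (hy : y ∈ L.vertices) :
    ∃ x ∈ K.vertices, f x = y := by
  obtain ⟨s, hs, hsy⟩ := (h.mem_iff {y}).1 hy
  obtain ⟨x, hx⟩ := K.nonempty_of_mem hs
  refine ⟨x, K.subset_vertices hs hx, ?_⟩
  have := Finset.mem_image_of_mem f hx
  rwa [hsy, Finset.mem_singleton] at this

theorem star (h : IsSimplicialIso f K L) {v : E N} (hv : v ∈ K.vertices) :
    IsSimplicialIso f (K.star v) (L.star (f v)) := by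
  refine ⟨h.injOn.mono fun x hx => hx.1, fun t => ?_⟩
  simp only [TwoComplex.mem_star, h.mem_iff t]
  constructor
  · rintro ⟨⟨s, hs, rfl⟩, h2⟩
    refine ⟨s, ⟨hs, ?_⟩, rfl⟩
    rw [← Finset.image_insert, h.image_mem_iff] at h2
    · exact h2
    · rw [Finset.coe_insert]
      exact Set.insert_subset hv (K.subset_vertices hs)
  · rintro ⟨s, ⟨hs, hs2⟩, rfl⟩
    refine ⟨⟨s, hs, rfl⟩, ?_⟩
    rw [← Finset.image_insert]
    exact h.image_mem hs2

theorem mem_image_iff (h : IsSimplicialIso f K L) {v : E N} (hv : v ∈ K.vertices)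
    {s : Finset (E N)} (hs : s ∈ K.faces) : f v ∈ s.image f ↔ v ∈ s := by
  refine ⟨fun H => ?_, Finset.mem_image_of_mem f⟩
  obtain ⟨x, hx, hxv⟩ := Finset.mem_image.1 H
  rwa [← h.injOn (K.subset_vertices hs hx) hv hxv]

/-- The hypothesis concerns only the stars, because that is all a star isometry provides; the link
is the part of the star whose simplices avoid the center. -/
theorem link_of_star {v : E N} (hv : v ∈ K.vertices)
    (h : IsSimplicialIso f (K.star v) (L.star (f v))) :
    IsSimplicialIso f (K.link v) (L.link (f v)) := by
  have hv' : v ∈ (K.star v).vertices := K.mem_star_vertices ⟨v, hv⟩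
  refine ⟨h.injOn.mono fun x hx => (TwoComplex.mem_link_iff_star.1 hx).1, fun t => ?_⟩
  simp only [TwoComplex.mem_link_iff_star, h.mem_iff t]
  constructor
  · rintro ⟨⟨s, hs, rfl⟩, h2⟩
    exact ⟨s, ⟨hs, fun h3 => h2 (Finset.mem_image_of_mem f h3)⟩, rfl⟩
  · rintro ⟨s, ⟨hs, hs2⟩, rfl⟩
    exact ⟨⟨s, hs, rfl⟩, fun h3 => hs2 ((h.mem_image_iff hv' hs).1 h3)⟩

/-- The combinatorial equivalence defined by a simplicial isomorphism. -/
noncomputable def toSimplicialEquiv (h : IsSimplicialIso f K L) : SimplicialEquiv K L where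
  toEquiv := Equiv.ofBijective (fun x => ⟨f x, h.mem_vertices x.2⟩)
    ⟨fun x y hxy => Subtype.ext (h.injOn x.2 y.2 (congrArg Subtype.val hxy)), fun y => by
      obtain ⟨x, hx, hxy⟩ := h.exists_of_mem_vertices y.2
      exact ⟨⟨x, hx⟩, Subtype.ext hxy⟩⟩
  map_faces := by
    intro s
    have hs : ((s.map (Function.Embedding.subtype (· ∈ K.vertices)) : Finset (E N)) :
        Set (E N)) ⊆ K.vertices := by
      intro x hx
      obtain ⟨y, -, rfl⟩ := Finset.mem_map.1 (Finset.mem_coe.1 hx)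
      exact y.2
    rw [← h.image_mem_iff hs]
    congr! 1
    ext y
    simp only [Finset.mem_image, Finset.mem_map]
    constructor
    · rintro ⟨_, ⟨x, hx, rfl⟩, rfl⟩
      exact ⟨_, ⟨x, hx, rfl⟩, rfl⟩
    · rintro ⟨_, ⟨x, hx, rfl⟩, rfl⟩
      exact ⟨x, ⟨x, hx, rfl⟩, rfl⟩

@[simp] theorem toSimplicialEquiv_apply (h : IsSimplicialIso f K L) (x : K.vertices) :
    (h.toSimplicialEquiv.toEquiv x : E M) = f x := rfl

end IsSimplicialIso

namespace SimplicialEquiv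

variable {N M : ℕ} {K : TwoComplex N} {L : TwoComplex M}

/-- The vertex map of a combinatorial equivalence, extended by `0`. -/
noncomputable def toFun (e : SimplicialEquiv K L) (x : E N) : E M :=
  if h : x ∈ K.vertices then e.toEquiv ⟨x, h⟩ else 0

theorem toFun_apply (e : SimplicialEquiv K L) (x : K.vertices) :
    e.toFun x = e.toEquiv x := by
  rw [toFun, dif_pos x.2]

theorem image_toFun (e : SimplicialEquiv K L) (s : Finset K.vertices) :
    (s.map (Function.Embedding.subtype (· ∈ K.vertices))).image e.toFun =
      (s.map e.toEquiv.toEmbedding).map (Function.Embedding.subtype (· ∈ L.vertices)) := by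
  ext y
  simp only [Finset.mem_image, Finset.mem_map]
  constructor
  · rintro ⟨_, ⟨x, hx, rfl⟩, rfl⟩
    exact ⟨e.toEquiv x, ⟨x, hx, rfl⟩, (e.toFun_apply x).symm⟩
  · rintro ⟨_, ⟨x, hx, rfl⟩, rfl⟩
    exact ⟨x, ⟨x, hx, rfl⟩, e.toFun_apply x⟩

theorem exists_map_eq {N : ℕ} (K : TwoComplex N) {s : Finset (E N)}
    (hs : (s : Set (E N)) ⊆ K.vertices) :
    ∃ t : Finset K.vertices, t.map (Function.Embedding.subtype (· ∈ K.vertices)) = s :=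
  ⟨s.subtype (· ∈ K.vertices), Finset.subtype_map_of_mem hs⟩

theorem isSimplicialIso (e : SimplicialEquiv K L) : IsSimplicialIso e.toFun K L := by
  refine ⟨fun x hx y hy hxy => ?_, fun t => ⟨fun ht => ?_, ?_⟩⟩
  · have h1 := e.toFun_apply ⟨x, hx⟩
    have h2 := e.toFun_apply ⟨y, hy⟩
    have h3 := e.toEquiv.injective (Subtype.ext (h1.symm.trans (hxy.trans h2)))
    exact congrArg Subtype.val h3
  · obtain ⟨t, rfl⟩ := exists_map_eq L (L.subset_vertices ht)
    refine ⟨_, (e.map_faces (t.map e.toEquiv.symm.toEmbedding)).2 ?_, ?_⟩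
    · convert ht
      ext x
      simp
    · rw [image_toFun]
      congr 1
      ext x
      simp
  · rintro ⟨s, hs, rfl⟩
    obtain ⟨s, rfl⟩ := exists_map_eq K (K.subset_vertices hs)
    rw [image_toFun]
    exact (e.map_faces s).1 hs

end SimplicialEquiv

/-- Replaces a bijection of subtypes by a map of points. Preserving edge lengths is the same as
preserving distances within each face, since any two vertices of a face span a face. -/
theorem starIsometric_iff {N M : ℕ} {K : TwoComplex N} {v : K.vertices} {L : TwoComplex M}
    {w : L.vertices} :
    StarIsometric K v L w ↔ ∃ f : E N → E M, f v = w ∧ IsSimplicialIso f (K.star v) (L.star w) ∧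
      ∀ s ∈ (K.star v).faces, ∀ x ∈ s, ∀ y ∈ s, dist (f x) (f y) = dist x y := by
  constructor
  · rintro ⟨e, h1, h2⟩
    refine ⟨e.toFun, ?_, e.isSimplicialIso, fun s hs x hx y hy => ?_⟩
    · have := e.toFun_apply (K.starCenter v)
      rw [h1] at this
      exact this
    · have hx' := (K.star v).subset_vertices hs hx
      have hy' := (K.star v).subset_vertices hs hy
      rw [e.toFun_apply ⟨x, hx'⟩, e.toFun_apply ⟨y, hy'⟩]
      refine h2 ⟨x, hx'⟩ ⟨y, hy'⟩ ?_
      refine (K.star v).down_closed hs ?_ (by simp)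
      intro z hz
      obtain ⟨z, hz', rfl⟩ := Finset.mem_map.1 hz
      rcases Finset.mem_insert.1 hz' with rfl | hz'
      · exact hx
      · rw [Finset.mem_singleton.1 hz']
        exact hy
  · rintro ⟨f, h1, h2, h3⟩
    refine ⟨h2.toSimplicialEquiv, Subtype.ext h1, fun x y hxy => ?_⟩
    exact h3 _ hxy x (Finset.mem_map.2 ⟨x, by simp, rfl⟩) y (Finset.mem_map.2 ⟨y, by simp, rfl⟩)

/-! ### Homeomorphisms between underlying spaces -/

theorem IsCompact.nonempty_homeomorph_image {X Y : Type*} [TopologicalSpace X] [TopologicalSpace Y]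
    [T2Space Y] {A : Set X} (hA : IsCompact A) {B : Set Y} {g : X → Y} (hg : ContinuousOn g A)
    (hgi : Set.InjOn g A) (hB : g '' A = B) : Nonempty (A ≃ₜ B) := by
  have : CompactSpace A := isCompact_iff_compactSpace.1 hA
  have hb : Set.BijOn g A B := ⟨fun x hx => hB ▸ Set.mem_image_of_mem g hx, hgi, hB.symm.subset⟩
  exact ⟨Continuous.homeoOfEquivCompactToT2 (f := hb.equiv g)
    ((continuousOn_iff_continuous_domRestrict.1 hg).subtype_mk _)⟩

theorem bary_mapDomain {V W : Type*} [AddCommGroup V] [Module ℝ V] [AddCommGroup W] [Module ℝ W]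
    (f : V → W) (c : V →₀ ℝ) {s : Finset V} (hs : c.support ⊆ s) :
    bary (c.mapDomain f) = ∑ y ∈ s, c y • f y := by
  rw [bary, Finsupp.linearCombination_mapDomain, Finsupp.linearCombination_apply,
    Finsupp.sum_of_support_subset _ hs]
  · rfl
  · simp

theorem mass_mapDomain {V W : Type*} (f : V → W) (c : V →₀ ℝ) :
    mass (c.mapDomain f) = mass c := by
  rw [mass, Finsupp.linearCombination_mapDomain]
  rfl

theorem IsConvexWeight.mapDomain {V W : Type*} [DecidableEq W] (f : V → W) {c : V →₀ ℝ}
    {s : Finset V}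
    (hc : IsConvexWeight c s) : IsConvexWeight (c.mapDomain f) (s.image f) := by
  refine ⟨fun y => ?_, Finsupp.mapDomain_support.trans (Finset.image_subset_image hc.supp), ?_⟩
  · rw [Finsupp.mapDomain, Finsupp.sum, Finsupp.finsetSum_apply]
    refine Finset.sum_nonneg fun i _ => ?_
    rw [Finsupp.single_apply]
    split_ifs
    · exact hc.nonneg i
    · exact le_rfl
  · rw [mass_mapDomain, hc.mass_eq]

theorem TwoComplex.mem_space_iff_weight {N : ℕ} {K : TwoComplex N} {x : E N} :
    x ∈ K.space ↔ ∃ s ∈ K.faces, ∃ c, IsConvexWeight c s ∧ bary c = x := by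
  rw [Geometry.SimplicialComplex.mem_space_iff]
  simp only [mem_convexHull_iff_weight]

/-- Instead of gluing a piecewise linear map, take its graph: the union of the hulls of the lifted
simplices. It is compact, and both coordinate projections are injective on it by uniqueness of
weights, hence homeomorphisms onto the two spaces. -/
theorem IsSimplicialIso.nonempty_homeomorph {N M : ℕ} {f : E N → E M} {K : TwoComplex N}
    {L : TwoComplex M} (h : IsSimplicialIso f K L) : Nonempty (K.space ≃ₜ L.space) := by
  set G : Set (E N × E M) :=
    ⋃ s ∈ K.faces, convexHull ℝ ((s.image fun x => (x, f x) : Finset (E N × E M)) : Set _) with hG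
  have mem : ∀ z, z ∈ G ↔ ∃ s ∈ K.faces, ∃ c, IsConvexWeight c s ∧
      z = (bary c, bary (c.mapDomain f)) := by
    intro z
    simp only [hG, Set.mem_iUnion₂, exists_prop]
    refine exists_congr fun s => and_congr_right fun hs => ?_
    have pair : ∀ c : E N →₀ ℝ, c.support ⊆ s →
        (∑ y ∈ s, c y • (y, f y)) = (bary c, bary (c.mapDomain f)) := by
      intro c hc
      rw [bary_eq_sum hc, bary_mapDomain f c hc]
      ext1 <;> simp [Prod.fst_sum, Prod.snd_sum]
    rw [mem_convexHull_iff_weight]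
    constructor
    · rintro ⟨c, hc, rfl⟩
      refine ⟨c.mapDomain Prod.fst, ?_, ?_⟩
      · have := hc.mapDomain Prod.fst
        rw [Finset.image_image] at this
        simpa [Function.comp_def] using this
      · have h1 : (c.mapDomain Prod.fst).mapDomain (fun x => (x, f x)) = c := by
          rw [← Finsupp.mapDomain_comp]
          conv_rhs => rw [← Finsupp.mapDomain_id (v := c)]
          refine Finsupp.mapDomain_congr fun x hx => ?_
          obtain ⟨y, -, rfl⟩ := Finset.mem_image.1 (hc.supp hx)
          rfl
        have h2 : (c.mapDomain Prod.fst).support ⊆ s := by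
          have := (hc.mapDomain Prod.fst).supp
          rw [Finset.image_image] at this
          simpa [Function.comp_def] using this
        conv_lhs => rw [← h1, bary_mapDomain _ _ h2, pair _ h2]
    · rintro ⟨c, hc, rfl⟩
      refine ⟨c.mapDomain fun x => (x, f x), hc.mapDomain _, ?_⟩
      rw [bary_mapDomain _ _ hc.supp, pair _ hc.supp]
  have hcpt : IsCompact G :=
    K.finite_faces.isCompact_biUnion fun s _ =>
      (Finset.finite_toSet _).isCompact_convexHull (𝕜 := ℝ)
  have hfst : Nonempty (G ≃ₜ K.space) := by
    refine hcpt.nonempty_homeomorph_image continuous_fst.continuousOn ?_ ?_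
    · intro z hz z' hz' hzz
      obtain ⟨s, hs, c, hc, rfl⟩ := (mem z).1 hz
      obtain ⟨t, ht, d, hd, rfl⟩ := (mem z').1 hz'
      have : c = d := K.weight_unique hs ht hc hd hzz
      rw [this]
    · ext x
      rw [TwoComplex.mem_space_iff_weight]
      constructor
      · rintro ⟨z, hz, rfl⟩
        obtain ⟨s, hs, c, hc, rfl⟩ := (mem z).1 hz
        exact ⟨s, hs, c, hc, rfl⟩
      · rintro ⟨s, hs, c, hc, rfl⟩
        exact ⟨_, (mem _).2 ⟨s, hs, c, hc, rfl⟩, rfl⟩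
  have hsnd : Nonempty (G ≃ₜ L.space) := by
    refine hcpt.nonempty_homeomorph_image continuous_snd.continuousOn ?_ ?_
    · intro z hz z' hz' hzz
      obtain ⟨s, hs, c, hc, rfl⟩ := (mem z).1 hz
      obtain ⟨t, ht, d, hd, rfl⟩ := (mem z').1 hz'
      have h1 : c.mapDomain f = d.mapDomain f :=
        L.weight_unique (h.image_mem hs) (h.image_mem ht) (hc.mapDomain f) (hd.mapDomain f) hzz
      have : c = d := by
        refine Finsupp.mapDomain_injOn K.vertices h.injOn ?_ ?_ h1
        · exact (Finset.coe_subset.2 hc.supp).trans (K.subset_vertices hs)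
        · exact (Finset.coe_subset.2 hd.supp).trans (K.subset_vertices ht)
      rw [this]
    · ext x
      rw [TwoComplex.mem_space_iff_weight]
      constructor
      · rintro ⟨z, hz, rfl⟩
        obtain ⟨s, hs, c, hc, rfl⟩ := (mem z).1 hz
        exact ⟨_, h.image_mem hs, _, hc.mapDomain f, rfl⟩
      · rintro ⟨t, ht, d, hd, rfl⟩
        obtain ⟨s, hs, rfl⟩ := (h.mem_iff t).1 ht
        have hd' := mem_convexHull_iff_weight.2 ⟨d, hd, rfl⟩
        have himg : ((s.image f : Finset (E M)) : Set (E M)) = (Prod.snd : E N × E M → E M) ''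
            ((s.image fun x => (x, f x) : Finset (E N × E M)) : Set _) := by
          ext; simp
        rw [himg] at hd'
        have h3 := (LinearMap.snd ℝ (E N) (E M)).image_convexHull
          ((s.image fun x => (x, f x) : Finset (E N × E M)) : Set _)
        rw [LinearMap.coe_snd] at h3
        rw [← h3] at hd'
        obtain ⟨z, hz, hzd⟩ := hd'
        exact ⟨z, Set.mem_biUnion hs hz, hzd⟩
  exact ⟨hfst.some.symm.trans hsnd.some⟩

/-! ### Simplicial isomorphisms, angles and flatness -/

/-- Polarization expresses the inner product of the two arms by the three side lengths. -/
theorem EuclideanGeometry.angle_eq_of_dist_eq {N M : ℕ} {a v b : E N} {a' v' b' : E M}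
    (h1 : dist a' v' = dist a v) (h2 : dist b' v' = dist b v) (h3 : dist a' b' = dist a b) :
    EuclideanGeometry.angle a' v' b' = EuclideanGeometry.angle a v b := by
  rw [dist_eq_norm, dist_eq_norm] at h1 h2
  rw [← dist_sub_right a b v, ← dist_sub_right a' b' v', dist_eq_norm, dist_eq_norm] at h3
  simp only [EuclideanGeometry.angle, InnerProductGeometry.angle, vsub_eq_sub,
    real_inner_eq_norm_mul_self_add_norm_mul_self_sub_norm_sub_mul_self_div_two, h1, h2, h3]

theorem interiorAngle_image {N M : ℕ} {f : E N → E M} {s : Finset (E N)} {v : E N} (hv : v ∈ s)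
    (hf : Set.InjOn f s) : interiorAngle (f v) (s.image f) =
      (∑ p ∈ (s.erase v).offDiag, EuclideanGeometry.angle (f p.1) (f v) (f p.2)) / 2 /
        (2 * Real.pi) := by
  rw [interiorAngle]
  congr 2
  symm
  refine Finset.sum_nbij (fun p => (f p.1, f p.2)) ?_ ?_ ?_ ?_
  · intro p hp
    simp only [Finset.mem_offDiag, Finset.mem_erase] at hp ⊢
    obtain ⟨⟨h1, h2⟩, ⟨h3, h4⟩, h5⟩ := hp
    exact ⟨⟨fun h => h1 (hf h2 hv h), Finset.mem_image_of_mem f h2⟩,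
      ⟨fun h => h3 (hf h4 hv h), Finset.mem_image_of_mem f h4⟩, fun h => h5 (hf h2 h4 h)⟩
  · intro p hp q hq hpq
    simp only [Finset.coe_offDiag, Set.mem_offDiag, Finset.coe_erase, Set.mem_sdiff,
      Finset.mem_coe] at hp hq
    have h1 := congrArg Prod.fst hpq
    have h2 := congrArg Prod.snd hpq
    exact Prod.ext (hf hp.1.1 hq.1.1 h1) (hf hp.2.1.1 hq.2.1.1 h2)
  · rintro ⟨a, b⟩ hp
    simp only [Finset.coe_offDiag, Set.mem_offDiag, Finset.coe_erase, Set.mem_sdiff,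
      Finset.mem_coe, Finset.mem_image, Set.mem_singleton_iff] at hp
    obtain ⟨⟨⟨a, ha, rfl⟩, h2⟩, ⟨⟨b, hb, rfl⟩, h4⟩, h5⟩ := hp
    refine ⟨(a, b), ?_, rfl⟩
    simp only [Finset.coe_offDiag, Set.mem_offDiag, Finset.coe_erase, Set.mem_sdiff,
      Finset.mem_coe, Set.mem_singleton_iff]
    exact ⟨⟨ha, fun h => h2 (h ▸ rfl)⟩, ⟨hb, fun h => h4 (h ▸ rfl)⟩, fun h => h5 (h ▸ rfl)⟩
  · intro p _
    rfl

theorem interiorAngle_image_of_dist {N M : ℕ} {f : E N → E M} {s : Finset (E N)} {v : E N}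
    (hv : v ∈ s) (hf : Set.InjOn f s) (hd : ∀ x ∈ s, ∀ y ∈ s, dist (f x) (f y) = dist x y) :
    interiorAngle (f v) (s.image f) = interiorAngle v s := by
  rw [interiorAngle_image hv hf, interiorAngle]
  congr 2
  refine Finset.sum_congr rfl fun p hp => ?_
  simp only [Finset.mem_offDiag, Finset.mem_erase] at hp
  exact EuclideanGeometry.angle_eq_of_dist_eq (hd _ hp.1.2 _ hv) (hd _ hp.2.1.2 _ hv)
    (hd _ hp.1.2 _ hp.2.1.2)

/-- The angle is continuous where both arms are nonzero, which holds in the limit because `v` is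
erased from `s`. -/
theorem tendsto_interiorAngle_image {N : ℕ} {f : ℕ → E N → E N} {s : Finset (E N)} {v : E N}
    (hv : v ∈ s) (hf : ∀ n, Set.InjOn (f n) s)
    (hlim : ∀ x ∈ s, Tendsto (fun n => f n x) atTop (𝓝 x)) :
    Tendsto (fun n => interiorAngle (f n v) (s.image (f n))) atTop (𝓝 (interiorAngle v s)) := by
  have key : ∀ p ∈ (s.erase v).offDiag,
      Tendsto (fun n => EuclideanGeometry.angle (f n p.1) (f n v) (f n p.2)) atTop
        (𝓝 (EuclideanGeometry.angle p.1 v p.2)) := by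
    intro p hp
    rw [Finset.mem_offDiag, Finset.mem_erase, Finset.mem_erase] at hp
    have h1 : Tendsto (fun n => (f n p.1, f n v, f n p.2)) atTop (𝓝 (p.1, v, p.2)) :=
      (hlim _ hp.1.2).prodMk_nhds ((hlim _ hv).prodMk_nhds (hlim _ hp.2.1.2))
    have h2 : ContinuousAt (fun y : E N × E N × E N => EuclideanGeometry.angle y.1 y.2.1 y.2.2)
        (p.1, v, p.2) := EuclideanGeometry.continuousAt_angle hp.1.1 hp.2.1.1
    exact Tendsto.comp (f := fun n => (f n p.1, f n v, f n p.2)) h2 h1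
  have h3 := ((tendsto_finsetSum _ key).div_const 2).div_const (2 * Real.pi)
  exact h3.congr fun n => (interiorAngle_image hv (hf n)).symm

theorem TwoComplex.mem_star_of_mem {N : ℕ} {K : TwoComplex N} {v : E N} {t : Finset (E N)}
    (ht : t ∈ K.faces) (hv : v ∈ t) : t ∈ (K.star v).faces :=
  ⟨ht, by rwa [Finset.insert_eq_of_mem hv]⟩

theorem IsSimplicialIso.sum_faces_at {N M : ℕ} {f : E N → E M} {K : TwoComplex N}
    {L : TwoComplex M} {v : E N} (hv : v ∈ K.vertices)
    (h : IsSimplicialIso f (K.star v) (L.star (f v))) (g : Finset (E M) → ℝ) :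
    ∑ t ∈ L.simplices with f v ∈ t, g t = ∑ s ∈ K.simplices with v ∈ s, g (s.image f) := by
  have hv' : v ∈ (K.star v).vertices := K.mem_star_vertices ⟨v, hv⟩
  symm
  refine Finset.sum_nbij (fun s => s.image f) ?_ ?_ ?_ fun _ _ => rfl
  · intro s hs
    simp only [Finset.mem_filter, TwoComplex.mem_simplices] at hs ⊢
    exact ⟨(h.image_mem (TwoComplex.mem_star_of_mem hs.1 hs.2)).1, Finset.mem_image_of_mem f hs.2⟩
  · intro s hs t ht hst
    simp only [Finset.coe_filter, Set.mem_ofPred_eq, TwoComplex.mem_simplices] at hs ht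
    exact Finset.image_injOn_subset h.injOn
      ((K.star v).subset_vertices (TwoComplex.mem_star_of_mem hs.1 hs.2))
      ((K.star v).subset_vertices (TwoComplex.mem_star_of_mem ht.1 ht.2)) hst
  · intro t ht
    simp only [Finset.coe_filter, Set.mem_ofPred_eq, TwoComplex.mem_simplices] at ht
    obtain ⟨s, hs, rfl⟩ := (h.mem_iff t).1 (TwoComplex.mem_star_of_mem ht.1 ht.2)
    refine ⟨s, ?_, rfl⟩
    simp only [Finset.coe_filter, Set.mem_ofPred_eq, TwoComplex.mem_simplices]
    exact ⟨hs.1, (h.mem_image_iff hv' hs).1 ht.2⟩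

theorem angleSum_eq_sum {N : ℕ} (K : TwoComplex N) (v : K.vertices) :
    angleSum K v = ∑ t ∈ K.simplices with (v : E N) ∈ t,
      if t.card = 3 then interiorAngle (v : E N) t else 0 := by
  rw [angleSum, ← Finset.sum_filter, Finset.filter_filter]

theorem flatness_congr (c : HomeoType → ℝ) {X Y : Type} [TopologicalSpace X] [TopologicalSpace Y]
    (h : Nonempty (X ≃ₜ Y)) : flatness c X = flatness c Y := by
  obtain ⟨h⟩ := h
  have key : ∀ m, Nonempty (X ≃ₜ SuspendedPoints m) ↔ Nonempty (Y ≃ₜ SuspendedPoints m) :=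
    fun m => ⟨fun ⟨e⟩ => ⟨h.symm.trans e⟩, fun ⟨e⟩ => ⟨h.trans e⟩⟩
  unfold flatness
  simp only [key]
  split_ifs
  · rfl
  · congr 1
    exact Quotient.sound ⟨TopCat.isoOfHomeo h⟩

/-! ### Isometry invariance and continuity of the two curvatures -/

namespace IsSimplicialIso

variable {N M : ℕ} {f : E N → E M} {K : TwoComplex N} {L : TwoComplex M}

theorem injOn_face {v : E N} (h : IsSimplicialIso f (K.star v) (L.star (f v)))
    {s : Finset (E N)} (hs : s ∈ K.faces) (hvs : v ∈ s) : Set.InjOn f s :=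
  h.injOn.mono ((K.star v).subset_vertices (TwoComplex.mem_star_of_mem hs hvs))

/-- Pulling the sum back to the simplices at `v` leaves the metric of `L` visible only in the
angles. An isometry then changes no term, and along a convergent sequence the index set of the sum
is fixed. -/
theorem standardCurvature_eq {v : E N} (hv : v ∈ K.vertices) (hw : f v ∈ L.vertices)
    (h : IsSimplicialIso f (K.star v) (L.star (f v))) :
    standardCurvature L ⟨f v, hw⟩ = ∑ s ∈ K.simplices with v ∈ s, (-1 : ℝ) ^ (s.card - 1) *
      (if s.card = 1 then 1 else if s.card = 2 then 1 / 2
        else 1 / 2 - interiorAngle (f v) (s.image f)) := by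
  rw [standardCurvature, h.sum_faces_at hv]
  refine Finset.sum_congr rfl fun s hs => ?_
  simp only [Finset.mem_filter, TwoComplex.mem_simplices] at hs
  rw [exteriorAngle, Finset.card_image_of_injOn (h.injOn_face hs.1 hs.2)]

theorem generalizedAngleDefect_eq (c : HomeoType → ℝ) {v : E N} (hv : v ∈ K.vertices)
    (hw : f v ∈ L.vertices) (h : IsSimplicialIso f (K.star v) (L.star (f v))) :
    generalizedAngleDefect c L ⟨f v, hw⟩ = flatness c (K.link v).space -
      ∑ s ∈ K.simplices with v ∈ s,
        if s.card = 3 then interiorAngle (f v) (s.image f) else 0 := by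
  rw [generalizedAngleDefect, angleSum_eq_sum, h.sum_faces_at hv,
    flatness_congr c (h.link_of_star hv).nonempty_homeomorph]
  congr 1
  refine Finset.sum_congr rfl fun s hs => ?_
  simp only [Finset.mem_filter, TwoComplex.mem_simplices] at hs
  rw [Finset.card_image_of_injOn (h.injOn_face hs.1 hs.2)]

end IsSimplicialIso

theorem standardCurvature_invariantUnderStarIsometry :
    standardCurvature.InvariantUnderStarIsometry := by
  rintro N M K L ⟨v, hv⟩ ⟨w, hw⟩ h
  obtain ⟨f, rfl, hf, hd⟩ := starIsometric_iff.1 h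
  rw [hf.standardCurvature_eq hv, standardCurvature]
  refine Finset.sum_congr rfl fun s hs => ?_
  simp only [Finset.mem_filter, TwoComplex.mem_simplices] at hs
  rw [interiorAngle_image_of_dist hs.2 (hf.injOn_face hs.1 hs.2)
    (hd s (TwoComplex.mem_star_of_mem hs.1 hs.2)), exteriorAngle]

theorem generalizedAngleDefect_invariantUnderStarIsometry (c : HomeoType → ℝ) :
    (generalizedAngleDefect c).InvariantUnderStarIsometry := by
  rintro N M K L ⟨v, hv⟩ ⟨w, hw⟩ h
  obtain ⟨f, rfl, hf, hd⟩ := starIsometric_iff.1 h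
  rw [hf.generalizedAngleDefect_eq c hv, generalizedAngleDefect, angleSum_eq_sum]
  congr 1
  refine Finset.sum_congr rfl fun s hs => ?_
  simp only [Finset.mem_filter, TwoComplex.mem_simplices] at hs
  rw [interiorAngle_image_of_dist hs.2 (hf.injOn_face hs.1 hs.2)
    (hd s (TwoComplex.mem_star_of_mem hs.1 hs.2))]

theorem tendsto_toFun {N : ℕ} {K : TwoComplex N} {Ks : ℕ → TwoComplex N}
    {e : ∀ n, SimplicialEquiv K (Ks n)}
    (h : ∀ v : K.vertices, Tendsto (fun n => ((e n).toEquiv v : E N)) atTop (𝓝 (v : E N)))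
    {s : Finset (E N)} (hs : s ∈ K.faces) :
    ∀ x ∈ s, Tendsto (fun n => (e n).toFun x) atTop (𝓝 x) := by
  intro x hx
  have hx' := K.subset_vertices hs hx
  simpa only [← SimplicialEquiv.toFun_apply] using h ⟨x, hx'⟩

theorem SimplicialEquiv.apply_eq {N M : ℕ} {K : TwoComplex N} {L : TwoComplex M}
    (e : SimplicialEquiv K L) (v : K.vertices) :
    e.toEquiv v = ⟨e.toFun v, e.isSimplicialIso.mem_vertices v.2⟩ :=
  Subtype.ext (e.toFun_apply v).symm

theorem standardCurvature_isContinuous : standardCurvature.IsContinuous := by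
  rintro N K Ks e h ⟨v, hv⟩
  have := fun n => (((e n).isSimplicialIso.star hv).standardCurvature_eq hv
    ((e n).isSimplicialIso.mem_vertices hv))
  simp only [SimplicialEquiv.apply_eq, this]
  rw [standardCurvature]
  refine tendsto_finsetSum _ fun s hs => ?_
  simp only [Finset.mem_filter, TwoComplex.mem_simplices] at hs
  unfold exteriorAngle
  refine Tendsto.const_mul _ ?_
  split_ifs
  · exact tendsto_const_nhds
  · exact tendsto_const_nhds
  · exact (tendsto_interiorAngle_image hs.2
      (fun n => ((e n).isSimplicialIso.star hv).injOn_face hs.1 hs.2)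
      (tendsto_toFun h hs.1)).const_sub _

theorem generalizedAngleDefect_isContinuous (c : HomeoType → ℝ) :
    (generalizedAngleDefect c).IsContinuous := by
  rintro N K Ks e h ⟨v, hv⟩
  have := fun n => (((e n).isSimplicialIso.star hv).generalizedAngleDefect_eq c hv
    ((e n).isSimplicialIso.mem_vertices hv))
  simp only [SimplicialEquiv.apply_eq, this]
  rw [generalizedAngleDefect, angleSum_eq_sum]
  refine Tendsto.const_sub _ (tendsto_finsetSum _ fun s hs => ?_)
  simp only [Finset.mem_filter, TwoComplex.mem_simplices] at hs
  split_ifs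
  · exact tendsto_interiorAngle_image hs.2
      (fun n => ((e n).isSimplicialIso.star hv).injOn_face hs.1 hs.2)
      (tendsto_toFun h hs.1)
  · exact tendsto_const_nhds

/-! ### The Descartes-Gauss-Bonnet Theorem -/

theorem interiorAngle_triple {N : ℕ} {v a b : E N} (hva : v ≠ a) (hvb : v ≠ b) (hab : a ≠ b) :
    interiorAngle v {v, a, b} = EuclideanGeometry.angle a v b / (2 * Real.pi) := by
  have h1 : ({v, a, b} : Finset (E N)).erase v = {a, b} := by
    rw [Finset.erase_insert]
    simp [hva, hvb]
  have h2 : ({a, b} : Finset (E N)).offDiag = {(a, b), (b, a)} := by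
    ext ⟨x, y⟩
    simp only [Finset.mem_offDiag, Finset.mem_insert, Finset.mem_singleton, Prod.mk.injEq]
    constructor
    · rintro ⟨rfl | rfl, rfl | rfl, h⟩ <;> simp_all
    · rintro (⟨rfl, rfl⟩ | ⟨rfl, rfl⟩) <;> simp [hab, hab.symm]
  rw [interiorAngle, h1, h2, Finset.sum_pair (by simp [hab]), EuclideanGeometry.angle_comm b v a]
  ring

theorem sum_interiorAngle {N : ℕ} {t : Finset (E N)} (ht : t.card = 3) :
    ∑ v ∈ t, interiorAngle v t = 1 / 2 := by
  obtain ⟨a, b, c, hab, hac, hbc, rfl⟩ := Finset.card_eq_three.1 ht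
  rw [Finset.sum_insert (by simp [hab, hac]), Finset.sum_pair hbc, interiorAngle_triple hab hac hbc]
  have h1 : ({a, b, c} : Finset (E N)) = {b, c, a} := by ext; simp; tauto
  have h2 : ({a, b, c} : Finset (E N)) = {c, a, b} := by ext; simp; tauto
  have e2 : interiorAngle b {a, b, c} = EuclideanGeometry.angle c b a / (2 * Real.pi) := by
    rw [h1, interiorAngle_triple hbc hab.symm hac.symm]
  have e3 : interiorAngle c {a, b, c} = EuclideanGeometry.angle a c b / (2 * Real.pi) := by
    rw [h2, interiorAngle_triple hac.symm hbc.symm hab]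
  rw [e2, e3, ← add_div, ← add_div]
  have := EuclideanGeometry.angle_add_angle_add_angle_eq_pi (p₁ := b) (p₂ := a) c hab
  have hpi := Real.pi_ne_zero
  field_simp
  linarith [EuclideanGeometry.angle_comm b a c, EuclideanGeometry.angle_comm a c b,
    EuclideanGeometry.angle_comm c b a]

theorem TwoComplex.sum_vertices_sum_faces {N : ℕ} (K : TwoComplex N)
    (g : E N → Finset (E N) → ℝ) :
    ∑ v : K.vertices, ∑ t ∈ K.simplices with (v : E N) ∈ t, g v t =
      ∑ t ∈ K.simplices, ∑ v ∈ t, g v t := by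
  have h1 : ∑ v : K.vertices, ∑ t ∈ K.simplices with (v : E N) ∈ t, g v t =
      ∑ v ∈ K.finite_vertices.toFinset, ∑ t ∈ K.simplices with v ∈ t, g v t := by
    symm
    refine Finset.sum_subtype _ ?_ _
    intro x
    simp
  rw [h1]
  simp only [Finset.sum_filter]
  rw [Finset.sum_comm]
  refine Finset.sum_congr rfl fun t ht => ?_
  rw [← Finset.sum_filter]
  congr 1
  ext x
  simp only [Finset.mem_filter, Set.Finite.mem_toFinset, and_iff_right_iff_imp]
  exact fun hx => K.subset_vertices (mem_simplices.1 ht) hx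

theorem TwoComplex.card_cases (K : TwoComplex N) {t : Finset (E N)} (ht : t ∈ K.faces) :
    t.card = 1 ∨ t.card = 2 ∨ t.card = 3 := by
  have h1 := Finset.card_pos.2 (K.nonempty_of_mem ht)
  have h2 := K.card_le_three t ht
  omega

/-- After exchanging the sums, the exterior angles of each simplex add up to one: `1`, `2 · 1/2`,
and `3/2 - 1/2` by the angle sum of a triangle. -/
theorem standardCurvature_satisfiesDGB : standardCurvature.SatisfiesDGB eulerChar := by
  intro N K
  unfold standardCurvature
  rw [K.sum_vertices_sum_faces (fun v t => (-1 : ℝ) ^ (t.card - 1) * exteriorAngle v t), eulerChar]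
  refine Finset.sum_congr rfl fun t ht => ?_
  rw [← Finset.mul_sum]
  suffices h : ∑ v ∈ t, exteriorAngle v t = 1 by rw [h, mul_one]
  unfold exteriorAngle
  rcases K.card_cases (TwoComplex.mem_simplices.1 ht) with h | h | h
  · simp [h]
  · simp [h]
  · have h' : ∑ v ∈ t, (1 / 2 - interiorAngle v t) = 1 := by
      rw [Finset.sum_sub_distrib, sum_interiorAngle h]
      norm_num [h]
    simpa [h] using h'

theorem TwoComplex.sum_order {N : ℕ} (K : TwoComplex N) :
    ∑ e ∈ K.simplices with e.card = 2, (K.order e : ℝ) =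
      ∑ t ∈ K.simplices with t.card = 3, (3 : ℝ) := by
  have h1 : ∀ e, (K.order e : ℝ) =
      ∑ t ∈ K.simplices with t.card = 3, if e ⊆ t then (1 : ℝ) else 0 := by
    intro e
    rw [order, ← Finset.sum_filter, Finset.filter_filter]
    simp [and_comm]
  simp only [h1]
  rw [Finset.sum_comm]
  refine Finset.sum_congr rfl fun t ht => ?_
  simp only [Finset.mem_filter, mem_simplices] at ht
  rw [← Finset.sum_filter, Finset.filter_filter]
  have : (K.simplices.filter fun e => e.card = 2 ∧ e ⊆ t) = t.powersetCard 2 := by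
    ext e
    simp only [Finset.mem_filter, mem_simplices, Finset.mem_powersetCard]
    constructor
    · tauto
    · rintro ⟨h1, h2⟩
      exact ⟨K.down_closed ht.1 h1 (Finset.card_pos.1 (by omega)), h2, h1⟩
  rw [this]
  simp [Finset.card_powersetCard, ht.2]

/-- The flatness terms agree on both sides. All angles together give half the number of triangles,
and the half orders give three halves of it, as each triangle has three edges; the difference is the
count of triangles. -/
theorem generalizedAngleDefect_satisfiesDGB (c : HomeoType → ℝ) :
    (generalizedAngleDefect c).SatisfiesDGB (stratifiedEulerChar c) := by
  intro N K
  have h1 : ∑ v : K.vertices, angleSum K v = ∑ t ∈ K.simplices with t.card = 3, (1 / 2 : ℝ) := by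
    simp only [angleSum_eq_sum]
    rw [K.sum_vertices_sum_faces (fun v t => if t.card = 3 then interiorAngle v t else 0),
      Finset.sum_filter]
    refine Finset.sum_congr rfl fun t _ => ?_
    split_ifs with h
    · exact sum_interiorAngle h
    · simp
  unfold generalizedAngleDefect stratifiedEulerChar
  have h2 : ∑ e ∈ K.simplices with e.card = 2, (K.order e : ℝ) / 2 =
      ∑ t ∈ K.simplices with t.card = 3, (3 / 2 : ℝ) := by
    rw [← Finset.sum_div, K.sum_order, Finset.sum_div]
  rw [Finset.sum_sub_distrib, h1, h2]
  simp only [Finset.sum_const, nsmul_eq_mul]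
  ring

/-! ### Radial projection to the link -/

section Radial

variable {V : Type*} [AddCommGroup V] [Module ℝ V] [DecidableEq V]

/-- Drop the weight at `v` and divide the rest by its mass `r`. Mass zero would put the point at
`v`. -/
theorem IsConvexWeight.exists_radial {c : V →₀ ℝ} {s : Finset V} (hc : IsConvexWeight c s) {v : V}
    (hv : bary c ≠ v) : ∃ (d : V →₀ ℝ) (r : ℝ), IsConvexWeight d (s.erase v) ∧ 0 < r ∧ r ≤ 1 ∧
      bary c - v = r • (bary d - v) := by
  have hdec : Finsupp.single v (c v) + c.erase v = c := Finsupp.single_add_erase v c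
  have hb : c v • v + bary (c.erase v) = bary c := by
    conv_rhs => rw [← hdec, map_add, bary_single]
  have hm : c v + mass (c.erase v) = 1 := by
    conv_rhs => rw [← hc.mass_eq, ← hdec, map_add, mass_single]
  have hsupp : (c.erase v).support ⊆ s.erase v := by
    rw [Finsupp.support_erase]
    exact Finset.erase_subset_erase v hc.supp
  have hnn : ∀ y, 0 ≤ c.erase v y := by
    intro y
    rw [Finsupp.erase_apply]
    split_ifs
    · exact le_rfl
    · exact hc.nonneg y
  have hsum := mass_eq_sum hsupp
  rcases (Finset.sum_nonneg fun y (_ : y ∈ s.erase v) => hnn y).eq_or_lt with hz | hz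
  · exfalso
    have h0 := (Finset.sum_eq_zero_iff_of_nonneg fun y _ => hnn y).1 hz.symm
    rw [← hsum] at hz
    apply hv
    have h1 : c v = 1 := by linarith
    rw [← hb, h1, one_smul, bary_eq_sum hsupp, Finset.sum_eq_zero, add_zero]
    intro y hy
    rw [h0 y hy, zero_smul]
  · rw [← hsum] at hz
    refine ⟨(mass (c.erase v))⁻¹ • c.erase v, mass (c.erase v),
      ⟨fun y => mul_nonneg (inv_nonneg.2 hz.le) (hnn y), Finsupp.support_smul.trans hsupp, ?_⟩,
      hz, by linarith [hc.nonneg v], ?_⟩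
    · rw [map_smul, smul_eq_mul, inv_mul_cancel₀ hz.ne']
    · rw [map_smul, smul_sub, smul_smul, mul_inv_cancel₀ hz.ne', one_smul, ← hb]
      have : mass (c.erase v) = 1 - c v := by linarith
      rw [this, sub_smul, one_smul]
      abel

theorem exists_radial_of_mem_convexHull {s : Finset V} {v x : V}
    (hx : x ∈ convexHull ℝ (s : Set V)) (hv : x ≠ v) :
    ∃ y ∈ convexHull ℝ ((s.erase v : Finset V) : Set V), ∃ r : ℝ, 0 < r ∧ r ≤ 1 ∧
      x - v = r • (y - v) := by
  obtain ⟨c, hc, rfl⟩ := mem_convexHull_iff_weight.1 hx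
  obtain ⟨d, r, hd, h1, h2, h3⟩ := hc.exists_radial hv
  exact ⟨_, mem_convexHull_iff_weight.2 ⟨d, hd, rfl⟩, r, h1, h2, h3⟩

end Radial

namespace TwoComplex

variable {N : ℕ} {K J : TwoComplex N} {v : E N}

/-- A ray from `v` meets the link at most once. For `r ≤ 1` the point `x` has weights on `t`
together with `v`, with weight `1 - r` at `v`; its weights on `s` give `v` weight zero, so
uniqueness in `K` forces `r = 1`. For `r ≥ 1` exchange the two points. -/
theorem link_ray_unique {s t : Finset (E N)} (hs : s ∈ (K.link v).faces)
    (ht : t ∈ (K.link v).faces) {x y : E N} (hx : x ∈ convexHull ℝ (s : Set (E N)))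
    (hy : y ∈ convexHull ℝ (t : Set (E N))) {r : ℝ} (hr : 0 < r) (h : x - v = r • (y - v)) :
    x = y := by
  have key : ∀ {s t : Finset (E N)}, s ∈ (K.link v).faces → t ∈ (K.link v).faces →
      ∀ {c d : E N →₀ ℝ}, IsConvexWeight c s → IsConvexWeight d t → ∀ {r : ℝ}, 0 < r → r ≤ 1 →
      bary c - v = r • (bary d - v) → r = 1 := by
    intro s t hs ht c d hc hd r hr hr1 h
    rw [mem_link] at hs ht
    have he : IsConvexWeight (Finsupp.single v (1 - r) + r • d) (insert v t) := by
      refine ⟨fun z => ?_, ?_, ?_⟩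
      · rw [Finsupp.add_apply, Finsupp.smul_apply, Finsupp.single_apply]
        have := mul_nonneg hr.le (hd.nonneg z)
        split_ifs
        · exact add_nonneg (by linarith) this
        · simpa using this
      · refine Finsupp.support_add.trans (Finset.union_subset ?_ ?_)
        · exact Finsupp.support_single_subset.trans (by simp)
        · exact (Finsupp.support_smul.trans hd.supp).trans (Finset.subset_insert _ _)
      · rw [map_add, map_smul, mass_single, hd.mass_eq, smul_eq_mul]
        ring
    have hb : bary c = bary (Finsupp.single v (1 - r) + r • d) := by
      rw [map_add, map_smul, bary_single, sub_smul, one_smul, ← sub_add_cancel (bary c) v, h,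
        smul_sub]
      abel
    have hce := K.weight_unique hs.1 ht.2.2 hc he hb
    have h0 : c v = 0 := hc.eq_zero hs.2.1
    have h1 : d v = 0 := hd.eq_zero ht.2.1
    rw [hce, Finsupp.add_apply, Finsupp.smul_apply, h1, Finsupp.single_eq_same] at h0
    simp at h0
    linarith
  obtain ⟨c, hc, rfl⟩ := mem_convexHull_iff_weight.1 hx
  obtain ⟨d, hd, rfl⟩ := mem_convexHull_iff_weight.1 hy
  have hr1 : r = 1 := by
    rcases le_total r 1 with h1 | h1
    · exact key hs ht hc hd hr h1 h
    · have h2 := key ht hs hd hc (inv_pos.2 hr) (inv_le_one_of_one_le₀ h1)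
        (by rw [h, smul_smul, inv_mul_cancel₀ hr.ne', one_smul])
      exact inv_eq_one.1 h2
  rw [hr1, one_smul] at h
  exact sub_left_inj.1 h

theorem notMem_link_space {x : E N} (hv : v ∈ K.vertices) (hx : x ∈ (K.link v).space) : x ≠ v := by
  rintro rfl
  obtain ⟨s, hs, hxs⟩ := Geometry.SimplicialComplex.mem_space_iff.1 hx
  exact hs.2.1 ((K.vertex_mem_convexHull_iff hv hs.1).1 hxs)

/-- There are finitely many simplices, so one of them contains points of the ray arbitrarily close
to `v`. Being closed, it contains `v`, which is therefore one of its vertices. -/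
theorem exists_face_of_ray (hv : v ∈ K.vertices) {d : E N}
    (h : ∀ᶠ r : ℝ in 𝓝[>] 0, v + r • d ∈ K.space) :
    ∃ s ∈ K.faces, v ∈ s ∧ ∃ r : ℝ, 0 < r ∧ v + r • d ∈ convexHull ℝ (s : Set (E N)) := by
  have h1 : ∃ s ∈ K.faces, ∃ᶠ r : ℝ in 𝓝[>] 0, v + r • d ∈ convexHull ℝ (s : Set (E N)) := by
    by_contra! hcon
    have h2 : ∀ᶠ r : ℝ in 𝓝[>] 0, ∀ s ∈ K.faces, v + r • d ∉ convexHull ℝ (s : Set (E N)) :=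
      (eventually_all_finite K.finite_faces).2 fun s hs => hcon s hs
    obtain ⟨r, hr1, hr2⟩ := (h.and h2).exists
    obtain ⟨s, hs, hrs⟩ := Geometry.SimplicialComplex.mem_space_iff.1 hr1
    exact hr2 s hs hrs
  obtain ⟨s, hs, hfr⟩ := h1
  have hlim : Tendsto (fun r : ℝ => v + r • d) (𝓝[>] 0) (𝓝 v) := by
    have : Tendsto (fun r : ℝ => v + r • d) (𝓝 0) (𝓝 (v + (0 : ℝ) • d)) :=
      (continuous_const.add (continuous_id.smul continuous_const)).tendsto 0
    rw [zero_smul, add_zero] at this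
    exact this.mono_left nhdsWithin_le_nhds
  have hclosed : IsClosed (convexHull ℝ (s : Set (E N))) :=
    (s.finite_toSet.isCompact_convexHull (𝕜 := ℝ)).isClosed
  refine ⟨s, hs, (K.vertex_mem_convexHull_iff hv hs).1
    (hclosed.mem_of_frequently_of_tendsto hfr hlim), ?_⟩
  obtain ⟨r, hr1, hr2⟩ := (hfr.and_eventually self_mem_nhdsWithin).exists
  exact ⟨r, hr2, hr1⟩

theorem mem_link_erase {s : Finset (E N)} (hs : s ∈ K.faces) (hv : v ∈ s) {y : E N}
    (hy : y ∈ convexHull ℝ ((s.erase v : Finset (E N)) : Set (E N))) :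
    s.erase v ∈ (K.link v).faces := by
  have hne : (s.erase v).Nonempty := by
    by_contra h
    rw [Finset.not_nonempty_iff_eq_empty] at h
    simp [h] at hy
  refine ⟨K.down_closed hs (Finset.erase_subset _ _) hne, Finset.notMem_erase _ _, ?_⟩
  rwa [Finset.insert_erase hv]

/-- The unit vectors that point from `v` into the set `X`. -/
def directions (X : Set (E N)) (v : E N) : Set (E N) :=
  {d | ‖d‖ = 1 ∧ ∀ᶠ r : ℝ in 𝓝[>] 0, v + r • d ∈ X}

/-- Normalizing `x - v` identifies the link with a set that refers to the underlying space only.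
This is why the homeomorphism type of the link survives subdivision. -/
theorem link_homeomorph_directions (hv : v ∈ K.vertices) :
    Nonempty ((K.link v).space ≃ₜ directions K.space v) := by
  have hcpt : IsCompact (K.link v).space :=
    (K.link v).finite_faces.isCompact_biUnion fun s _ =>
      s.finite_toSet.isCompact_convexHull (𝕜 := ℝ)
  refine hcpt.nonempty_homeomorph_image (g := fun x => ‖x - v‖⁻¹ • (x - v)) ?_ ?_ ?_
  · have h1 : ContinuousOn (fun x : E N => ‖x - v‖) (K.link v).space := by fun_prop
    have h2 : ContinuousOn (fun x : E N => x - v) (K.link v).space := by fun_prop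
    refine (h1.inv₀ fun x hx => ?_).smul h2
    rw [norm_ne_zero_iff, sub_ne_zero]
    exact notMem_link_space hv hx
  · intro x hx y hy hxy
    have hx0 : 0 < ‖x - v‖ := norm_pos_iff.2 (sub_ne_zero.2 (notMem_link_space hv hx))
    have hy0 : 0 < ‖y - v‖ := norm_pos_iff.2 (sub_ne_zero.2 (notMem_link_space hv hy))
    obtain ⟨s, hs, hxs⟩ := Geometry.SimplicialComplex.mem_space_iff.1 hx
    obtain ⟨t, ht, hyt⟩ := Geometry.SimplicialComplex.mem_space_iff.1 hy
    refine link_ray_unique hs ht hxs hyt (r := ‖x - v‖ * ‖y - v‖⁻¹)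
      (mul_pos hx0 (inv_pos.2 hy0)) ?_
    have hxy' : ‖x - v‖⁻¹ • (x - v) = ‖y - v‖⁻¹ • (y - v) := hxy
    rw [mul_smul, ← hxy', smul_smul, mul_inv_cancel₀ hx0.ne', one_smul]
  · ext d
    constructor
    · rintro ⟨x, hx, rfl⟩
      have hx0 : 0 < ‖x - v‖ := norm_pos_iff.2 (sub_ne_zero.2 (notMem_link_space hv hx))
      refine ⟨?_, ?_⟩
      · rw [norm_smul, norm_inv, norm_norm, inv_mul_cancel₀ hx0.ne']
      · obtain ⟨s, hs, hxs⟩ := Geometry.SimplicialComplex.mem_space_iff.1 hx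
        have : Set.Ioo (0 : ℝ) ‖x - v‖ ∈ 𝓝[>] (0 : ℝ) := Ioo_mem_nhdsGT hx0
        filter_upwards [this] with r hr
        refine Geometry.SimplicialComplex.mem_space_iff.2 ⟨_, hs.2.2, ?_⟩
        have hv' : v ∈ convexHull ℝ ((insert v s : Finset (E N)) : Set (E N)) :=
          subset_convexHull ℝ _ (by simp)
        have hx' : x ∈ convexHull ℝ ((insert v s : Finset (E N)) : Set (E N)) :=
          convexHull_mono (by simp) hxs
        rw [smul_smul]
        refine (convex_convexHull ℝ _).add_smul_sub_mem hv' hx' ⟨?_, ?_⟩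
        · exact (mul_pos hr.1 (inv_pos.2 hx0)).le
        · rw [← div_eq_mul_inv]
          exact (div_le_one hx0).2 hr.2.le
    · rintro ⟨hd, h⟩
      obtain ⟨s, hs, hvs, r, hr, hrs⟩ := exists_face_of_ray hv h
      have hne : v + r • d ≠ v := by
        rw [Ne, add_eq_left, smul_eq_zero, not_or]
        exact ⟨hr.ne', fun h0 => by simp [h0] at hd⟩
      obtain ⟨y, hy, l, hl, -, hly⟩ := exists_radial_of_mem_convexHull hrs hne
      refine ⟨y, Geometry.SimplicialComplex.mem_space_iff.2 ⟨_, mem_link_erase hs hvs hy, hy⟩, ?_⟩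
      rw [add_sub_cancel_left] at hly
      have h1 : y - v = (l⁻¹ * r) • d := by
        rw [mul_smul, hly, smul_smul, inv_mul_cancel₀ hl.ne', one_smul]
      have h2 : 0 < l⁻¹ * r := mul_pos (inv_pos.2 hl) hr
      change ‖y - v‖⁻¹ • (y - v) = d
      rw [h1, norm_smul, hd, mul_one, Real.norm_of_nonneg h2.le, smul_smul,
        inv_mul_cancel₀ h2.ne', one_smul]

theorem link_homeomorph_of_space_eq (h : J.space = K.space) (hK : v ∈ K.vertices)
    (hJ : v ∈ J.vertices) : Nonempty ((K.link v).space ≃ₜ (J.link v).space) := by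
  obtain ⟨e⟩ := link_homeomorph_directions hK
  obtain ⟨e'⟩ := link_homeomorph_directions hJ
  rw [h] at e'
  exact ⟨e.trans e'.symm⟩

/-- If a point in the relative interior of a simplex of a subdivision lies in a simplex `t` of `K`,
then the whole simplex lies in `t`. -/
theorem IsSubdivision.subset_of_interior (h : J.IsSubdivision K) {s t : Finset (E N)}
    (hs : s ∈ J.faces) (ht : t ∈ K.faces) {c : E N →₀ ℝ} (hc : IsConvexWeight c s)
    (hpos : ∀ y ∈ s, 0 < c y) (hx : bary c ∈ convexHull ℝ (t : Set (E N))) :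
    (s : Set (E N)) ⊆ convexHull ℝ (t : Set (E N)) := by
  obtain ⟨u, hu, hsu⟩ := h.2 s hs
  have hex : ∀ y : E N, y ∈ s → ∃ d, IsConvexWeight d u ∧ bary d = y := fun y hy =>
    mem_convexHull_iff_weight.1 (hsu (subset_convexHull ℝ _ hy))
  choose! d hd hdy using hex
  obtain ⟨e, he, hex⟩ := mem_convexHull_iff_weight.1 hx
  -- Replacing each vertex `y` by its weights `d y` on `u` gives weights of the same point as `e`,
  -- so the two agree. Outside `t` the sum vanishes, and as every `c y` is positive, no `d y` can
  -- charge a vertex outside `t`.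
  have hD : IsConvexWeight (∑ y ∈ s, c y • d y) u := by
    refine ⟨fun z => ?_, ?_, ?_⟩
    · rw [Finsupp.finsetSum_apply]
      exact Finset.sum_nonneg fun y hy => mul_nonneg (hc.nonneg y) ((hd y hy).nonneg z)
    · refine Finsupp.support_finsetSum.trans (Finset.biUnion_subset.2 fun y hy => ?_)
      exact Finsupp.support_smul.trans (hd y hy).supp
    · rw [map_sum, ← hc.mass_eq, mass_eq_sum hc.supp]
      refine Finset.sum_congr rfl fun y hy => ?_
      rw [map_smul, (hd y hy).mass_eq, smul_eq_mul, mul_one]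
  have hDb : bary (∑ y ∈ s, c y • d y) = bary e := by
    rw [hex, map_sum, bary_eq_sum hc.supp]
    refine Finset.sum_congr rfl fun y hy => ?_
    rw [map_smul, hdy y hy]
  have hDe := K.weight_unique hu ht hD he hDb
  intro y hy
  refine mem_convexHull_iff_weight.2 ⟨d y, ⟨(hd y hy).nonneg, fun z hz => ?_,
    (hd y hy).mass_eq⟩, hdy y hy⟩
  by_contra hzt
  have h0 := he.eq_zero hzt
  rw [← hDe, Finsupp.finsetSum_apply] at h0
  have h1 := (Finset.sum_eq_zero_iff_of_nonneg fun y hy =>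
    mul_nonneg (hc.nonneg y) ((hd y hy).nonneg z)).1 h0 y hy
  rcases mul_eq_zero.1 h1 with h2 | h2
  · exact (hpos y hy).ne' h2
  · exact Finsupp.mem_support_iff.1 hz h2

end TwoComplex

/-! ### Consecutive pairs -/

/-- The pairs of consecutive elements of a finite set of real numbers. -/
noncomputable def consecutivePairs (P : Finset ℝ) : Finset (ℝ × ℝ) :=
  (P ×ˢ P).filter fun p => p.1 < p.2 ∧ ∀ z ∈ P, ¬ (p.1 < z ∧ z < p.2)

theorem mem_consecutivePairs {P : Finset ℝ} {p : ℝ × ℝ} : p ∈ consecutivePairs P ↔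
    p.1 ∈ P ∧ p.2 ∈ P ∧ p.1 < p.2 ∧ ∀ z ∈ P, ¬ (p.1 < z ∧ z < p.2) := by
  simp only [consecutivePairs, Finset.mem_filter, Finset.mem_product, and_assoc]

/-- Every element except the largest has exactly one successor. -/
theorem sum_consecutivePairs_fst {P : Finset ℝ} {b : ℝ} (hb : b ∈ P) (hmax : ∀ z ∈ P, z ≤ b)
    (g : ℝ → ℝ) : ∑ p ∈ consecutivePairs P, g p.1 = ∑ z ∈ P.erase b, g z := by
  refine Finset.sum_nbij Prod.fst ?_ ?_ ?_ fun _ _ => rfl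
  · intro p hp
    obtain ⟨h1, h2, h3, -⟩ := mem_consecutivePairs.1 hp
    exact Finset.mem_erase.2 ⟨(h3.trans_le (hmax _ h2)).ne, h1⟩
  · intro p hp q hq hpq
    obtain ⟨h1, h2, h3, h4⟩ := mem_consecutivePairs.1 (Finset.mem_coe.1 hp)
    obtain ⟨h5, h6, h7, h8⟩ := mem_consecutivePairs.1 (Finset.mem_coe.1 hq)
    refine Prod.ext hpq ?_
    rcases lt_trichotomy p.2 q.2 with h | h | h
    · exact absurd ⟨hpq ▸ h3, h⟩ (h8 _ h2)
    · exact h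
    · exact absurd ⟨hpq ▸ h7, h⟩ (h4 _ h6)
  · intro z hz
    obtain ⟨hzb, hzP⟩ := Finset.mem_erase.1 (Finset.mem_coe.1 hz)
    have hne : (P.filter (z < ·)).Nonempty :=
      ⟨b, Finset.mem_filter.2 ⟨hb, lt_of_le_of_ne (hmax z hzP) hzb⟩⟩
    have hm := Finset.mem_filter.1 (Finset.min'_mem _ hne)
    refine ⟨(z, (P.filter (z < ·)).min' hne), Finset.mem_coe.2 (mem_consecutivePairs.2
      ⟨hzP, hm.1, hm.2, fun w hw hw' => ?_⟩), rfl⟩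
    exact absurd (Finset.min'_le _ w (Finset.mem_filter.2 ⟨hw, hw'.1⟩)) (not_le.2 hw'.2)

theorem sum_consecutivePairs_snd {P : Finset ℝ} {a : ℝ} (ha : a ∈ P) (hmin : ∀ z ∈ P, a ≤ z)
    (g : ℝ → ℝ) : ∑ p ∈ consecutivePairs P, g p.2 = ∑ z ∈ P.erase a, g z := by
  refine Finset.sum_nbij Prod.snd ?_ ?_ ?_ fun _ _ => rfl
  · intro p hp
    obtain ⟨h1, h2, h3, -⟩ := mem_consecutivePairs.1 hp
    exact Finset.mem_erase.2 ⟨((hmin _ h1).trans_lt h3).ne', h2⟩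
  · intro p hp q hq hpq
    obtain ⟨h1, h2, h3, h4⟩ := mem_consecutivePairs.1 (Finset.mem_coe.1 hp)
    obtain ⟨h5, h6, h7, h8⟩ := mem_consecutivePairs.1 (Finset.mem_coe.1 hq)
    refine Prod.ext ?_ hpq
    rcases lt_trichotomy p.1 q.1 with h | h | h
    · exact absurd ⟨h, hpq ▸ h7⟩ (h4 _ h5)
    · exact h
    · exact absurd ⟨h, hpq ▸ h3⟩ (h8 _ h1)
  · intro z hz
    obtain ⟨hzb, hzP⟩ := Finset.mem_erase.1 (Finset.mem_coe.1 hz)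
    have hne : (P.filter (· < z)).Nonempty :=
      ⟨a, Finset.mem_filter.2 ⟨ha, lt_of_le_of_ne (hmin z hzP) (Ne.symm hzb)⟩⟩
    have hm := Finset.mem_filter.1 (Finset.max'_mem _ hne)
    refine ⟨((P.filter (· < z)).max' hne, z), Finset.mem_coe.2 (mem_consecutivePairs.2
      ⟨hm.1, hzP, hm.2, fun w hw hw' => ?_⟩), rfl⟩
    exact absurd (Finset.le_max' _ w (Finset.mem_filter.2 ⟨hw, hw'.2⟩)) (not_le.2 hw'.1)

theorem sum_consecutivePairs_sub {P : Finset ℝ} {a b : ℝ} (ha : a ∈ P) (hb : b ∈ P)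
    (hmin : ∀ z ∈ P, a ≤ z) (hmax : ∀ z ∈ P, z ≤ b) (g : ℝ → ℝ) :
    ∑ p ∈ consecutivePairs P, (g p.2 - g p.1) = g b - g a := by
  rw [Finset.sum_sub_distrib, sum_consecutivePairs_fst hb hmax, sum_consecutivePairs_snd ha hmin]
  linarith [Finset.add_sum_erase P g ha, Finset.add_sum_erase P g hb]

theorem card_consecutivePairs {P : Finset ℝ} {b : ℝ} (hb : b ∈ P) (hmax : ∀ z ∈ P, z ≤ b) :
    (consecutivePairs P).card + 1 = P.card := by
  have h := sum_consecutivePairs_fst hb hmax fun _ => 1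
  simp only [Finset.sum_const, nsmul_eq_mul, mul_one, Nat.cast_inj] at h
  rw [h, Finset.card_erase_add_one hb]

/-! ### Subdivision of a sector -/

namespace TwoComplex

variable {N : ℕ} {K J : TwoComplex N} {v a b : E N}

/-- Near `v` the ray towards `z` runs in a simplex of `J` at `v`. The face whose relative interior
contains a point of the ray lies entirely in `t`; removing `v` from it gives `g`, which the ray
meets at `y`. -/
theorem IsSubdivision.exists_link_face (h : J.IsSubdivision K) (hJ : v ∈ J.vertices)
    {t : Finset (E N)} (ht : t ∈ K.faces) (hvt : v ∈ t) {z : E N}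
    (hz : z ∈ convexHull ℝ (t : Set (E N))) (hzv : z ≠ v) :
    ∃ g : Finset (E N), v ∉ g ∧ insert v g ∈ J.faces ∧
      (g : Set (E N)) ⊆ convexHull ℝ (t : Set (E N)) ∧
      ∃ y ∈ convexHull ℝ (g : Set (E N)), ∃ r : ℝ, 0 < r ∧ y - v = r • (z - v) := by
  have hvt' : v ∈ convexHull ℝ (t : Set (E N)) := subset_convexHull ℝ _ hvt
  have hray : ∀ r : ℝ, 0 ≤ r → r ≤ 1 → v + r • (z - v) ∈ convexHull ℝ (t : Set (E N)) :=
    fun r h0 h1 => (convex_convexHull ℝ _).add_smul_sub_mem hvt' hz ⟨h0, h1⟩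
  obtain ⟨s, hs, hvs, r, hr, hrs⟩ := exists_face_of_ray hJ (d := z - v) (by
    have : Set.Ioo (0 : ℝ) 1 ∈ 𝓝[>] (0 : ℝ) := Ioo_mem_nhdsGT one_pos
    filter_upwards [this] with r hr
    rw [h.1]
    exact Geometry.SimplicialComplex.mem_space_iff.2 ⟨t, ht, hray r hr.1.le hr.2.le⟩)
  -- The bound `r` keeps the point in `s`, the bound `1` keeps it in `t`.
  set q : ℝ := min r 1 with hq
  have hq0 : 0 < q := lt_min hr one_pos
  have hqs : v + q • (z - v) ∈ convexHull ℝ (s : Set (E N)) := by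
    have := (convex_convexHull ℝ (s : Set (E N))).add_smul_sub_mem
      (subset_convexHull ℝ _ hvs) hrs (t := q / r)
      ⟨(div_pos hq0 hr).le, (div_le_one hr).2 (min_le_left _ _)⟩
    rwa [add_sub_cancel_left, smul_smul, div_mul_cancel₀ _ hr.ne'] at this
  obtain ⟨c, hc, hcz⟩ := mem_convexHull_iff_weight.1 hqs
  -- On the support all weights are positive, as `subset_of_interior` requires.
  have hcsupp : IsConvexWeight c c.support := ⟨hc.nonneg, subset_rfl, hc.mass_eq⟩
  have hne : c.support.Nonempty := by
    rw [Finset.nonempty_iff_ne_empty, Ne, Finsupp.support_eq_empty]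
    rintro rfl
    simpa using hc.mass_eq
  have hsub := h.subset_of_interior (J.down_closed hs hc.supp hne) ht hcsupp
    (fun y hy => lt_of_le_of_ne (hc.nonneg y) (Finsupp.mem_support_iff.1 hy).symm)
    (by rw [hcz]; exact hray q hq0.le (min_le_right _ _))
  have hbv : bary c ≠ v := by
    rw [hcz, Ne, add_eq_left, smul_eq_zero, not_or, sub_eq_zero]
    exact ⟨hq0.ne', hzv⟩
  obtain ⟨d, l, hd, hl, -, hdl⟩ := hcsupp.exists_radial hbv
  refine ⟨c.support.erase v, Finset.notMem_erase _ _, ?_, ?_, bary d,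
    mem_convexHull_iff_weight.2 ⟨d, hd, rfl⟩, l⁻¹ * q, mul_pos (inv_pos.2 hl) hq0, ?_⟩
  · exact J.down_closed hs (Finset.insert_subset hvs ((Finset.erase_subset _ _).trans hc.supp))
      (Finset.insert_nonempty _ _)
  · exact (Finset.coe_subset.2 (Finset.erase_subset _ _)).trans hsub
  · rw [hcz, add_sub_cancel_left] at hdl
    rw [mul_smul, hdl, smul_smul, inv_mul_cancel₀ hl.ne', one_smul]

/-- The other end points of the edges of `J` at `v`. -/
noncomputable def neighbors (J : TwoComplex N) (v : E N) : Finset (E N) :=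
  J.finite_vertices.toFinset.filter fun x => x ≠ v ∧ {v, x} ∈ J.faces

theorem mem_neighbors {x : E N} : x ∈ J.neighbors v ↔ x ≠ v ∧ {v, x} ∈ J.faces := by
  rw [neighbors, Finset.mem_filter, Set.Finite.mem_toFinset, and_iff_right_iff_imp]
  exact fun h => J.subset_vertices h.2 (by simp)

theorem singleton_mem_link {x : E N} (hx : x ∈ J.neighbors v) : {x} ∈ (J.link v).faces := by
  rw [mem_neighbors] at hx
  exact ⟨J.subset_vertices hx.2 (by simp), by simpa using hx.1.symm, hx.2⟩

theorem neighbors_ray_unique {x y : E N} (hx : x ∈ J.neighbors v) (hy : y ∈ J.neighbors v) {r : ℝ}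
    (hr : 0 < r) (h : x - v = r • (y - v)) : x = y :=
  link_ray_unique (singleton_mem_link hx) (singleton_mem_link hy) (by simp) (by simp) hr h

theorem triangle_coords_unique (hs : {v, a, b} ∈ K.faces) (hva : v ≠ a) (hvb : v ≠ b) (hab : a ≠ b)
    {α β α' β' : ℝ} (h : α • (a - v) + β • (b - v) = α' • (a - v) + β' • (b - v)) :
    α = α' ∧ β = β' := by
  have key := (K.indep hs).weight_unique
    (c := Finsupp.single a α + Finsupp.single b β + Finsupp.single v (1 - α - β))
    (d := Finsupp.single a α' + Finsupp.single b β' + Finsupp.single v (1 - α' - β'))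
    ?_ ?_ ?_ ?_
  · have h1 := DFunLike.congr_fun key a
    have h2 := DFunLike.congr_fun key b
    simp only [Finsupp.add_apply, Finsupp.single_apply, if_true, if_neg hva, if_neg hvb, if_neg hab,
      if_neg hab.symm] at h1 h2
    constructor <;> linarith
  · refine Finsupp.support_add.trans (Finset.union_subset (Finsupp.support_add.trans
      (Finset.union_subset ?_ ?_)) ?_) <;> refine Finsupp.support_single_subset.trans ?_ <;> simp
  · refine Finsupp.support_add.trans (Finset.union_subset (Finsupp.support_add.trans
      (Finset.union_subset ?_ ?_)) ?_) <;> refine Finsupp.support_single_subset.trans ?_ <;> simp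
  · simp only [map_add, mass_single]
    ring
  · simp only [map_add, bary_single]
    have e : ∀ p q : ℝ, p • a + q • b + (1 - p - q) • v = p • (a - v) + q • (b - v) + v := by
      intro p q
      module
    rw [e, e, h]

end TwoComplex

/-- The direction from `v` to the point that divides the segment from `a` to `b` in the ratio
`t : 1 - t`. -/
noncomputable def sectorDir {N : ℕ} (v a b : E N) (t : ℝ) : E N := (1 - t) • (a - v) + t • (b - v)

theorem exists_sectorDir {N : ℕ} {v a b x : E N} (hva : v ≠ a) (hvb : v ≠ b)
    (hx : x ∈ convexHull ℝ (({v, a, b} : Finset (E N)) : Set (E N))) (hxv : x ≠ v) :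
    ∃ t r : ℝ, 0 ≤ t ∧ t ≤ 1 ∧ 0 < r ∧ r ≤ 1 ∧ x - v = r • sectorDir v a b t := by
  obtain ⟨y, hy, r, hr, hr1, hxy⟩ := exists_radial_of_mem_convexHull hx hxv
  have h1 : (({v, a, b} : Finset (E N)).erase v : Finset (E N)) = {a, b} := by
    rw [Finset.erase_insert]
    simp [hva, hvb]
  rw [h1, Finset.coe_pair, convexHull_pair, segment_eq_image] at hy
  obtain ⟨t, ht, rfl⟩ := hy
  refine ⟨t, r, ht.1, ht.2, hr, hr1, ?_⟩
  rw [hxy, sectorDir]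
  congr 1
  module

theorem add_sectorDir_mem {N : ℕ} {v a b : E N} {t : ℝ} (h0 : 0 ≤ t) (h1 : t ≤ 1) :
    v + sectorDir v a b t ∈ convexHull ℝ (({v, a, b} : Finset (E N)) : Set (E N)) := by
  have : v + sectorDir v a b t = (1 - t) • a + t • b := by
    rw [sectorDir]; module
  rw [this]
  exact convex_convexHull ℝ _ (subset_convexHull ℝ _ (by simp)) (subset_convexHull ℝ _ (by simp))
    (by linarith) h0 (by ring)

/-- A combination of two sector directions is a multiple of the direction at the weighted mean of
the parameters, so the order of directions in a sector can be read off from real numbers. -/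
theorem add_sectorDir {N : ℕ} {v a b : E N} {p q : ℝ} (hpq : p + q ≠ 0) (s t : ℝ) :
    p • sectorDir v a b s + q • sectorDir v a b t =
      (p + q) • sectorDir v a b ((p * s + q * t) / (p + q)) := by
  simp only [sectorDir, smul_add, smul_smul]
  have h1 : (p + q) * (1 - (p * s + q * t) / (p + q)) = p * (1 - s) + q * (1 - t) := by
    field_simp
    ring
  have h2 : (p + q) * ((p * s + q * t) / (p + q)) = p * s + q * t := by
    field_simp
  rw [h1, h2]
  module

/-- On the line through `a` and `b` the point with parameter `s` is `a` itself or lies strictly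
between `a` and the point with parameter `t`, so the angles at `v` add. -/
theorem sectorDir_angle_sub {N : ℕ} {v a b : E N} (hva : v ≠ a) (hab : a ≠ b) {s t : ℝ}
    (hs : 0 ≤ s) (hst : s < t) :
    EuclideanGeometry.angle (v + sectorDir v a b s) v (v + sectorDir v a b t) =
      EuclideanGeometry.angle a v (v + sectorDir v a b t) -
        EuclideanGeometry.angle a v (v + sectorDir v a b s) := by
  have e : ∀ t, v + sectorDir v a b t = AffineMap.lineMap a b t := by
    intro t
    rw [sectorDir, AffineMap.lineMap_apply_module]
    module
  rcases hs.eq_or_lt with rfl | hs0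
  · rw [e 0, AffineMap.lineMap_apply_zero, EuclideanGeometry.angle_self_of_ne hva.symm, sub_zero]
  · rw [eq_sub_iff_add_eq']
    apply EuclideanGeometry.angle_add_angle_eq_of_sbtw
    have ht0 := hs0.trans hst
    have : AffineMap.lineMap a b s = AffineMap.lineMap a (AffineMap.lineMap a b t) (s / t) := by
      rw [AffineMap.lineMap_lineMap_right, div_mul_cancel₀ _ ht0.ne']
    rw [e, e, this]
    refine sbtw_lineMap_iff.2 ⟨fun h => ?_, div_pos hs0 ht0, (div_lt_one ht0).2 hst⟩
    rw [eq_comm, AffineMap.lineMap_eq_left_iff] at h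
    rcases h with h | h
    · exact hab h
    · exact ht0.ne' h

theorem angle_eq_of_sub_eq_smul {N : ℕ} {v x y d e : E N} {r q : ℝ} (hr : 0 < r) (hq : 0 < q)
    (hx : x - v = r • d) (hy : y - v = q • e) :
    EuclideanGeometry.angle x v y = EuclideanGeometry.angle (v + d) v (v + e) := by
  simp only [EuclideanGeometry.angle, vsub_eq_sub, hx, hy, add_sub_cancel_left]
  rw [InnerProductGeometry.angle_smul_left_of_pos _ _ hr,
    InnerProductGeometry.angle_smul_right_of_pos _ _ hq]

namespace TwoComplex

variable {N : ℕ} {K J : TwoComplex N} {v a b : E N}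

theorem sectorDir_unique (hs : {v, a, b} ∈ K.faces) (hva : v ≠ a) (hvb : v ≠ b) (hab : a ≠ b)
    {r q s t : ℝ} (hr : r ≠ 0) (h : r • sectorDir v a b s = q • sectorDir v a b t) : s = t := by
  simp only [sectorDir, smul_add, smul_smul] at h
  obtain ⟨h1, h2⟩ := triangle_coords_unique hs hva hvb hab h
  have h3 : r = q := by linarith
  rw [← h3] at h2
  exact mul_left_cancel₀ hr h2

/-- A triangle at `v` contains no further edge at `v` in its interior. -/
theorem not_sector_between {x y z : E N} (hxy : {v, x, y} ∈ J.faces) (hx : x ∈ J.neighbors v)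
    (hxy' : x ≠ y) (hz : z ∈ J.neighbors v) (hxz : x ≠ z) {p q : ℝ} (hp : 0 < p) (hq : 0 ≤ q)
    (h : z - v = p • (x - v) + q • (y - v)) : False := by
  have hxv := (mem_neighbors.1 hx).1
  have hzv := (mem_neighbors.1 hz).1
  -- This scale makes `v + l • (z - v)` a convex combination both of `v`, `z` and of `v`, `x`, `y`.
  -- The first gives `x` the weight zero, the second gives it `l * p > 0`.
  set l : ℝ := (1 + p + q)⁻¹ with hl
  have hl0 : 0 < l := inv_pos.2 (by linarith)
  have hl1 : l * (1 + p + q) = 1 := inv_mul_cancel₀ (by linarith)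
  have hlp := mul_pos hl0 hp
  have hlq := mul_nonneg hl0.le hq
  have nn : ∀ (w u : E N) (c : ℝ), 0 ≤ c → 0 ≤ Finsupp.single w c u := by
    intro w u c hc
    rw [Finsupp.single_apply]
    split_ifs
    · exact hc
    · exact le_rfl
  have hc : IsConvexWeight (Finsupp.single v (1 - l) + Finsupp.single z l) {v, z} := by
    refine ⟨fun w => add_nonneg (nn _ _ _ (by nlinarith)) (nn _ _ _ hl0.le), ?_, ?_⟩
    · refine Finsupp.support_add.trans (Finset.union_subset ?_ ?_) <;>
        refine Finsupp.support_single_subset.trans ?_ <;> simp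
    · simp
  have hd : IsConvexWeight (Finsupp.single v (1 - l * p - l * q) + Finsupp.single x (l * p) +
      Finsupp.single y (l * q)) {v, x, y} := by
    refine ⟨fun w => add_nonneg (add_nonneg (nn _ _ _ (by nlinarith)) (nn _ _ _ hlp.le))
      (nn _ _ _ hlq), ?_, ?_⟩
    · refine Finsupp.support_add.trans (Finset.union_subset (Finsupp.support_add.trans
        (Finset.union_subset ?_ ?_)) ?_) <;> refine Finsupp.support_single_subset.trans ?_ <;> simp
    · simp only [map_add, mass_single]
      ring
  have := J.weight_unique (mem_neighbors.1 hz).2 hxy hc hd (by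
    simp only [map_add, bary_single]
    have : z = v + (p • (x - v) + q • (y - v)) := by rw [← h]; abel
    rw [this]
    module)
  have h1 := DFunLike.congr_fun this x
  simp only [Finsupp.add_apply, Finsupp.single_apply, if_true, if_neg hxv.symm, if_neg hxz.symm,
    if_neg hxy'.symm] at h1
  linarith

/-- The neighbors of `v` in `J` that lie in the simplex `t`. -/
noncomputable def neighborsIn (J : TwoComplex N) (v : E N) (t : Finset (E N)) : Finset (E N) :=
  (J.neighbors v).filter fun x => x ∈ convexHull ℝ (t : Set (E N))

/-- The triangles of `J` at `v`. -/
noncomputable def triangles (J : TwoComplex N) (v : E N) : Finset (Finset (E N)) :=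
  J.simplices.filter fun t => v ∈ t ∧ t.card = 3

/-- The triangles of `J` at `v` that lie in the simplex `t`. -/
noncomputable def trianglesIn (J : TwoComplex N) (v : E N) (t : Finset (E N)) :
    Finset (Finset (E N)) :=
  (J.triangles v).filter fun s => (s : Set (E N)) ⊆ convexHull ℝ (t : Set (E N))

theorem mem_triangles {t : Finset (E N)} :
    t ∈ J.triangles v ↔ t ∈ J.faces ∧ v ∈ t ∧ t.card = 3 := by
  rw [triangles, Finset.mem_filter, mem_simplices]

theorem exists_of_mem_triangles {t : Finset (E N)} (ht : t ∈ J.triangles v) :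
    ∃ x y, x ∈ J.neighbors v ∧ y ∈ J.neighbors v ∧ x ≠ y ∧ t = {v, x, y} := by
  obtain ⟨h1, h2, h3⟩ := mem_triangles.1 ht
  have h4 : (t.erase v).card = 2 := by rw [Finset.card_erase_of_mem h2, h3]
  obtain ⟨x, y, hxy, he⟩ := Finset.card_eq_two.1 h4
  have ht' : t = {v, x, y} := by rw [← Finset.insert_erase h2, he]
  have hx : x ∈ t.erase v := by simp [he]
  have hy : y ∈ t.erase v := by simp [he]
  rw [Finset.mem_erase] at hx hy
  refine ⟨x, y, mem_neighbors.2 ⟨hx.1, J.down_closed h1 ?_ (by simp)⟩,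
    mem_neighbors.2 ⟨hy.1, J.down_closed h1 ?_ (by simp)⟩, hxy, ht'⟩ <;>
  simp [Finset.insert_subset_iff, h2, hx.2, hy.2]

theorem triple_mem_triangles {x y : E N} (h : {v, x, y} ∈ J.faces) (hx : x ≠ v) (hy : y ≠ v)
    (hxy : x ≠ y) : {v, x, y} ∈ J.triangles v :=
  mem_triangles.2 ⟨h, by simp, Finset.card_eq_three.2 ⟨v, x, y, hx.symm, hy.symm, hxy, rfl⟩⟩

/-- A parametrization of the edges of `J` at `v` in the sector `{v, a, b}`, and of the triangles by
consecutive pairs of parameters. -/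
theorem IsSubdivision.exists_parametrization (h : J.IsSubdivision K) (hJ : v ∈ J.vertices)
    (hs : {v, a, b} ∈ K.faces) (hva : v ≠ a) (hvb : v ≠ b) (hab : a ≠ b) :
    ∃ τ r : E N → ℝ, (∀ x ∈ J.neighborsIn v {v, a, b}, 0 ≤ τ x ∧ τ x ≤ 1 ∧ 0 < r x ∧ r x ≤ 1 ∧
        x - v = r x • sectorDir v a b (τ x)) ∧
      Set.InjOn τ (J.neighborsIn v {v, a, b}) ∧
      0 ∈ (J.neighborsIn v {v, a, b}).image τ ∧ 1 ∈ (J.neighborsIn v {v, a, b}).image τ ∧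
      ∃ ξ : ℝ → E N, (∀ x ∈ J.neighborsIn v {v, a, b}, ξ (τ x) = x) ∧
      ∀ g : Finset (E N) → ℝ, ∑ t ∈ J.trianglesIn v {v, a, b}, g t =
        ∑ p ∈ consecutivePairs ((J.neighborsIn v {v, a, b}).image τ), g {v, ξ p.1, ξ p.2} := by
  set X := J.neighborsIn v {v, a, b} with hX
  have hXmem : ∀ x, x ∈ X ↔ x ∈ J.neighbors v ∧
      x ∈ convexHull ℝ (({v, a, b} : Finset (E N)) : Set (E N)) := fun x => Finset.mem_filter
  have hex : ∀ x, x ∈ X → ∃ t r : ℝ, 0 ≤ t ∧ t ≤ 1 ∧ 0 < r ∧ r ≤ 1 ∧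
      x - v = r • sectorDir v a b t := fun x hx =>
    exists_sectorDir hva hvb ((hXmem x).1 hx).2 (mem_neighbors.1 ((hXmem x).1 hx).1).1
  choose! τ r hτr using hex
  have hinj : Set.InjOn τ X := by
    intro x hx y hy hxy
    obtain ⟨-, -, hrx, -, hx'⟩ := hτr x hx
    obtain ⟨-, -, hry, -, hy'⟩ := hτr y hy
    refine neighbors_ray_unique ((hXmem x).1 hx).1 ((hXmem y).1 hy).1 (r := r x * (r y)⁻¹)
      (mul_pos hrx (inv_pos.2 hry)) ?_
    rw [hx', hy', ← hxy, smul_smul, mul_assoc, inv_mul_cancel₀ hry.ne', mul_one]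
  -- every direction in the sector is an edge direction or interior to a triangle
  have hcover : ∀ t : ℝ, 0 ≤ t → t ≤ 1 → t ∈ X.image τ ∨
      ∃ x ∈ X, ∃ y ∈ X, {v, x, y} ∈ J.faces ∧ τ x < t ∧ t < τ y := by
    intro t h0 h1
    have hne : v + sectorDir v a b t ≠ v := by
      intro hcon
      rw [add_eq_left] at hcon
      -- A vanishing direction would have the parameters `t` and `t + 1` at once.
      have h2 : (1 : ℝ) • sectorDir v a b t = (0 : ℝ) • sectorDir v a b (t + 1) := by
        rw [hcon, smul_zero, zero_smul]
      have := sectorDir_unique hs hva hvb hab one_ne_zero h2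
      linarith
    obtain ⟨g, hvg, hg, hgs, y, hy, q, hq, hyq⟩ := h.exists_link_face hJ hs (by simp)
      (add_sectorDir_mem h0 h1) hne
    rw [add_sub_cancel_left] at hyq
    have hgX : ∀ x ∈ g, x ∈ X := by
      intro x hx
      refine (hXmem x).2 ⟨mem_neighbors.2 ⟨fun hxv => hvg (hxv ▸ hx), J.down_closed hg ?_
        (by simp)⟩, hgs hx⟩
      exact Finset.insert_subset_insert _ (Finset.singleton_subset_iff.2 hx)
    have hgne : g.Nonempty := by
      by_contra hcon
      rw [Finset.not_nonempty_iff_eq_empty] at hcon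
      simp [hcon] at hy
    have hcard : g.card = 1 ∨ g.card = 2 := by
      have h3 := J.card_le_three _ hg
      rw [Finset.card_insert_of_notMem hvg] at h3
      have := Finset.card_pos.2 hgne
      omega
    rcases hcard with hcard | hcard
    · obtain ⟨x, rfl⟩ := Finset.card_eq_one.1 hcard
      left
      have hx := hgX x (by simp)
      refine Finset.mem_image.2 ⟨x, hx, ?_⟩
      simp only [Finset.coe_singleton, convexHull_singleton, Set.mem_singleton_iff] at hy
      obtain ⟨-, -, hrx, -, hx'⟩ := hτr x hx
      exact sectorDir_unique hs hva hvb hab hrx.ne' (hx'.symm.trans (hy ▸ hyq))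
    · obtain ⟨x, z, hxz, rfl⟩ := Finset.card_eq_two.1 hcard
      have hx := hgX x (by simp)
      have hz := hgX z (by simp)
      obtain ⟨-, -, hrx, -, hx'⟩ := hτr x hx
      obtain ⟨-, -, hrz, -, hz'⟩ := hτr z hz
      rw [Finset.coe_pair, convexHull_pair] at hy
      obtain ⟨p₁, p₂, hp₁, hp₂, hp, rfl⟩ := hy
      have hm₁ : 0 ≤ p₁ * r x := mul_nonneg hp₁ hrx.le
      have hm₂ : 0 ≤ p₂ * r z := mul_nonneg hp₂ hrz.le
      have e1 : p₁ • x + p₂ • z - v = p₁ • (x - v) + p₂ • (z - v) := by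
        have : p₂ = 1 - p₁ := by linarith
        rw [this]
        module
      have hpos : 0 < p₁ * r x + p₂ * r z := by
        rcases hp₁.eq_or_lt with h2 | h2
        · have : p₂ = 1 := by linarith
          rw [← h2, this]; linarith
        · have := mul_pos h2 hrx; linarith
      rw [e1, hx', hz', smul_smul, smul_smul, add_sectorDir hpos.ne'] at hyq
      have ht := sectorDir_unique hs hva hvb hab hpos.ne' hyq
      -- A vanishing coefficient puts the direction on an edge; otherwise `t` is a proper weighted
      -- mean of `τ x` and `τ z`.
      rcases hm₁.eq_or_lt with h2 | h2
      · left
        rw [← h2] at ht hpos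
        simp only [zero_mul, zero_add] at ht hpos
        rw [mul_div_assoc, mul_div_cancel₀ _ hpos.ne'] at ht
        exact Finset.mem_image.2 ⟨z, hz, ht⟩
      rcases hm₂.eq_or_lt with h3 | h3
      · left
        rw [← h3] at ht hpos
        simp only [zero_mul, add_zero] at ht hpos
        rw [mul_div_assoc, mul_div_cancel₀ _ hpos.ne'] at ht
        exact Finset.mem_image.2 ⟨x, hx, ht⟩
      right
      rw [div_eq_iff hpos.ne'] at ht
      rcases lt_trichotomy (τ x) (τ z) with h4 | h4 | h4
      · exact ⟨x, hx, z, hz, hg, by nlinarith, by nlinarith⟩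
      · exact absurd (hinj hx hz h4) hxz
      · refine ⟨z, hz, x, hx, ?_, by nlinarith, by nlinarith⟩
        rwa [Finset.pair_comm z x]
  -- no edge direction is interior to a triangle
  have hbetween : ∀ x ∈ X, ∀ y ∈ X, {v, x, y} ∈ J.faces → ∀ z ∈ X, τ x < τ z → τ z < τ y →
      False := by
    intro x hx y hy hxy z hz h1 h2
    obtain ⟨-, -, hrx, -, hx'⟩ := hτr x hx
    obtain ⟨-, -, hry, -, hy'⟩ := hτr y hy
    obtain ⟨-, -, hrz, -, hz'⟩ := hτr z hz
    have hd : 0 < τ y - τ x := by linarith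
    refine not_sector_between hxy ((hXmem x).1 hx).1 (fun he => ?_) ((hXmem z).1 hz).1
      (fun he => ?_) (p := r z * ((τ y - τ z) / (τ y - τ x)) * (r x)⁻¹)
      (q := r z * ((τ z - τ x) / (τ y - τ x)) * (r y)⁻¹) ?_ ?_ ?_
    · rw [he] at hd; linarith
    · rw [he] at h1; linarith
    · exact mul_pos (mul_pos hrz (div_pos (by linarith) hd)) (inv_pos.2 hrx)
    · exact (mul_pos (mul_pos hrz (div_pos (by linarith) hd)) (inv_pos.2 hry)).le
    · rw [hx', hy', hz', smul_smul, smul_smul, inv_mul_cancel_right₀ hrx.ne',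
        inv_mul_cancel_right₀ hry.ne']
      have e2 : r z * ((τ y - τ z) / (τ y - τ x)) + r z * ((τ z - τ x) / (τ y - τ x)) = r z := by
        field_simp
        ring
      rw [add_sectorDir (by rw [e2]; exact hrz.ne'), e2]
      congr 2
      field_simp
      ring
  have h01 : ∀ t : ℝ, (t = 0 ∨ t = 1) → t ∈ X.image τ := by
    intro t ht
    have ht0 : 0 ≤ t := by rcases ht with rfl | rfl <;> norm_num
    have ht1 : t ≤ 1 := by rcases ht with rfl | rfl <;> norm_num
    rcases hcover t ht0 ht1 with h1 | ⟨x, hx, y, hy, -, h1, h2⟩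
    · exact h1
    · have := (hτr x hx).1
      have := (hτr y hy).2.1
      rcases ht with rfl | rfl <;> linarith
  refine ⟨τ, r, hτr, hinj, h01 0 (Or.inl rfl), h01 1 (Or.inr rfl), Function.invFunOn τ X,
    hinj.leftInvOn_invFunOn, fun g => ?_⟩
  set ξ := Function.invFunOn τ X with hξ
  have hξτ : ∀ x ∈ X, ξ (τ x) = x := hinj.leftInvOn_invFunOn
  symm
  refine Finset.sum_nbij (fun p => {v, ξ p.1, ξ p.2}) ?_ ?_ ?_ fun _ _ => rfl
  · rintro ⟨p, q⟩ hpq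
    obtain ⟨hp, hq, hlt, hcons⟩ := mem_consecutivePairs.1 hpq
    obtain ⟨x, hx, rfl⟩ := Finset.mem_image.1 hp
    obtain ⟨y, hy, rfl⟩ := Finset.mem_image.1 hq
    simp only [hξτ x hx, hξτ y hy]
    simp only at hlt hcons
    have hx01 := hτr x hx
    have hy01 := hτr y hy
    -- The midpoint of two consecutive parameters is no edge direction, hence interior to a
    -- triangle. Consecutiveness and `hbetween` leave `x` and `y` as the only possible sides of that
    -- triangle.
    have hface : {v, x, y} ∈ J.faces := by
      rcases hcover ((τ x + τ y) / 2) (by linarith [hx01.1, hy01.1])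
        (by linarith [hx01.2.1, hy01.2.1]) with h1 | ⟨x', hx', y', hy', hf, h1, h2⟩
      · exact absurd ⟨by linarith, by linarith⟩ (hcons _ h1)
      · have e1 : x' = x := by
          refine hinj hx' hx (le_antisymm ?_ ?_)
          · by_contra hcon
            exact hcons _ (Finset.mem_image_of_mem τ hx') ⟨not_le.1 hcon, by linarith⟩
          · by_contra hcon
            exact hbetween x' hx' y' hy' hf x hx (not_le.1 hcon) (by linarith)
        have e2 : y' = y := by
          refine hinj hy' hy (le_antisymm ?_ ?_)
          · by_contra hcon
            exact hbetween x' hx' y' hy' hf y hy (by linarith) (not_le.1 hcon)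
          · by_contra hcon
            exact hcons _ (Finset.mem_image_of_mem τ hy') ⟨by linarith, not_le.1 hcon⟩
        rwa [e1, e2] at hf
    have hxX := (hXmem x).1 hx
    have hyX := (hXmem y).1 hy
    refine Finset.mem_filter.2 ⟨triple_mem_triangles hface (mem_neighbors.1 hxX.1).1
      (mem_neighbors.1 hyX.1).1 (fun he => ?_), ?_⟩
    · rw [he] at hlt; exact lt_irrefl _ hlt
    · intro z hz
      simp only [Finset.coe_insert, Finset.coe_singleton, Set.mem_insert_iff,
        Set.mem_singleton_iff] at hz
      rcases hz with rfl | rfl | rfl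
      · exact subset_convexHull ℝ _ (by simp)
      · exact hxX.2
      · exact hyX.2
  · rintro ⟨p, q⟩ hpq ⟨p', q'⟩ hpq' heq
    obtain ⟨hp, hq, hlt, hcons⟩ := mem_consecutivePairs.1 (Finset.mem_coe.1 hpq)
    obtain ⟨hp', hq', hlt', hcons'⟩ := mem_consecutivePairs.1 (Finset.mem_coe.1 hpq')
    obtain ⟨x, hx, rfl⟩ := Finset.mem_image.1 hp
    obtain ⟨y, hy, rfl⟩ := Finset.mem_image.1 hq
    obtain ⟨x', hx', rfl⟩ := Finset.mem_image.1 hp'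
    obtain ⟨y', hy', rfl⟩ := Finset.mem_image.1 hq'
    simp only [hξτ x hx, hξτ y hy, hξτ x' hx', hξτ y' hy'] at heq
    simp only at hlt hlt'
    have hxv := (mem_neighbors.1 ((hXmem x).1 hx).1).1
    have hyv := (mem_neighbors.1 ((hXmem y).1 hy).1).1
    have hxm : x ∈ ({v, x', y'} : Finset (E N)) := heq ▸ (by simp)
    have hym : y ∈ ({v, x', y'} : Finset (E N)) := heq ▸ (by simp)
    simp only [Finset.mem_insert, Finset.mem_singleton, hxv, hyv, false_or] at hxm hym
    rcases hxm with rfl | rfl <;> rcases hym with rfl | rfl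
    · exact absurd hlt (lt_irrefl _)
    · rfl
    · exact absurd hlt hlt'.not_gt
    · exact absurd hlt (lt_irrefl _)
  · intro t ht
    obtain ⟨ht1, ht2⟩ := Finset.mem_filter.1 (Finset.mem_coe.1 ht)
    obtain ⟨x, y, hx, hy, hxy, rfl⟩ := exists_of_mem_triangles ht1
    have hxX : x ∈ X := (hXmem x).2 ⟨hx, ht2 (by simp)⟩
    have hyX : y ∈ X := (hXmem y).2 ⟨hy, ht2 (by simp)⟩
    have hf := (mem_triangles.1 ht1).1
    have key : ∀ x ∈ X, ∀ y ∈ X, {v, x, y} ∈ J.faces → τ x < τ y →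
        (τ x, τ y) ∈ consecutivePairs (X.image τ) := by
      intro x hx y hy hf hlt
      refine mem_consecutivePairs.2 ⟨Finset.mem_image_of_mem τ hx, Finset.mem_image_of_mem τ hy,
        hlt, fun z hz hz' => ?_⟩
      obtain ⟨w, hw, rfl⟩ := Finset.mem_image.1 hz
      exact hbetween x hx y hy hf w hw hz'.1 hz'.2
    rcases lt_trichotomy (τ x) (τ y) with h4 | h4 | h4
    · refine ⟨(τ x, τ y), key x hxX y hyX hf h4, ?_⟩
      simp only [hξτ x hxX, hξτ y hyX]
    · exact absurd (hinj hxX hyX h4) hxy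
    · refine ⟨(τ y, τ x), key y hyX x hxX (by rwa [Finset.pair_comm y x]) h4, ?_⟩
      simp only [hξτ x hxX, hξτ y hyX, Finset.pair_comm y x]

/-- With `A t` the angle between `a` and the direction at `t`, each small triangle contributes the
increment of `A` over a consecutive pair, and the sum telescopes from `A 0 = 0` to `A 1`. -/
theorem IsSubdivision.sum_interiorAngle_trianglesIn (h : J.IsSubdivision K) (hJ : v ∈ J.vertices)
    (hs : {v, a, b} ∈ K.faces) (hva : v ≠ a) (hvb : v ≠ b) (hab : a ≠ b) :
    ∑ t ∈ J.trianglesIn v {v, a, b}, interiorAngle v t = interiorAngle v {v, a, b} := by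
  obtain ⟨τ, r, hτr, hinj, h0, h1, ξ, hξ, hsum⟩ := h.exists_parametrization hJ hs hva hvb hab
  rw [hsum]
  set A : ℝ → ℝ := fun t => EuclideanGeometry.angle a v (v + sectorDir v a b t) with hA
  have key := sum_consecutivePairs_sub h0 h1
    (fun z hz => by
      obtain ⟨x, hx, rfl⟩ := Finset.mem_image.1 hz
      exact (hτr x hx).1)
    (fun z hz => by
      obtain ⟨x, hx, rfl⟩ := Finset.mem_image.1 hz
      exact (hτr x hx).2.1) A
  have hA1 : A 1 = EuclideanGeometry.angle a v b := by
    simp [hA, sectorDir]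
  have hA0 : A 0 = 0 := by
    simp [hA, sectorDir, EuclideanGeometry.angle_self_of_ne hva.symm]
  rw [interiorAngle_triple hva hvb hab, ← hA1, ← sub_zero (A 1), ← hA0, ← key, Finset.sum_div]
  refine Finset.sum_congr rfl ?_
  rintro ⟨p, q⟩ hpq
  obtain ⟨hp, hq, hlt, -⟩ := mem_consecutivePairs.1 hpq
  obtain ⟨x, hx, rfl⟩ := Finset.mem_image.1 hp
  obtain ⟨y, hy, rfl⟩ := Finset.mem_image.1 hq
  simp only at hlt
  obtain ⟨hx0, -, hrx, -, hx'⟩ := hτr x hx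
  obtain ⟨-, -, hry, -, hy'⟩ := hτr y hy
  simp only [hξ x hx, hξ y hy]
  have hxv := (mem_neighbors.1 (Finset.mem_filter.1 hx).1).1
  have hyv := (mem_neighbors.1 (Finset.mem_filter.1 hy).1).1
  rw [interiorAngle_triple hxv.symm hyv.symm (fun he => by rw [he] at hlt; exact lt_irrefl _ hlt),
    angle_eq_of_sub_eq_smul hrx hry hx' hy', sectorDir_angle_sub hva hab hx0 hlt]

theorem IsSubdivision.card_trianglesIn (h : J.IsSubdivision K) (hJ : v ∈ J.vertices)
    (hs : {v, a, b} ∈ K.faces) (hva : v ≠ a) (hvb : v ≠ b) (hab : a ≠ b) :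
    (J.trianglesIn v {v, a, b}).card + 1 = (J.neighborsIn v {v, a, b}).card := by
  obtain ⟨τ, r, hτr, hinj, h0, h1, ξ, hξ, hsum⟩ := h.exists_parametrization hJ hs hva hvb hab
  have h2 := hsum fun _ => 1
  simp only [Finset.sum_const, nsmul_eq_mul, mul_one, Nat.cast_inj] at h2
  rw [h2, card_consecutivePairs h1, Finset.card_image_of_injOn hinj]
  intro z hz
  obtain ⟨x, hx, rfl⟩ := Finset.mem_image.1 hz
  exact (hτr x hx).2.1

theorem mem_convexHull_pair_iff {x : E N} :
    x ∈ convexHull ℝ (({v, a} : Finset (E N)) : Set (E N)) ↔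
      ∃ t : ℝ, 0 ≤ t ∧ t ≤ 1 ∧ x - v = t • (a - v) := by
  rw [Finset.coe_pair, convexHull_pair, segment_eq_image']
  constructor
  · rintro ⟨t, ht, rfl⟩
    exact ⟨t, ht.1, ht.2, by simp⟩
  · rintro ⟨t, h0, h1, h⟩
    exact ⟨t, ⟨h0, h1⟩, by simp [← h]⟩

/-- An edge of `K` at `v` other than `{v, a}` and `{v, b}` meets the triangle only in `v`. So the
neighbors in question are those with the parameters `0` and `1`. -/
theorem IsSubdivision.card_boundary_neighborsIn (h : J.IsSubdivision K) (hJ : v ∈ J.vertices)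
    (hs : {v, a, b} ∈ K.faces) (hva : v ≠ a) (hvb : v ≠ b) (hab : a ≠ b) :
    ((J.neighborsIn v {v, a, b}).filter fun x => ∃ e ∈ K.faces, v ∈ e ∧ e.card = 2 ∧
      x ∈ convexHull ℝ (e : Set (E N))).card = 2 := by
  obtain ⟨τ, r, hτr, hinj, h0, h1, ξ, hξ, -⟩ := h.exists_parametrization hJ hs hva hvb hab
  obtain ⟨x₀, hx₀, hτ₀⟩ := Finset.mem_image.1 h0
  obtain ⟨x₁, hx₁, hτ₁⟩ := Finset.mem_image.1 h1
  refine Finset.card_eq_two.2 ⟨x₀, x₁, fun he => ?_, ?_⟩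
  · rw [he, hτ₁] at hτ₀
    exact one_ne_zero hτ₀
  ext x
  rw [Finset.mem_filter, Finset.mem_insert, Finset.mem_singleton]
  constructor
  · rintro ⟨hx, e, he, hve, hcard, hxe⟩
    obtain ⟨ht0, ht1, hr, -, hx'⟩ := hτr x hx
    obtain ⟨hxn, hxs⟩ := Finset.mem_filter.1 hx
    have hxv := (mem_neighbors.1 hxn).1
    obtain ⟨w, hw⟩ := Finset.card_eq_one.1
      (show (e.erase v).card = 1 by rw [Finset.card_erase_of_mem hve, hcard])
    have hee : e = {v, w} := by rw [← Finset.insert_erase hve, hw]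
    subst hee
    have hxi := K.inter_subset_convexHull he hs ⟨hxe, hxs⟩
    by_cases hws : w = a ∨ w = b
    · obtain ⟨t, -, -, ht⟩ := mem_convexHull_pair_iff.1 hxe
      rw [hx', sectorDir, smul_add, smul_smul, smul_smul] at ht
      rcases hws with rfl | rfl
      · left
        have := (triangle_coords_unique hs hva hvb hab (α' := t) (β' := 0)
          (ht.trans (by simp))).2
        refine hinj hx hx₀ ?_
        rw [hτ₀]
        exact (mul_eq_zero.1 this).resolve_left hr.ne'
      · right
        have := (triangle_coords_unique hs hva hvb hab (α' := 0) (β' := t)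
          (ht.trans (by simp))).1
        refine hinj hx hx₁ ?_
        rw [hτ₁]
        linarith [(mul_eq_zero.1 this).resolve_left hr.ne']
    · exfalso
      have hsub : ((({v, w} : Finset (E N)) : Set (E N)) ∩
          (({v, a, b} : Finset (E N)) : Set (E N))) ⊆ {v} := by
        rintro z ⟨hz1, hz2⟩
        simp only [Finset.coe_insert, Finset.coe_singleton, Set.mem_insert_iff,
          Set.mem_singleton_iff] at hz1 hz2 ⊢
        rcases hz1 with rfl | rfl
        · rfl
        · tauto
      have := convexHull_mono hsub hxi
      rw [convexHull_singleton] at this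
      exact hxv this
  -- The bound `r x ≤ 1` keeps `x` on the edge and not merely on its ray.
  · have key : ∀ x ∈ J.neighborsIn v {v, a, b}, ∀ w, w ≠ v → {v, w} ∈ K.faces →
        x - v = r x • (w - v) → ∃ e ∈ K.faces, v ∈ e ∧ e.card = 2 ∧
          x ∈ convexHull ℝ (e : Set (E N)) := by
      intro x hx w hwv hw hxw
      obtain ⟨-, -, hr0, hr1, -⟩ := hτr x hx
      exact ⟨_, hw, by simp, Finset.card_pair hwv.symm,
        mem_convexHull_pair_iff.2 ⟨_, hr0.le, hr1, hxw⟩⟩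
    rintro (rfl | rfl)
    · refine ⟨hx₀, key _ hx₀ a hva.symm (K.down_closed hs (by simp [Finset.insert_subset_iff])
        (by simp)) ?_⟩
      rw [(hτr _ hx₀).2.2.2.2, hτ₀]
      simp [sectorDir]
    · refine ⟨hx₁, key _ hx₁ b hvb.symm (K.down_closed hs (by simp [Finset.insert_subset_iff])
        (by simp)) ?_⟩
      rw [(hτr _ hx₁).2.2.2.2, hτ₁]
      simp [sectorDir]

end TwoComplex

/-! ### Invariance under subdivision -/

namespace TwoComplex

variable {N : ℕ} {K J : TwoComplex N} {v : E N}

theorem card_le_card_of_subset_convexHull {s t : Finset (E N)} (ht : t ∈ J.faces)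
    (h : (t : Set (E N)) ⊆ convexHull ℝ (s : Set (E N))) : t.card ≤ s.card :=
  (J.indep ht).card_le_card_of_subset_affineSpan
    (h.trans (convexHull_subset_affineSpan _))

theorem IsSubdivision.exists_mem_face (h : J.IsSubdivision K) (hK : v ∈ K.vertices)
    {t : Finset (E N)} (ht : t ∈ J.faces) (hv : v ∈ t) :
    ∃ s ∈ K.faces, v ∈ s ∧ (t : Set (E N)) ⊆ convexHull ℝ (s : Set (E N)) := by
  obtain ⟨s, hs, hts⟩ := h.2 t ht
  have hts' := (subset_convexHull ℝ (t : Set (E N))).trans hts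
  exact ⟨s, hs, (K.vertex_mem_convexHull_iff hK hs).1 (hts' hv), hts'⟩

/-- A triangle of `J` at `v` lies in exactly one triangle of `K` at `v`: if it lay in two, it would
lie in their intersection, which then has three vertices for dimension reasons and equals both. -/
theorem IsSubdivision.sum_triangles (h : J.IsSubdivision K) (hK : v ∈ K.vertices)
    (g : Finset (E N) → ℝ) :
    ∑ t ∈ J.triangles v, g t = ∑ s ∈ K.triangles v, ∑ t ∈ J.trianglesIn v s, g t := by
  have hex : ∀ t, t ∈ J.triangles v → ∃ s, s ∈ K.triangles v ∧
      (t : Set (E N)) ⊆ convexHull ℝ (s : Set (E N)) := by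
    intro t ht
    obtain ⟨h1, h2, h3⟩ := mem_triangles.1 ht
    obtain ⟨s, hs, hvs, hts⟩ := h.exists_mem_face hK h1 h2
    refine ⟨s, mem_triangles.2 ⟨hs, hvs, ?_⟩, hts⟩
    have h4 := card_le_card_of_subset_convexHull h1 hts
    have h5 := K.card_le_three s hs
    omega
  choose! m hm hmt using hex
  rw [← Finset.sum_fiberwise_of_maps_to hm]
  refine Finset.sum_congr rfl fun s hs => Finset.sum_congr ?_ fun _ _ => rfl
  ext t
  rw [trianglesIn, Finset.mem_filter, Finset.mem_filter]
  refine and_congr_right fun ht => ⟨fun he => he ▸ hmt t ht, fun hts => ?_⟩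
  have h1 := mem_triangles.1 hs
  have h2 := mem_triangles.1 (hm t ht)
  have h3 := mem_triangles.1 ht
  have hsub : (t : Set (E N)) ⊆ convexHull ℝ ((m t ∩ s : Finset (E N)) : Set (E N)) := by
    rw [Finset.coe_inter]
    exact fun x hx => K.inter_subset_convexHull h2.1 h1.1 ⟨hmt t ht hx, hts hx⟩
  have h4 := card_le_card_of_subset_convexHull h3.1 hsub
  have h5 := Finset.eq_of_subset_of_card_le (Finset.inter_subset_left (s₁ := m t) (s₂ := s))
    (by omega)
  have h6 := Finset.eq_of_subset_of_card_le (Finset.inter_subset_right (s₁ := m t) (s₂ := s))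
    (by omega)
  rw [← h5, h6]

/-- The neighbors of `v` in `J` that lie on edges of `K` at `v`. -/
noncomputable def neighborsOnEdges (J K : TwoComplex N) (v : E N) : Finset (E N) :=
  (J.neighbors v).filter fun x => ∃ e ∈ K.faces, v ∈ e ∧ e.card = 2 ∧
    x ∈ convexHull ℝ (e : Set (E N))

theorem exists_neighbor_of_edge {e : Finset (E N)} (he : e ∈ K.faces) (hv : v ∈ e)
    (hc : e.card = 2) : ∃ w ∈ K.neighbors v, e = {v, w} := by
  obtain ⟨w, hw⟩ := Finset.card_eq_one.1
    (show (e.erase v).card = 1 by rw [Finset.card_erase_of_mem hv, hc])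
  have hee : e = {v, w} := by rw [← Finset.insert_erase hv, hw]
  have hwe : w ∈ e.erase v := by simp [hw]
  exact ⟨w, mem_neighbors.2 ⟨(Finset.mem_erase.1 hwe).1, hee ▸ he⟩, hee⟩

theorem exists_pos_of_mem_edge {x w : E N} (hx : x ∈ J.neighbors v)
    (h : x ∈ convexHull ℝ (({v, w} : Finset (E N)) : Set (E N))) :
    ∃ t : ℝ, 0 < t ∧ x - v = t • (w - v) := by
  obtain ⟨t, h0, -, ht⟩ := mem_convexHull_pair_iff.1 h
  refine ⟨t, lt_of_le_of_ne h0 fun h1 => (mem_neighbors.1 hx).1 ?_, ht⟩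
  rw [← h1, zero_smul] at ht
  exact sub_eq_zero.1 ht

/-- Each edge of `K` at `v` carries exactly one edge of `J` at `v`: one exists by covering, and
neighbors on the same ray coincide. -/
theorem IsSubdivision.card_neighborsOnEdges (h : J.IsSubdivision K) (hJ : v ∈ J.vertices) :
    (J.neighborsOnEdges K v).card = (K.neighbors v).card := by
  have hex : ∀ w, w ∈ K.neighbors v → ∃ x, x ∈ J.neighbors v ∧
      x ∈ convexHull ℝ (({v, w} : Finset (E N)) : Set (E N)) := by
    intro w hw
    obtain ⟨hwv, hf⟩ := mem_neighbors.1 hw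
    obtain ⟨g, hvg, hg, hgs, y, hy, -⟩ := h.exists_link_face hJ hf (by simp)
      (subset_convexHull ℝ _ (by simp : w ∈ (({v, w} : Finset (E N)) : Set (E N)))) hwv
    obtain ⟨x, hx⟩ : g.Nonempty := by
      by_contra hcon
      rw [Finset.not_nonempty_iff_eq_empty] at hcon
      simp [hcon] at hy
    exact ⟨x, mem_neighbors.2 ⟨fun hxv => hvg (hxv ▸ hx), J.down_closed hg
      (Finset.insert_subset_insert _ (Finset.singleton_subset_iff.2 hx)) (by simp)⟩, hgs hx⟩
  choose! m hm hmw using hex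
  symm
  refine Finset.card_nbij m ?_ ?_ ?_
  · intro w hw
    obtain ⟨hwv, hf⟩ := mem_neighbors.1 hw
    exact Finset.mem_filter.2 ⟨hm w hw, _, hf, by simp, Finset.card_pair hwv.symm, hmw w hw⟩
  · intro w hw w' hw' he
    obtain ⟨t, ht, h1⟩ := exists_pos_of_mem_edge (hm w hw) (hmw w hw)
    obtain ⟨t', ht', h2⟩ := exists_pos_of_mem_edge (hm w' hw') (hmw w' hw')
    refine neighbors_ray_unique hw hw' (mul_pos (inv_pos.2 ht) ht') ?_
    rw [mul_smul, ← h2, ← he, h1, smul_smul, inv_mul_cancel₀ ht.ne', one_smul]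
  · intro x hx
    obtain ⟨hx, e, he, hve, hc, hxe⟩ := Finset.mem_filter.1 (Finset.mem_coe.1 hx)
    obtain ⟨w, hw, rfl⟩ := exists_neighbor_of_edge he hve hc
    refine ⟨w, hw, ?_⟩
    obtain ⟨t, ht, h1⟩ := exists_pos_of_mem_edge (hm w hw) (hmw w hw)
    obtain ⟨t', ht', h2⟩ := exists_pos_of_mem_edge hx hxe
    refine neighbors_ray_unique (hm w hw) hx (mul_pos ht (inv_pos.2 ht')) ?_
    rw [h2, smul_smul, inv_mul_cancel_right₀ ht'.ne', h1]

/-- The number of edges minus the number of triangles at `v` is invariant: old edges correspond to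
edges of `J` on them, and a triangle of `K` cut into `k` triangles at `v` has `k - 1` new edges in
its interior. -/
theorem IsSubdivision.card_neighbors (h : J.IsSubdivision K) (hK : v ∈ K.vertices)
    (hJ : v ∈ J.vertices) :
    (J.neighbors v).card + (K.triangles v).card = (K.neighbors v).card + (J.triangles v).card := by
  set B : E N → Prop := fun x => ∃ e ∈ K.faces, v ∈ e ∧ e.card = 2 ∧
    x ∈ convexHull ℝ (e : Set (E N)) with hB
  -- Used twice: for a simplex that contains a new neighbor, and for the intersection of two such
  -- triangles, which shows that the triangle is unique.
  have hpt : ∀ s ∈ K.faces, v ∈ s → ∀ x, x ≠ v → x ∈ convexHull ℝ (s : Set (E N)) → ¬ B x →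
      s ∈ K.triangles v := by
    intro s hs hvs x hxv hxs hBx
    refine mem_triangles.2 ⟨hs, hvs, ?_⟩
    rcases K.card_cases hs with h1 | h1 | h1
    · exfalso
      obtain ⟨y, rfl⟩ := Finset.card_eq_one.1 h1
      rw [Finset.mem_singleton.1 hvs] at hxv
      simp only [Finset.coe_singleton, convexHull_singleton, Set.mem_singleton_iff] at hxs
      exact hxv hxs
    · exact absurd ⟨s, hs, hvs, h1, hxs⟩ hBx
    · exact h1
  have hex : ∀ x, x ∈ (J.neighbors v).filter (fun x => ¬ B x) → ∃ s, s ∈ K.triangles v ∧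
      x ∈ convexHull ℝ (s : Set (E N)) := by
    intro x hx
    obtain ⟨hx, hBx⟩ := Finset.mem_filter.1 hx
    obtain ⟨hxv, hf⟩ := mem_neighbors.1 hx
    obtain ⟨s, hs, hvs, hxs⟩ := h.exists_mem_face hK hf (by simp)
    have hxs' := hxs (by simp : x ∈ (({v, x} : Finset (E N)) : Set (E N)))
    exact ⟨s, hpt s hs hvs x hxv hxs' hBx, hxs'⟩
  choose! m hm hmx using hex
  have h1 : ((J.neighbors v).filter fun x => ¬ B x).card =
      ∑ s ∈ K.triangles v, ((J.neighborsIn v s).filter fun x => ¬ B x).card := by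
    rw [Finset.card_eq_sum_card_fiberwise hm]
    refine Finset.sum_congr rfl fun s hs => ?_
    congr 1
    ext x
    simp only [neighborsIn, Finset.mem_filter]
    constructor
    · rintro ⟨⟨h1, h2⟩, rfl⟩
      exact ⟨⟨h1, hmx x (Finset.mem_filter.2 ⟨h1, h2⟩)⟩, h2⟩
    · rintro ⟨⟨h1, hxs⟩, h2⟩
      refine ⟨⟨h1, h2⟩, ?_⟩
      have hx : x ∈ (J.neighbors v).filter fun x => ¬ B x := Finset.mem_filter.2 ⟨h1, h2⟩
      have h3 := mem_triangles.1 hs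
      have h4 := mem_triangles.1 (hm x hx)
      have h5 := K.inter_subset_convexHull h4.1 h3.1 ⟨hmx x hx, hxs⟩
      rw [← Finset.coe_inter] at h5
      have hv : v ∈ m x ∩ s := Finset.mem_inter.2 ⟨h4.2.1, h3.2.1⟩
      have h6 := (mem_triangles.1 (hpt (m x ∩ s)
        (K.down_closed h4.1 Finset.inter_subset_left ⟨v, hv⟩) hv x
        (mem_neighbors.1 h1).1 h5 h2)).2.2
      have h7 := Finset.eq_of_subset_of_card_le (Finset.inter_subset_left (s₁ := m x) (s₂ := s))
        (by omega)
      have h8 := Finset.eq_of_subset_of_card_le (Finset.inter_subset_right (s₁ := m x) (s₂ := s))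
        (by omega)
      rw [← h7, h8]
  have h2 : ∀ s ∈ K.triangles v, ((J.neighborsIn v s).filter fun x => ¬ B x).card + 1 =
      (J.trianglesIn v s).card := by
    intro s hs
    have hs' := mem_triangles.1 hs
    obtain ⟨a, b, ha, hb, hab, rfl⟩ := exists_of_mem_triangles hs
    have hva := (mem_neighbors.1 ha).1.symm
    have hvb := (mem_neighbors.1 hb).1.symm
    have h3 : ((J.neighborsIn v {v, a, b}).filter B).card = 2 :=
      h.card_boundary_neighborsIn hJ hs'.1 hva hvb hab
    have h4 := h.card_trianglesIn hJ hs'.1 hva hvb hab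
    have h5 := Finset.card_filter_add_card_filter_not (s := J.neighborsIn v {v, a, b}) B
    omega
  have h3 : (J.triangles v).card = ∑ s ∈ K.triangles v, (J.trianglesIn v s).card := by
    have := h.sum_triangles hK fun _ => 1
    simp only [Finset.sum_const, nsmul_eq_mul, mul_one] at this
    exact_mod_cast this
  have h4 : ∑ s ∈ K.triangles v, (((J.neighborsIn v s).filter fun x => ¬ B x).card + 1) =
      (J.triangles v).card := by
    rw [h3]
    exact Finset.sum_congr rfl h2
  rw [Finset.sum_add_distrib, ← h1, Finset.sum_const, smul_eq_mul, mul_one] at h4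
  have h5 := h.card_neighborsOnEdges hJ
  have h6 := Finset.card_filter_add_card_filter_not (s := J.neighbors v) B
  have h7 : J.neighborsOnEdges K v = (J.neighbors v).filter B := rfl
  rw [h7] at h5
  omega

theorem IsSubdivision.angleSum_eq (h : J.IsSubdivision K) (hK : v ∈ K.vertices)
    (hJ : v ∈ J.vertices) : angleSum J ⟨v, hJ⟩ = angleSum K ⟨v, hK⟩ := by
  change ∑ t ∈ J.triangles v, interiorAngle v t = ∑ t ∈ K.triangles v, interiorAngle v t
  rw [h.sum_triangles hK]
  refine Finset.sum_congr rfl fun s hs => ?_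
  have hs' := mem_triangles.1 hs
  obtain ⟨a, b, ha, hb, hab, rfl⟩ := exists_of_mem_triangles hs
  exact h.sum_interiorAngle_trianglesIn hJ hs'.1 (mem_neighbors.1 ha).1.symm
    (mem_neighbors.1 hb).1.symm hab

theorem card_edges_at (K : TwoComplex N) (v : E N) :
    (K.simplices.filter fun t => v ∈ t ∧ t.card = 2).card = (K.neighbors v).card := by
  symm
  refine Finset.card_nbij (fun w => {v, w}) ?_ ?_ ?_
  · intro w hw
    obtain ⟨hwv, hf⟩ := mem_neighbors.1 hw
    exact Finset.mem_filter.2 ⟨mem_simplices.2 hf, by simp, Finset.card_pair hwv.symm⟩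
  · intro w hw w' hw' he
    have he' : ({v, w} : Finset (E N)) = {v, w'} := he
    have h1 : w ∈ ({v, w'} : Finset (E N)) := he' ▸ (by simp)
    simpa [(mem_neighbors.1 hw).1] using h1
  · intro e he
    obtain ⟨he, hve, hc⟩ := Finset.mem_filter.1 (Finset.mem_coe.1 he)
    obtain ⟨w, hw, rfl⟩ := exists_neighbor_of_edge (mem_simplices.1 he) hve hc
    exact ⟨w, hw, rfl⟩

/-- In this form curvature involves only the angle sum and the difference of the numbers of
triangles and edges at `v`, both invariant under subdivision. -/
theorem standardCurvature_eq_card (K : TwoComplex N) (v : K.vertices) :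
    standardCurvature K v = 1 - (K.neighbors v).card / 2 + (K.triangles v).card / 2 -
      angleSum K v := by
  have h1 : (K.simplices.filter fun t => (v : E N) ∈ t ∧ t.card = 1) = {{(v : E N)}} := by
    ext t
    rw [Finset.mem_filter, mem_simplices, Finset.mem_singleton]
    constructor
    · rintro ⟨-, h1, h2⟩
      obtain ⟨y, rfl⟩ := Finset.card_eq_one.1 h2
      rw [Finset.mem_singleton.1 h1]
    · rintro rfl
      exact ⟨v.2, by simp, by simp⟩
  have h2 : ∀ t ∈ K.simplices.filter fun t => (v : E N) ∈ t,
      (-1 : ℝ) ^ (t.card - 1) * exteriorAngle (v : E N) t =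
        (if t.card = 1 then 1 else 0) - (if t.card = 2 then 1 / 2 else 0) +
          (if t.card = 3 then 1 / 2 - interiorAngle (v : E N) t else 0) := by
    intro t ht
    have ht' := mem_simplices.1 (Finset.mem_filter.1 ht).1
    unfold exteriorAngle
    rcases K.card_cases ht' with h | h | h <;> simp [h]
  rw [standardCurvature, Finset.sum_congr rfl h2, Finset.sum_add_distrib, Finset.sum_sub_distrib,
    ← Finset.sum_filter, ← Finset.sum_filter, ← Finset.sum_filter, Finset.filter_filter,
    Finset.filter_filter, Finset.filter_filter, Finset.sum_sub_distrib, h1, Finset.sum_const,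
    Finset.sum_const, card_edges_at, Finset.sum_const, angleSum, triangles]
  simp only [Finset.card_singleton, nsmul_eq_mul]
  ring

end TwoComplex

theorem standardCurvature_invariantUnderSubdivision :
    standardCurvature.InvariantUnderSubdivision := by
  intro N K J h v hK hJ
  rw [TwoComplex.standardCurvature_eq_card, TwoComplex.standardCurvature_eq_card,
    h.angleSum_eq hK hJ]
  have := h.card_neighbors hK hJ
  have h2 : ((J.neighbors v).card : ℝ) + (K.triangles v).card =
      (K.neighbors v).card + (J.triangles v).card := by exact_mod_cast this
  simp only
  linarith

theorem generalizedAngleDefect_invariantUnderSubdivision (c : HomeoType → ℝ) :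
    (generalizedAngleDefect c).InvariantUnderSubdivision := by
  intro N K J h v hK hJ
  rw [generalizedAngleDefect, generalizedAngleDefect, h.angleSum_eq hK hJ,
    flatness_congr c (TwoComplex.link_homeomorph_of_space_eq h.1 hK hJ)]

/-! ### Stellar subdivision of an edge -/

namespace TwoComplex

variable {N : ℕ} {K : TwoComplex N} {u v p : E N} {α β : ℝ}

/-- The simplices of the complex that arises from `K` when the edge `{u, v}` is subdivided at
`p`. -/
def stellarFaces (K : TwoComplex N) (u v p : E N) : Set (Finset (E N)) :=
  {s | (s ∈ K.faces ∧ ¬ {u, v} ⊆ s) ∨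
    (p ∈ s ∧ ¬ {u, v} ⊆ s.erase p ∧ insert u (insert v (s.erase p)) ∈ K.faces)}

theorem stellarFaces_comm (K : TwoComplex N) (u v p : E N) :
    K.stellarFaces u v p = K.stellarFaces v u p := by
  ext s
  simp only [stellarFaces, Set.mem_ofPred_eq, Finset.pair_comm u v, Finset.insert_comm u v]

/-- `p` divides the edge `{u, v}` of `K` in the ratio `β : α`. -/
structure DividesEdge (K : TwoComplex N) (u v p : E N) (α β : ℝ) : Prop where
  ne : u ≠ v
  mem : {u, v} ∈ K.faces
  pos_left : 0 < α
  pos_right : 0 < β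
  add_eq : α + β = 1
  eq : p = α • u + β • v

namespace DividesEdge

theorem symm (h : DividesEdge K u v p α β) : DividesEdge K v u p β α :=
  ⟨h.ne.symm, Finset.pair_comm u v ▸ h.mem, h.pos_right, h.pos_left, by rw [add_comm, h.add_eq],
    by rw [add_comm, h.eq]⟩

theorem ne_left (h : DividesEdge K u v p α β) : p ≠ u := by
  have h1 : p - u = β • (v - u) := by
    rw [h.eq, (by linarith [h.add_eq] : α = 1 - β)]
    module
  intro hpu
  rw [hpu, sub_self, eq_comm, smul_eq_zero, sub_eq_zero] at h1
  rcases h1 with h1 | h1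
  · exact h.pos_right.ne' h1
  · exact h.ne h1.symm

theorem ne_right (h : DividesEdge K u v p α β) : p ≠ v := h.symm.ne_left

theorem mem_convexHull (h : DividesEdge K u v p α β) {s : Finset (E N)} (hu : u ∈ s) (hv : v ∈ s) :
    p ∈ convexHull ℝ (s : Set (E N)) := by
  rw [h.eq]
  exact convex_convexHull ℝ _ (subset_convexHull ℝ _ hu) (subset_convexHull ℝ _ hv)
    h.pos_left.le h.pos_right.le h.add_eq

theorem notMem_vertices (h : DividesEdge K u v p α β) : p ∉ K.vertices := by
  intro hp
  have := (K.vertex_mem_convexHull_iff hp h.mem).1 (h.mem_convexHull (by simp) (by simp))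
  simp [h.ne_left, h.ne_right] at this

theorem notMem_face (h : DividesEdge K u v p α β) {s : Finset (E N)} (hs : s ∈ K.faces) : p ∉ s :=
  fun hp => h.notMem_vertices (K.subset_vertices hs hp)

/-- Weights on the subdivision, pushed to weights on `K`. -/
theorem pushWeight (h : DividesEdge K u v p α β) {s : Finset (E N)} (hs : s ∈ K.stellarFaces u v p)
    {c : E N →₀ ℝ} (hc : IsConvexWeight c s) :
    (∃ k ∈ K.faces, IsConvexWeight
      (c.erase p + c p • (Finsupp.single u α + Finsupp.single v β)) k) ∧
    bary (c.erase p + c p • (Finsupp.single u α + Finsupp.single v β)) = bary c ∧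
    (c u = 0 ∨ c v = 0) := by
  have hdec : Finsupp.single p (c p) + c.erase p = c := Finsupp.single_add_erase p c
  have hb : c p • p + bary (c.erase p) = bary c := by
    conv_rhs => rw [← hdec, map_add, bary_single]
  have hm : c p + mass (c.erase p) = 1 := by
    conv_rhs => rw [← hc.mass_eq, ← hdec, map_add, mass_single]
  have nn : ∀ y, 0 ≤ (c.erase p + c p • (Finsupp.single u α + Finsupp.single v β)) y := by
    intro y
    have h1 := h.pos_left.le
    have h2 := h.pos_right.le
    simp only [Finsupp.add_apply, Finsupp.smul_apply, Finsupp.erase_apply, Finsupp.single_apply,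
      smul_eq_mul]
    refine add_nonneg ?_ (mul_nonneg (hc.nonneg p) (add_nonneg ?_ ?_))
    · split_ifs
      · exact le_rfl
      · exact hc.nonneg y
    · split_ifs <;> simp [h1]
    · split_ifs <;> simp [h2]
  refine ⟨?_, ?_, ?_⟩
  · have hmass : mass (c.erase p + c p • (Finsupp.single u α + Finsupp.single v β)) = 1 := by
      rw [map_add, map_smul, map_add, mass_single, mass_single, h.add_eq, smul_eq_mul, mul_one,
        add_comm, hm]
    have hsupp : (c.erase p).support ⊆ s.erase p := by
      rw [Finsupp.support_erase]
      exact Finset.erase_subset_erase p hc.supp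
    rcases hs with ⟨hs, -⟩ | ⟨-, -, hs⟩
    · refine ⟨s, hs, nn, ?_, hmass⟩
      rw [hc.eq_zero (h.notMem_face hs), zero_smul, add_zero]
      exact hsupp.trans (Finset.erase_subset _ _)
    · refine ⟨_, hs, nn, ?_, hmass⟩
      refine Finsupp.support_add.trans (Finset.union_subset ?_ (Finsupp.support_smul.trans
        (Finsupp.support_add.trans (Finset.union_subset ?_ ?_))))
      · exact hsupp.trans ((Finset.subset_insert _ _).trans (Finset.subset_insert _ _))
      · exact Finsupp.support_single_subset.trans (by simp)
      · exact Finsupp.support_single_subset.trans (by simp)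
  · rw [map_add, map_smul, map_add, bary_single, bary_single, ← h.eq, add_comm, hb]
  · by_contra! hcon
    have hu : u ∈ s := by
      by_contra hu
      exact hcon.1 (hc.eq_zero hu)
    have hv : v ∈ s := by
      by_contra hv
      exact hcon.2 (hc.eq_zero hv)
    rcases hs with ⟨-, hs⟩ | ⟨-, hs, -⟩
    · exact hs (by simp [Finset.insert_subset_iff, hu, hv])
    · exact hs (by simp [Finset.insert_subset_iff, hu, hv, h.ne_left.symm, h.ne_right.symm])

/-- Pushing adds `α` times the weight of `p` at `u`, and `β` times it at `v`. Where `d` vanishes,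
its pushed weight comes from `p` alone and bounds that of `c`. Applied in both directions, this
recovers the weight of `p` from the pushed weights. -/
theorem weight_le (h : DividesEdge K u v p α β) {c d : E N →₀ ℝ} (hc : ∀ y, 0 ≤ c y)
    (hd : d u = 0 ∨ d v = 0)
    (he : c.erase p + c p • (Finsupp.single u α + Finsupp.single v β) =
      d.erase p + d p • (Finsupp.single u α + Finsupp.single v β)) : c p ≤ d p := by
  have hu := DFunLike.congr_fun he u
  have hv := DFunLike.congr_fun he v
  simp only [Finsupp.add_apply, Finsupp.smul_apply, Finsupp.erase_apply, Finsupp.single_apply,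
      smul_eq_mul, if_true, if_neg h.ne, if_neg h.ne.symm, if_neg h.ne_left.symm,
      if_neg h.ne_right.symm] at hu hv
  have h1 := h.pos_left
  have h2 := h.pos_right
  by_contra hlt
  rw [not_le] at hlt
  rcases hd with h0 | h0
  · rw [h0] at hu
    nlinarith [hc u]
  · rw [h0] at hv
    nlinarith [hc v]

/-- The stellar subdivision of the edge `{u, v}` at `p`. -/
noncomputable def stellar (h : DividesEdge K u v p α β) : TwoComplex N :=
  ofWeightUnique (K.stellarFaces u v p)
    (by
      rintro s (⟨hs, -⟩ | ⟨hs, -⟩)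
      · exact K.nonempty_of_mem hs
      · exact ⟨p, hs⟩)
    (by
      rintro s hs t hts ht
      rcases hs with ⟨hs, hs2⟩ | ⟨hps, hs, hs2⟩
      · exact Or.inl ⟨K.down_closed hs hts ht, fun hcon => hs2 (hcon.trans hts)⟩
      · have hte : t.erase p ⊆ s.erase p := Finset.erase_subset_erase p hts
        by_cases hpt : p ∈ t
        · refine Or.inr ⟨hpt, fun hcon => hs (hcon.trans hte), K.down_closed hs2 ?_ (by simp)⟩
          exact Finset.insert_subset_insert _ (Finset.insert_subset_insert _ hte)
        · rw [Finset.erase_eq_of_notMem hpt] at hte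
          refine Or.inl ⟨K.down_closed hs2 ?_ ht, fun hcon => hs (hcon.trans hte)⟩
          exact hte.trans ((Finset.subset_insert _ _).trans (Finset.subset_insert _ _)))
    (by
      refine Set.Finite.subset (Finset.finite_toSet
        (insert p K.finite_vertices.toFinset).powerset) ?_
      intro s hs
      rw [Finset.mem_coe, Finset.mem_powerset]
      intro x hx
      rw [Finset.mem_insert, Set.Finite.mem_toFinset]
      by_cases hxp : x = p
      · exact Or.inl hxp
      · right
        rcases hs with ⟨hs, -⟩ | ⟨-, -, hs⟩
        · exact K.subset_vertices hs hx
        · exact K.subset_vertices hs (by simp [hxp, hx]))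
    (by
      rintro s (⟨hs, -⟩ | ⟨hps, hs, hs2⟩)
      · exact K.card_le_three s hs
      · have h1 := K.card_le_three _ hs2
        -- As `s.erase p` lacks `u` or `v`, adding both is a strict gain, which makes up for the
        -- vertex `p`.
        have h2 : (s.erase p).card < (insert u (insert v (s.erase p))).card := by
          refine Finset.card_lt_card (Finset.ssubset_iff_subset_ne.2 ⟨?_, fun hcon => ?_⟩)
          · exact (Finset.subset_insert _ _).trans (Finset.subset_insert _ _)
          · exact hs (by rw [hcon]; simp [Finset.insert_subset_iff])
        rw [Finset.card_erase_of_mem hps] at h2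
        omega)
    (by
      intro s hs t ht c d hc hd hcd
      obtain ⟨⟨k, hk, hck⟩, hcb, hc0⟩ := h.pushWeight hs hc
      obtain ⟨⟨l, hl, hdl⟩, hdb, hd0⟩ := h.pushWeight ht hd
      have he := K.weight_unique hk hl hck hdl (hcb.trans (hcd.trans hdb.symm))
      have hp : c p = d p := le_antisymm (h.weight_le hc.nonneg hd0 he)
        (h.weight_le hd.nonneg hc0 he.symm)
      rw [hp, add_left_inj] at he
      rw [← Finsupp.single_add_erase p c, ← Finsupp.single_add_erase p d, he, hp])

theorem mem_stellar (h : DividesEdge K u v p α β) {s : Finset (E N)} :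
    s ∈ h.stellar.faces ↔ (s ∈ K.faces ∧ ¬ {u, v} ⊆ s) ∨
      (p ∈ s ∧ ¬ {u, v} ⊆ s.erase p ∧ insert u (insert v (s.erase p)) ∈ K.faces) := Iff.rfl

/-- Exchange the whole weight of `u`, with the matching part of the weight of `v`, for weight `l = c
u / α` at `p`. The inequality says that the weight of `v` stays nonnegative; in the opposite case
the roles of `u` and `v` are exchanged. -/
theorem exists_stellarFace (h : DividesEdge K u v p α β) {s : Finset (E N)} (hs : s ∈ K.faces)
    (hu : u ∈ s) (hv : v ∈ s) {c : E N →₀ ℝ} (hc : IsConvexWeight c s)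
    (hle : c u * β ≤ c v * α) :
    ∃ t ∈ K.stellarFaces u v p, bary c ∈ convexHull ℝ (t : Set (E N)) := by
  have hp := h.notMem_face hs
  have h1 := h.pos_left
  have h2 := h.pos_right
  set l : ℝ := c u / α with hl
  have hl0 : 0 ≤ l := div_nonneg (hc.nonneg u) h1.le
  have hlu : l * α = c u := div_mul_cancel₀ _ h1.ne'
  have hlv : l * β ≤ c v := by
    rw [hl, div_mul_eq_mul_div]
    exact (div_le_iff₀ h1).2 hle
  set d : E N →₀ ℝ := c - l • (Finsupp.single u α + Finsupp.single v β) + Finsupp.single p l with hd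
  have hdy : ∀ y, d y = c y - l * ((if u = y then α else 0) + (if v = y then β else 0)) +
      (if p = y then l else 0) := by
    intro y
    simp only [hd, Finsupp.add_apply, Finsupp.sub_apply, Finsupp.smul_apply, Finsupp.single_apply,
      smul_eq_mul]
  refine ⟨insert p (s.erase u), ?_, mem_convexHull_iff_weight.2 ⟨d, ⟨?_, ?_, ?_⟩, ?_⟩⟩
  · right
    have hp' : p ∉ s.erase u := fun hcon => hp (Finset.mem_of_mem_erase hcon)
    rw [Finset.erase_insert hp']
    refine ⟨by simp, by simp [Finset.insert_subset_iff], ?_⟩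
    have hvs : v ∈ s.erase u := Finset.mem_erase.2 ⟨h.ne.symm, hv⟩
    rwa [Finset.insert_eq_of_mem hvs, Finset.insert_erase hu]
  · intro y
    rw [hdy]
    refine add_nonneg ?_ (by split_ifs <;> simp [hl0])
    by_cases hyu : u = y
    · subst hyu
      rw [if_pos rfl, if_neg h.ne.symm, add_zero, hlu, sub_self]
    · rw [if_neg hyu, zero_add]
      split_ifs with hyv
      · subst hyv
        linarith
      · simpa using hc.nonneg y
  · intro y hy
    rw [Finsupp.mem_support_iff, hdy] at hy
    by_contra hcon
    rw [Finset.mem_insert, Finset.mem_erase, not_or, not_and] at hcon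
    apply hy
    rw [if_neg (Ne.symm hcon.1)]
    by_cases hyu : u = y
    · subst hyu
      rw [if_pos rfl, if_neg h.ne.symm, add_zero, add_zero, hlu, sub_self]
    · have hys := hcon.2 (Ne.symm hyu)
      rw [if_neg hyu, if_neg (fun hyv : v = y => hys (hyv ▸ hv)), hc.eq_zero hys]
      simp
  · rw [hd, map_add, map_sub, map_smul, map_add, mass_single, mass_single, mass_single, h.add_eq,
      hc.mass_eq, smul_eq_mul]
    ring
  · rw [hd, map_add, map_sub, map_smul, map_add, bary_single, bary_single, bary_single, ← h.eq]
    abel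

theorem isSubdivision (h : DividesEdge K u v p α β) : h.stellar.IsSubdivision K := by
  have hsub : ∀ t ∈ h.stellar.faces, ∃ s ∈ K.faces,
      convexHull ℝ (t : Set (E N)) ⊆ convexHull ℝ (s : Set (E N)) := by
    intro t ht
    rcases h.mem_stellar.1 ht with ⟨ht, -⟩ | ⟨hpt, -, ht⟩
    · exact ⟨t, ht, subset_rfl⟩
    · refine ⟨_, ht, convexHull_min ?_ (convex_convexHull ℝ _)⟩
      intro x hx
      by_cases hxp : x = p
      · rw [hxp]
        exact h.mem_convexHull (by simp) (by simp)
      · exact subset_convexHull ℝ _ (by simp [hxp, Finset.mem_coe.1 hx])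
  refine ⟨Set.Subset.antisymm ?_ ?_, hsub⟩
  · intro x hx
    obtain ⟨t, ht, hxt⟩ := Geometry.SimplicialComplex.mem_space_iff.1 hx
    obtain ⟨s, hs, hts⟩ := hsub t ht
    exact Geometry.SimplicialComplex.mem_space_iff.2 ⟨s, hs, hts hxt⟩
  · intro x hx
    obtain ⟨s, hs, hxs⟩ := Geometry.SimplicialComplex.mem_space_iff.1 hx
    apply Geometry.SimplicialComplex.mem_space_iff.2
    by_cases huv : {u, v} ⊆ s
    · obtain ⟨c, hc, rfl⟩ := mem_convexHull_iff_weight.1 hxs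
      have hu : u ∈ s := huv (by simp)
      have hv : v ∈ s := huv (by simp)
      rcases le_total (c u * β) (c v * α) with hle | hle
      · exact h.exists_stellarFace hs hu hv hc hle
      · obtain ⟨t, ht, h1⟩ := h.symm.exists_stellarFace hs hv hu hc hle
        exact ⟨t, (stellarFaces_comm K u v p ▸ ht : t ∈ K.stellarFaces u v p), h1⟩
    · exact ⟨s, Or.inl ⟨hs, huv⟩, hxs⟩

theorem mem_vertices_stellar (h : DividesEdge K u v p α β) : u ∈ h.stellar.vertices := by
  refine h.mem_stellar.2 (Or.inl ⟨K.subset_vertices h.mem (by simp), fun hcon => ?_⟩)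
  exact h.ne.symm (Finset.mem_singleton.1 (hcon (by simp : v ∈ {u, v})))

/-- Seen from `u`, the subdivision just moves the neighbor `v` to `p`. This makes invariance under
subdivision a tool for changing edge lengths. -/
theorem star_stellar (h : DividesEdge K u v p α β) {t : Finset (E N)} :
    t ∈ (h.stellar.star u).faces ↔
      ∃ s ∈ (K.star u).faces, s.image (fun x => if x = v then p else x) = t := by
  have himg : ∀ s : Finset (E N), v ∉ s → s.image (fun x => if x = v then p else x) = s := by
    intro s hs
    conv_rhs => rw [← Finset.image_id (s := s)]
    refine Finset.image_congr fun x hx => ?_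
    exact if_neg fun hxv : x = v => hs (hxv ▸ Finset.mem_coe.1 hx)
  have himg' : ∀ s : Finset (E N), v ∈ s → s.image (fun x => if x = v then p else x) =
      insert p (s.erase v) := by
    intro s hs
    conv_lhs => rw [← Finset.insert_erase hs]
    rw [Finset.image_insert, himg _ (Finset.notMem_erase _ _), if_pos rfl]
  simp only [mem_star, h.mem_stellar]
  constructor
  · rintro ⟨h1, h2⟩
    by_cases hpt : p ∈ t
    · have h3 : p ∈ insert u t := Finset.mem_insert_of_mem hpt
      rcases h2 with ⟨h2, -⟩ | ⟨-, h2, h4⟩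
      · exact absurd h3 (h.notMem_face h2)
      rw [Finset.erase_insert_of_ne h.ne_left.symm] at h2 h4
      have hvt : v ∉ t.erase p := by
        intro hcon
        exact h2 (by simp [Finset.insert_subset_iff] at hcon ⊢; tauto)
      refine ⟨insert v (t.erase p), ⟨K.down_closed h4 ?_ (by simp), ?_⟩, ?_⟩
      · intro x hx
        simp only [Finset.mem_insert] at hx ⊢
        tauto
      · convert h4 using 1
        ext x
        simp only [Finset.mem_insert]
        tauto
      · rw [himg' _ (Finset.mem_insert_self _ _), Finset.erase_insert hvt, Finset.insert_erase hpt]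
    · rcases h1 with ⟨h1, h3⟩ | ⟨h1, -⟩
      · rcases h2 with ⟨h2, h4⟩ | ⟨h2, -⟩
        · refine ⟨t, ⟨h1, h2⟩, himg t fun hvt => h4 ?_⟩
          simp [Finset.insert_subset_iff, hvt]
        · rcases Finset.mem_insert.1 h2 with h2 | h2
          · exact absurd h2 h.ne_left
          · exact absurd h2 hpt
      · exact absurd h1 hpt
  · rintro ⟨s, ⟨hs, hs2⟩, rfl⟩
    by_cases hv : v ∈ s
    · rw [himg' s hv]
      have hps : p ∉ s.erase v := fun hcon => h.notMem_face hs (Finset.mem_of_mem_erase hcon)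
      have hps' : p ∉ insert u (s.erase v) := by
        rw [Finset.mem_insert, not_or]
        exact ⟨h.ne_left, hps⟩
      have e1 : insert u (insert v (s.erase v)) = insert u s := by rw [Finset.insert_erase hv]
      refine ⟨Or.inr ⟨by simp, ?_, ?_⟩, Or.inr ⟨by simp, ?_, ?_⟩⟩
      · rw [Finset.erase_insert hps]
        simp [Finset.insert_subset_iff]
      · rwa [Finset.erase_insert hps, e1]
      · rw [Finset.insert_comm, Finset.erase_insert hps']
        simp [Finset.insert_subset_iff, h.ne.symm]
      · rw [Finset.insert_comm u p, Finset.erase_insert hps', Finset.insert_comm v u,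
          Finset.insert_idem, e1]
        exact hs2
    · rw [himg s hv]
      refine ⟨Or.inl ⟨hs, fun hcon => hv (hcon (by simp))⟩, Or.inl ⟨hs2, fun hcon => ?_⟩⟩
      have := hcon (by simp : v ∈ {u, v})
      rw [Finset.mem_insert] at this
      rcases this with h1 | h1
      · exact h.ne h1.symm
      · exact hv h1

end DividesEdge

end TwoComplex

/-! ### Shrinking a star -/

/-- The vertex-supported function `ψ`, extended by `0` to all points. -/
noncomputable def VertexFunction.eval (ψ : VertexFunction) {N : ℕ} (K : TwoComplex N) (v : E N) :
    ℝ := if h : v ∈ K.vertices then ψ K ⟨v, h⟩ else 0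

theorem VertexFunction.eval_of_mem (ψ : VertexFunction) {N : ℕ} {K : TwoComplex N} {v : E N}
    (h : v ∈ K.vertices) : ψ.eval K v = ψ K ⟨v, h⟩ := dif_pos h

/-- The vertex functions that have the invariance properties and the total sum `0`. -/
structure IsNull (ψ : VertexFunction) : Prop where
  star : ψ.InvariantUnderStarIsometry
  subdivision : ψ.InvariantUnderSubdivision
  continuous : ψ.IsContinuous
  sum_eq_zero : ∀ ⦃N : ℕ⦄ (K : TwoComplex N), ∑ v : K.vertices, ψ K v = 0

namespace IsNull

variable {ψ : VertexFunction} {N M : ℕ} {K J : TwoComplex N} {L : TwoComplex M} {u v : E N}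

theorem eval_subdivision (h : IsNull ψ) (hJ : J.IsSubdivision K) (hvK : v ∈ K.vertices)
    (hvJ : v ∈ J.vertices) : ψ.eval J v = ψ.eval K v := by
  rw [ψ.eval_of_mem hvK, ψ.eval_of_mem hvJ, h.subdivision K J hJ v hvK hvJ]

theorem eval_isometry (h : IsNull ψ) (hv : v ∈ K.vertices) {f : E N → E M}
    (hf : IsSimplicialIso f (K.star v) (L.star (f v)))
    (hd : ∀ s ∈ (K.star v).faces, ∀ x ∈ s, ∀ y ∈ s, dist (f x) (f y) = dist x y) :
    ψ.eval L (f v) = ψ.eval K v := by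
  have hw : f v ∈ L.vertices := (hf.mem_vertices (K.mem_star_vertices ⟨v, hv⟩)).1
  rw [ψ.eval_of_mem hv, ψ.eval_of_mem hw]
  exact (h.star K L ⟨v, hv⟩ ⟨f v, hw⟩ (starIsometric_iff.2 ⟨f, rfl, hf, hd⟩)).symm

/-- A star is its own star, so the identity is a star isometry. This allows the zero sum to be
applied to a star alone. -/
theorem eval_star (h : IsNull ψ) (hv : v ∈ K.vertices) :
    ψ.eval (K.star v) v = ψ.eval K v := by
  refine h.eval_isometry (f := id) hv ⟨Set.injOn_id _, fun t => ?_⟩ fun _ _ _ _ _ _ => rfl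
  simp only [id, TwoComplex.star_star]
  constructor
  · exact fun ht => ⟨t, ht, Finset.image_id⟩
  · rintro ⟨s, hs, rfl⟩
    have hid : s.image id = s := Finset.image_id
    rw [hid]
    exact hs

theorem sum_eval (h : IsNull ψ) {S : Finset (E N)} (hS : ∀ x, x ∈ S ↔ x ∈ K.vertices) :
    ∑ x ∈ S, ψ.eval K x = 0 := by
  rw [← h.sum_eq_zero K, Finset.sum_subtype S hS]
  exact Finset.sum_congr rfl fun x _ => ψ.eval_of_mem x.2

end IsNull

namespace TwoComplex

variable {N : ℕ} {K : TwoComplex N} {u : E N}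

theorem mem_star_vertices_iff (hu : u ∈ K.vertices) {x : E N} :
    x ∈ (K.star u).vertices ↔ x = u ∨ x ∈ K.neighbors u := by
  rw [mem_neighbors]
  constructor
  · rintro ⟨h1, h2⟩
    by_cases hx : x = u
    · exact Or.inl hx
    · exact Or.inr ⟨hx, h2⟩
  · rintro (rfl | ⟨h1, h2⟩)
    · exact K.mem_star_vertices ⟨x, hu⟩
    · exact ⟨K.subset_vertices h2 (by simp), h2⟩

end TwoComplex

theorem Finset.image_congr_vertices {N : ℕ} {K : TwoComplex N} {f g : E N → E N}
    (h : ∀ x ∈ K.vertices, f x = g x) {s : Finset (E N)} (hs : s ∈ K.faces) :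
    s.image f = s.image g :=
  Finset.image_congr fun x hx => h x (K.subset_vertices hs hx)

namespace IsNull

variable {ψ : VertexFunction} {N : ℕ} {K : TwoComplex N} {u : E N}

/-- Induction on the points to be moved, with one stellar subdivision for each neighbor that really
moves. Only the star of `u` has to be controlled. -/
theorem exists_shrink_finset (h : IsNull ψ) (hu : u ∈ K.vertices) {r : E N → ℝ}
    (hr : ∀ x, 0 < r x ∧ r x ≤ 1) (A : Finset (E N)) :
    ∃ K' : TwoComplex N, u ∈ K'.vertices ∧ ψ.eval K' u = ψ.eval K u ∧
      ∀ t, t ∈ (K'.star u).faces ↔ ∃ s ∈ (K.star u).faces,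
        s.image (fun x => if x ∈ A then u + r x • (x - u) else x) = t := by
  induction A using Finset.induction_on with
  | empty =>
    refine ⟨K, hu, rfl, fun t => ?_⟩
    simp only [Finset.notMem_empty, if_false]
    constructor
    · exact fun ht => ⟨t, ht, Finset.image_id⟩
    · rintro ⟨s, hs, rfl⟩
      have hid : s.image (fun x : E N => x) = s := Finset.image_id
      rw [hid]
      exact hs
  | insert a A ha ih =>
    obtain ⟨K', hu', hK', hstar⟩ := ih
    -- Otherwise `a` is outside the star, is `u` itself, or has `r a = 1`; in each case the star
    -- stays as it is.
    by_cases hcase : a ∈ K.neighbors u ∧ r a < 1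
    · obtain ⟨haN, hra⟩ := hcase
      obtain ⟨hau, haf⟩ := TwoComplex.mem_neighbors.1 haN
      have hface : {u, a} ∈ K'.faces := by
        have h1 : ({u, a} : Finset (E N)) ∈ (K'.star u).faces := by
          refine (hstar _).2 ⟨{u, a}, TwoComplex.mem_star_of_mem haf (by simp), ?_⟩
          rw [Finset.image_insert, Finset.image_singleton, if_neg ha]
          simp
        exact h1.1
      have hdiv : TwoComplex.DividesEdge K' u a (u + r a • (a - u)) (1 - r a) (r a) :=
        ⟨hau.symm, hface, by linarith, (hr a).1, by ring, by module⟩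
      refine ⟨hdiv.stellar, hdiv.mem_vertices_stellar, ?_, fun t => ?_⟩
      · rw [h.eval_subdivision hdiv.isSubdivision hu' hdiv.mem_vertices_stellar, hK']
      · rw [hdiv.star_stellar]
        have hcongr : ∀ s ∈ (K.star u).faces,
            (s.image fun x => if x ∈ A then u + r x • (x - u) else x).image
              (fun x => if x = a then u + r a • (a - u) else x) =
            s.image fun x => if x ∈ insert a A then u + r x • (x - u) else x := by
          intro s hs
          rw [Finset.image_image]
          refine Finset.image_congr_vertices (K := K.star u) (fun x hx => ?_) hs
          rw [Function.comp_apply]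
          by_cases hxa : x = a
          · subst hxa
            rw [if_neg ha, if_pos rfl, if_pos (Finset.mem_insert_self _ _)]
          · have h1 : x ∈ insert a A ↔ x ∈ A := by simp [hxa]
            simp only [h1]
            -- A vertex moved earlier cannot have landed on `a`, since distinct neighbors lie on
            -- distinct rays from `u`.
            refine if_neg ?_
            split_ifs with hxA
            · intro hcon
              rcases (TwoComplex.mem_star_vertices_iff hu).1 hx with rfl | hxN
              · rw [sub_self, smul_zero, add_zero] at hcon
                exact hau hcon.symm
              · refine hxa (TwoComplex.neighbors_ray_unique haN hxN (hr x).1 ?_).symm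
                rw [← hcon]
                abel
            · exact hxa
        constructor
        · rintro ⟨s', hs', rfl⟩
          obtain ⟨s, hs, rfl⟩ := (hstar _).1 hs'
          exact ⟨s, hs, (hcongr s hs).symm⟩
        · rintro ⟨s, hs, rfl⟩
          exact ⟨_, (hstar _).2 ⟨s, hs, rfl⟩, hcongr s hs⟩
    · refine ⟨K', hu', hK', fun t => ?_⟩
      rw [hstar]
      refine exists_congr fun s => and_congr_right fun hs => ?_
      rw [Finset.image_congr_vertices (K := K.star u) (fun x hx => ?_) hs]
      by_cases hxa : x = a
      · subst hxa
        rw [if_neg ha, if_pos (Finset.mem_insert_self _ _)]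
        rcases (TwoComplex.mem_star_vertices_iff hu).1 hx with rfl | hxN
        · simp
        · have : r x = 1 := le_antisymm (hr x).2 (not_lt.1 fun hlt => hcase ⟨hxN, hlt⟩)
          rw [this, one_smul]
          abel
      · have h1 : x ∈ insert a A ↔ x ∈ A := by simp [hxa]
        simp only [h1]

/-- The star of `u` can be shrunk by moving its vertices towards `u`. -/
theorem exists_shrink (h : IsNull ψ) (hu : u ∈ K.vertices) {r : E N → ℝ}
    (hr : ∀ x, 0 < r x ∧ r x ≤ 1) :
    ∃ K' : TwoComplex N, u ∈ K'.vertices ∧ ψ.eval K' u = ψ.eval K u ∧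
      ∀ t, t ∈ (K'.star u).faces ↔ ∃ s ∈ (K.star u).faces,
        s.image (fun x => u + r x • (x - u)) = t := by
  obtain ⟨K', h1, h2, h3⟩ := h.exists_shrink_finset hu hr K.finite_vertices.toFinset
  refine ⟨K', h1, h2, fun t => ?_⟩
  rw [h3]
  refine exists_congr fun s => and_congr_right fun hs => ?_
  rw [Finset.image_congr_vertices (K := K.star u) (fun x hx => ?_) hs]
  exact if_pos ((Set.Finite.mem_toFinset K.finite_vertices).2 (show x ∈ K.vertices from hx.1))

end IsNull

/-! ### Books -/

namespace TwoComplex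

variable {N M : ℕ}

/-- The star of `u` in `K` consists of the triangles `{u, v, w}`, `w ∈ W`, glued along the edge
`{u, v}`. -/
structure IsBook (K : TwoComplex N) (u v : E N) (W : Finset (E N)) : Prop where
  ne : u ≠ v
  notMem_left : u ∉ W
  notMem_right : v ∉ W
  mem_iff : ∀ t, t ∈ (K.star u).faces ↔
    t.Nonempty ∧ (t ⊆ {u, v} ∨ ∃ w ∈ W, t ⊆ {u, v, w})

namespace IsBook

variable {K : TwoComplex N} {u v : E N} {W : Finset (E N)}

theorem mem_vertices (h : K.IsBook u v W) : u ∈ K.vertices :=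
  ((h.mem_iff {u}).2 ⟨by simp, Or.inl (by simp)⟩).1

theorem mem_star_vertices (h : K.IsBook u v W) {x : E N} :
    x ∈ (K.star u).vertices ↔ x = u ∨ x = v ∨ x ∈ W := by
  change {x} ∈ (K.star u).faces ↔ _
  rw [h.mem_iff]
  simp only [Finset.singleton_nonempty, true_and, Finset.singleton_subset_iff, Finset.mem_insert,
    Finset.mem_singleton]
  constructor
  · rintro ((h1 | h1) | ⟨w, hw, h1 | h1 | h1⟩)
    · exact Or.inl h1
    · exact Or.inr (Or.inl h1)
    · exact Or.inl h1
    · exact Or.inr (Or.inl h1)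
    · exact Or.inr (Or.inr (h1 ▸ hw))
  · rintro (h1 | h1 | h1)
    · exact Or.inl (Or.inl h1)
    · exact Or.inl (Or.inr h1)
    · exact Or.inr ⟨x, h1, Or.inr (Or.inr rfl)⟩

theorem triangle_mem (h : K.IsBook u v W) {w : E N} (hw : w ∈ W) : {u, v, w} ∈ K.faces :=
  ((h.mem_iff _).2 ⟨by simp, Or.inr ⟨w, hw, subset_rfl⟩⟩).1

theorem mem_neighbors_right (h : K.IsBook u v W) : v ∈ K.neighbors u :=
  ((mem_star_vertices_iff h.mem_vertices).1 (h.mem_star_vertices.2 (by simp))).resolve_left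
    h.ne.symm

theorem mem_neighbors (h : K.IsBook u v W) {w : E N} (hw : w ∈ W) : w ∈ K.neighbors u :=
  ((mem_star_vertices_iff h.mem_vertices).1 (h.mem_star_vertices.2 (by simp [hw]))).resolve_left
    fun hwu => h.notMem_left (hwu ▸ hw)

theorem ne_left (h : K.IsBook u v W) {w : E N} (hw : w ∈ W) : w ≠ u :=
  fun hwu => h.notMem_left (hwu ▸ hw)

theorem ne_right (h : K.IsBook u v W) {w : E N} (hw : w ∈ W) : w ≠ v :=
  fun hwv => h.notMem_right (hwv ▸ hw)

/-- Every maximal simplex contains the whole spine, so within this complex the star of `v` is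
everything. -/
theorem star_right (h : K.IsBook u v W) : (K.star u).IsBook v u W := by
  refine ⟨h.ne.symm, h.notMem_right, h.notMem_left, fun t => ?_⟩
  simp only [mem_star (K := K.star u), h.mem_iff]
  constructor
  · rintro ⟨⟨h1, h2⟩, -⟩
    refine ⟨h1, ?_⟩
    simp only [Finset.pair_comm v u, Finset.insert_comm v u]
    exact h2
  · rintro ⟨h1, h2⟩
    simp only [Finset.pair_comm v u, Finset.insert_comm v u] at h2
    refine ⟨⟨h1, h2⟩, by simp, ?_⟩
    rcases h2 with h2 | ⟨w, hw, h2⟩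
    · exact Or.inl (Finset.insert_subset (by simp) h2)
    · exact Or.inr ⟨w, hw, Finset.insert_subset (by simp) h2⟩

/-- Within the book, the simplices that contain `w` all belong to its one page. -/
theorem star_page (h : K.IsBook u v W) {w : E N} (hw : w ∈ W) :
    (K.star u).IsBook w u {v} := by
  have hwu := h.ne_left hw
  have hwv := h.ne_right hw
  refine ⟨hwu, by simpa using hwv, by simpa using h.ne, fun t => ?_⟩
  have e1 : ({w, u, v} : Finset (E N)) = {u, v, w} := by
    ext; simp only [Finset.mem_insert, Finset.mem_singleton]; tauto
  simp only [mem_star (K := K.star u), h.mem_iff, Finset.mem_singleton, exists_eq_left, e1]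
  constructor
  · rintro ⟨⟨h1, -⟩, -, h2⟩
    refine ⟨h1, Or.inr ?_⟩
    rcases h2 with h2 | ⟨w', hw', h2⟩
    · have := h2 (Finset.mem_insert_self w t)
      simp [hwu, hwv] at this
    · have := h2 (Finset.mem_insert_self w t)
      simp only [Finset.mem_insert, hwu, hwv, Finset.mem_singleton, false_or] at this
      rw [this]
      exact (Finset.subset_insert _ _).trans (this ▸ h2)
  · rintro ⟨h1, h2⟩
    have h3 : t ⊆ {u, v, w} := by
      rcases h2 with h2 | h2
      · refine h2.trans ?_
        intro x
        simp only [Finset.mem_insert, Finset.mem_singleton]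
        tauto
      · exact h2
    exact ⟨⟨h1, Or.inr ⟨w, hw, h3⟩⟩, by simp, Or.inr ⟨w, hw, Finset.insert_subset (by simp) h3⟩⟩

theorem angle_pos (h : K.IsBook u v W) {w : E N} (hw : w ∈ W) :
    0 < EuclideanGeometry.angle v u w ∧ EuclideanGeometry.angle v u w < Real.pi := by
  have hvu := h.ne.symm
  have hwu := h.ne_left hw
  have hwv := h.ne_right hw
  have huniq := fun α β α' β' =>
    triangle_coords_unique (α := α) (β := β) (α' := α') (β' := β') (h.triangle_mem hw) hvu.symm
      hwu.symm hwv.symm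
  constructor
  · refine lt_of_le_of_ne (EuclideanGeometry.angle_nonneg _ _ _) fun h0 => ?_
    obtain ⟨-, r, hr, hrw⟩ := InnerProductGeometry.angle_eq_zero_iff.1 h0.symm
    have := (huniq r 0 0 1 (by rw [zero_smul, zero_smul, one_smul, add_zero, zero_add]
                               exact hrw.symm)).1
    exact hr.ne' this
  · refine lt_of_le_of_ne (EuclideanGeometry.angle_le_pi _ _ _) fun h0 => ?_
    obtain ⟨-, r, hr, hrw⟩ := InnerProductGeometry.angle_eq_pi_iff.1 h0
    have := (huniq r 0 0 1 (by rw [zero_smul, zero_smul, one_smul, add_zero, zero_add]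
                               exact hrw.symm)).1
    exact hr.ne this

/-- Books are transported by images. -/
theorem image_mem_iff {f : E N → E M} {t : Finset (E M)} :
    (t.Nonempty ∧ (t ⊆ {f u, f v} ∨ ∃ w ∈ W.image f, t ⊆ {f u, f v, w})) ↔
      ∃ s : Finset (E N), (s.Nonempty ∧ (s ⊆ {u, v} ∨ ∃ w ∈ W, s ⊆ {u, v, w})) ∧
        s.image f = t := by
  have e1 : ({f u, f v} : Finset (E M)) = ({u, v} : Finset (E N)).image f := by
    rw [Finset.image_insert, Finset.image_singleton]
  have e2 : ∀ w, ({f u, f v, f w} : Finset (E M)) = ({u, v, w} : Finset (E N)).image f := by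
    intro w
    rw [Finset.image_insert, Finset.image_insert, Finset.image_singleton]
  constructor
  · rintro ⟨h1, h2 | ⟨w', hw', h2⟩⟩
    · rw [e1, Finset.subset_image_iff] at h2
      obtain ⟨s, hs, rfl⟩ := h2
      exact ⟨s, ⟨Finset.image_nonempty.1 h1, Or.inl hs⟩, rfl⟩
    · obtain ⟨w, hw, rfl⟩ := Finset.mem_image.1 hw'
      rw [e2, Finset.subset_image_iff] at h2
      obtain ⟨s, hs, rfl⟩ := h2
      exact ⟨s, ⟨Finset.image_nonempty.1 h1, Or.inr ⟨w, hw, hs⟩⟩, rfl⟩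
  · rintro ⟨s, ⟨h1, h2 | ⟨w, hw, h2⟩⟩, rfl⟩
    · exact ⟨Finset.image_nonempty.2 h1, Or.inl (e1 ▸ Finset.image_subset_image h2)⟩
    · exact ⟨Finset.image_nonempty.2 h1, Or.inr ⟨f w, Finset.mem_image_of_mem f hw,
        e2 w ▸ Finset.image_subset_image h2⟩⟩

end IsBook

end TwoComplex

namespace IsNull

open TwoComplex

variable {ψ : VertexFunction} {N M : ℕ} {K : TwoComplex N} {u v : E N} {W : Finset (E N)}

/-- Congruent pages suffice: vertices on different pages share no face, so a star isometry ignores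
their distance. -/
theorem eval_book_congr (h : IsNull ψ) {K' : TwoComplex M} {u' v' : E M} {g : E N → E M}
    (hK : K.IsBook u v W) (hK' : K'.IsBook u' v' (W.image g)) (hg : Set.InjOn g W)
    (hd : dist u' v' = dist u v) (hu : ∀ w ∈ W, dist u' (g w) = dist u w)
    (hv : ∀ w ∈ W, dist v' (g w) = dist v w) : ψ.eval K' u' = ψ.eval K u := by
  set f : E N → E M := fun x => if x = u then u' else if x = v then v' else g x with hf
  have hfu : f u = u' := if_pos rfl
  have hfv : f v = v' := by
    simp only [hf, if_neg hK.ne.symm, if_pos]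
  have hfw : ∀ w ∈ W, f w = g w := by
    intro w hw
    simp only [hf, if_neg (hK.ne_left hw), if_neg (hK.ne_right hw)]
  have hW : W.image f = W.image g := Finset.image_congr hfw
  have hiso : IsSimplicialIso f (K.star u) (K'.star (f u)) := by
    constructor
    · have key : ∀ w ∈ W, u' ≠ g w ∧ v' ≠ g w := fun w hw =>
        ⟨(hK'.ne_left (Finset.mem_image_of_mem g hw)).symm,
          (hK'.ne_right (Finset.mem_image_of_mem g hw)).symm⟩
      intro x hx y hy hxy
      rcases hK.mem_star_vertices.1 hx with rfl | rfl | hx' <;>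
      rcases hK.mem_star_vertices.1 hy with rfl | rfl | hy'
      · rfl
      · rw [hfu, hfv] at hxy; exact absurd hxy hK'.ne
      · rw [hfu, hfw y hy'] at hxy; exact absurd hxy (key y hy').1
      · rw [hfu, hfv] at hxy; exact absurd hxy.symm hK'.ne
      · rfl
      · rw [hfv, hfw y hy'] at hxy; exact absurd hxy (key y hy').2
      · rw [hfu, hfw x hx'] at hxy; exact absurd hxy.symm (key x hx').1
      · rw [hfv, hfw x hx'] at hxy; exact absurd hxy.symm (key x hx').2
      · rw [hfw x hx', hfw y hy'] at hxy; exact hg hx' hy' hxy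
    · intro t
      have := IsBook.image_mem_iff (f := f) (u := u) (v := v) (W := W) (t := t)
      rw [hfu, hfv, hW] at this
      rw [hfu, hK'.mem_iff, this]
      simp only [hK.mem_iff]
  have hdist : ∀ s ∈ (K.star u).faces, ∀ x ∈ s, ∀ y ∈ s, dist (f x) (f y) = dist x y := by
    have key : ∀ w ∈ W, ∀ x ∈ ({u, v, w} : Finset (E N)), ∀ y ∈ ({u, v, w} : Finset (E N)),
        dist (f x) (f y) = dist x y := by
      intro w hw x hx y hy
      simp only [Finset.mem_insert, Finset.mem_singleton] at hx hy
      rcases hx with rfl | rfl | rfl <;> rcases hy with rfl | rfl | rfl <;>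
        simp only [hfu, hfv, hfw _ hw, dist_self, hd, hu _ hw, hv _ hw, dist_comm v' u',
          dist_comm (g _) u', dist_comm (g _) v']
      · exact dist_comm _ _
      · exact dist_comm _ _
      · exact dist_comm _ _
    have key' : ∀ x ∈ ({u, v} : Finset (E N)), ∀ y ∈ ({u, v} : Finset (E N)),
        dist (f x) (f y) = dist x y := by
      intro x hx y hy
      simp only [Finset.mem_insert, Finset.mem_singleton] at hx hy
      rcases hx with rfl | rfl <;> rcases hy with rfl | rfl <;>
        simp only [hfu, hfv, dist_self, hd, dist_comm v' u']
      exact dist_comm _ _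
    intro s hs x hx y hy
    rcases ((hK.mem_iff s).1 hs).2 with h1 | ⟨w, hw, h1⟩
    · exact key' x (h1 hx) y (h1 hy)
    · exact key w hw x (h1 hx) y (h1 hy)
  have := h.eval_isometry hK.mem_vertices hiso hdist
  rwa [hfu] at this

theorem book_sum (h : IsNull ψ) (hK : K.IsBook u v W) :
    ψ.eval K u + ψ.eval (K.star u) v + ∑ w ∈ W, ψ.eval (K.star u) w = 0 := by
  have := h.sum_eval (K := K.star u) (S := insert u (insert v W)) (fun x => by
    rw [hK.mem_star_vertices, Finset.mem_insert, Finset.mem_insert])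
  rw [Finset.sum_insert (by simp [hK.ne, hK.notMem_left]), Finset.sum_insert hK.notMem_right,
    h.eval_star hK.mem_vertices] at this
  linarith

/-- All vertices other than `u` move along their own rays, by independent factors; the angles at `u`
stay the same and distinct pages stay distinct. -/
theorem exists_shrink_book (h : IsNull ψ) (hK : K.IsBook u v W) {s : ℝ} {t : E N → ℝ}
    (hs : 0 < s ∧ s ≤ 1) (ht : ∀ w ∈ W, 0 < t w ∧ t w ≤ 1) :
    ∃ K' : TwoComplex N, ψ.eval K' u = ψ.eval K u ∧
      K'.IsBook u (u + s • (v - u)) (W.image fun w => u + t w • (w - u)) ∧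
      Set.InjOn (fun w => u + t w • (w - u)) W := by
  set r : E N → ℝ := fun x => if x = v then s else if x ∈ W then t x else 1 with hr
  have hr1 : ∀ x, 0 < r x ∧ r x ≤ 1 := by
    intro x
    simp only [hr]
    split_ifs with h1 h2
    · exact hs
    · exact ht x h2
    · simp
  obtain ⟨K', -, h2, h3⟩ := h.exists_shrink hK.mem_vertices hr1
  set f : E N → E N := fun x => u + r x • (x - u) with hf
  have hfu : f u = u := by simp [hf]
  have hfv : f v = u + s • (v - u) := by simp [hf, hr]
  have hfw : ∀ w ∈ W, f w = u + t w • (w - u) := by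
    intro w hw
    simp only [hf, hr, if_neg (hK.ne_right hw), if_pos hw]
  have hne : ∀ x, x ≠ u → f x ≠ u := by
    intro x hx hcon
    simp only [hf, add_eq_left, smul_eq_zero, sub_eq_zero] at hcon
    rcases hcon with hcon | hcon
    · exact (hr1 x).1.ne' hcon
    · exact hx hcon
  have hinj : ∀ x ∈ K.neighbors u, ∀ y ∈ K.neighbors u, f x = f y → x = y := by
    intro x hx y hy hxy
    simp only [hf, add_right_inj] at hxy
    refine neighbors_ray_unique hx hy (mul_pos (inv_pos.2 (hr1 x).1) (hr1 y).1) ?_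
    rw [mul_smul, ← hxy, smul_smul, inv_mul_cancel₀ (hr1 x).1.ne', one_smul]
  have hW : W.image f = W.image fun w => u + t w • (w - u) := Finset.image_congr hfw
  refine ⟨K', h2, ?_, fun x hx y hy hxy => ?_⟩
  · rw [← hfv, ← hW]
    refine ⟨(hne v hK.ne.symm).symm, ?_, ?_, fun t => ?_⟩
    · intro hcon
      obtain ⟨w, hw, hwu⟩ := Finset.mem_image.1 hcon
      exact hne w (hK.ne_left hw) hwu
    · intro hcon
      obtain ⟨w, hw, hwu⟩ := Finset.mem_image.1 hcon
      exact hK.ne_right hw (hinj w (hK.mem_neighbors hw) v hK.mem_neighbors_right hwu)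
    · have := IsBook.image_mem_iff (f := f) (u := u) (v := v) (W := W) (t := t)
      rw [hfu] at this
      rw [h3, this]
      simp only [hK.mem_iff]
  · have hxy' : f x = f y := by rw [hfw x hx, hfw y hy]; exact hxy
    exact hinj x (hK.mem_neighbors hx) y (hK.mem_neighbors hy) hxy'

end IsNull

/-! ### Triangles with prescribed angles -/

namespace TwoComplex

variable {N : ℕ}

/-- The complex of all faces of a simplex of dimension at most two. -/
noncomputable def ofSimplex (s : Finset (E N)) (hs : AffineIndependent ℝ ((↑) : s → E N))
    (hc : s.card ≤ 3) : TwoComplex N :=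
  ofWeightUnique {t | t.Nonempty ∧ t ⊆ s} (fun _ h => h.1) (fun _ h _ hts ht => ⟨ht, hts.trans h.2⟩)
    ((Finset.finite_toSet s.powerset).subset fun _ h => Finset.mem_coe.2
      (Finset.mem_powerset.2 h.2))
    (fun _ h => (Finset.card_le_card h.2).trans hc)
    (fun _ h _ h' _ _ hc hd hcd => hs.weight_unique (hc.supp.trans h.2) (hd.supp.trans h'.2)
      (hc.mass_eq.trans hd.mass_eq.symm) hcd)

theorem mem_ofSimplex {s : Finset (E N)} {hs : AffineIndependent ℝ ((↑) : s → E N)}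
    {hc : s.card ≤ 3} {t : Finset (E N)} : t ∈ (ofSimplex s hs hc).faces ↔ t.Nonempty ∧ t ⊆ s :=
  Iff.rfl

theorem ofSimplex_isBook {u v w : E N} (huv : u ≠ v) (huw : u ≠ w) (hvw : v ≠ w)
    {hs : AffineIndependent ℝ ((↑) : ({u, v, w} : Finset (E N)) → E N)}
    {hc : ({u, v, w} : Finset (E N)).card ≤ 3} : (ofSimplex {u, v, w} hs hc).IsBook u v {w} := by
  refine ⟨huv, by simpa using huw, by simpa using hvw, fun t => ?_⟩
  simp only [mem_star, mem_ofSimplex, Finset.mem_singleton, exists_eq_left]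
  constructor
  · rintro ⟨⟨h1, h2⟩, -⟩
    exact ⟨h1, Or.inr h2⟩
  · rintro ⟨h1, h2⟩
    have h3 : t ⊆ {u, v, w} := by
      rcases h2 with h2 | h2
      · refine h2.trans ?_
        intro x
        simp only [Finset.mem_insert, Finset.mem_singleton]
        tauto
      · exact h2
    exact ⟨⟨h1, h3⟩, by simp, Finset.insert_subset (by simp) h3⟩

end TwoComplex

/-- The point of the unit circle with polar angle `θ`. -/
noncomputable def circlePoint (θ : ℝ) : E 2 := !₂[Real.cos θ, Real.sin θ]

@[simp] theorem circlePoint_apply_zero (θ : ℝ) : circlePoint θ 0 = Real.cos θ := rfl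

@[simp] theorem circlePoint_apply_one (θ : ℝ) : circlePoint θ 1 = Real.sin θ := rfl

theorem norm_circlePoint (θ : ℝ) : ‖circlePoint θ‖ = 1 := by
  rw [EuclideanSpace.norm_eq, Fin.sum_univ_two]
  simp

theorem circlePoint_ne_zero (θ : ℝ) : circlePoint θ ≠ 0 := by
  rw [← norm_pos_iff, norm_circlePoint]
  exact one_pos

theorem angle_circlePoint {θ₁ θ₂ : ℝ} (h0 : 0 ≤ θ₁ - θ₂) (h1 : θ₁ - θ₂ ≤ Real.pi) :
    EuclideanGeometry.angle (circlePoint θ₁) 0 (circlePoint θ₂) = θ₁ - θ₂ := by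
  rw [EuclideanGeometry.angle, InnerProductGeometry.angle]
  simp only [vsub_eq_sub, sub_zero, norm_circlePoint, mul_one, div_one]
  have : inner ℝ (circlePoint θ₁) (circlePoint θ₂) = Real.cos (θ₁ - θ₂) := by
    rw [PiLp.inner_apply, Fin.sum_univ_two, Real.cos_sub]
    simp [mul_comm]
  rw [this, Real.arccos_cos h0 h1]

theorem circlePoint_det (θ₁ θ₂ : ℝ) :
    circlePoint θ₁ 1 * circlePoint θ₂ 0 - circlePoint θ₁ 0 * circlePoint θ₂ 1 =
      Real.sin (θ₁ - θ₂) := by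
  rw [Real.sin_sub]
  simp

theorem circlePoint_ne {θ₁ θ₂ : ℝ} (h : Real.sin (θ₁ - θ₂) ≠ 0) :
    circlePoint θ₁ ≠ circlePoint θ₂ := by
  intro he
  rw [← circlePoint_det, he] at h
  exact h (by ring)

theorem affineIndependent_planar {a b : E 2} (h : a 1 * b 0 - a 0 * b 1 ≠ 0) :
    AffineIndependent ℝ ((↑) : ({0, a, b} : Finset (E 2)) → E 2) := by
  have ha : (0 : E 2) ≠ a := by
    rintro rfl
    simp at h
  have hb : (0 : E 2) ≠ b := by
    rintro rfl
    simp at h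
  have hab : a ≠ b := by
    rintro rfl
    exact h (by ring)
  refine affineIndependent_of_weight_unique fun c d hc hd hcd => ?_
  have hm : mass c = mass d := hc.mass_eq.trans hd.mass_eq.symm
  rw [mass_eq_sum hc.supp, mass_eq_sum hd.supp] at hm
  rw [bary_eq_sum hc.supp, bary_eq_sum hd.supp] at hcd
  rw [Finset.sum_insert (by simp [ha, hb]), Finset.sum_pair hab,
    Finset.sum_insert (by simp [ha, hb]), Finset.sum_pair hab] at hm hcd
  have h0 := congrArg (fun x : E 2 => x 0) hcd
  have h1 := congrArg (fun x : E 2 => x 1) hcd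
  simp only [smul_zero, zero_add, PiLp.add_apply, PiLp.smul_apply, smul_eq_mul] at h0 h1
  have ea : c a = d a := by
    have : (c a - d a) * (a 1 * b 0 - a 0 * b 1) = 0 := by linear_combination b 0 * h1 - b 1 * h0
    exact sub_eq_zero.1 ((mul_eq_zero.1 this).resolve_right h)
  have eb : c b = d b := by
    have : (c b - d b) * (a 1 * b 0 - a 0 * b 1) = 0 := by linear_combination a 1 * h0 - a 0 * h1
    exact sub_eq_zero.1 ((mul_eq_zero.1 this).resolve_right h)
  have e0 : c 0 = d 0 := by linarith
  ext x
  by_cases hx : x ∈ ({0, a, b} : Finset (E 2))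
  · simp only [Finset.mem_insert, Finset.mem_singleton] at hx
    rcases hx with rfl | rfl | rfl
    · exact e0
    · exact ea
    · exact eb
  · rw [hc.eq_zero hx, hd.eq_zero hx]

/-- The triangle with vertices `0` and two points of the unit circle. -/
noncomputable def circleTriangle (θ₁ θ₂ : ℝ) (h : Real.sin (θ₁ - θ₂) ≠ 0) : TwoComplex 2 :=
  TwoComplex.ofSimplex {0, circlePoint θ₁, circlePoint θ₂}
    (affineIndependent_planar (by rwa [circlePoint_det])) Finset.card_le_three

theorem circleTriangle_isBook {θ₁ θ₂ : ℝ} (h : Real.sin (θ₁ - θ₂) ≠ 0) :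
    (circleTriangle θ₁ θ₂ h).IsBook 0 (circlePoint θ₁) {circlePoint θ₂} :=
  TwoComplex.ofSimplex_isBook (circlePoint_ne_zero _).symm (circlePoint_ne_zero _).symm
    (circlePoint_ne h)

/-- The value of `ψ` at the corner of a triangle as a function of the angle. -/
noncomputable def cornerValue (ψ : VertexFunction) (θ : ℝ) : ℝ :=
  -- The second arm points to `circlePoint 0`, whence `θ - 0`. Only the values at angles strictly
  -- between `0` and `π` are used.
  if h : Real.sin (θ - 0) ≠ 0 then ψ.eval (circleTriangle θ 0 h) 0 else 0

/-! ### Corner values and isosceles books -/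

namespace IsNull

open TwoComplex EuclideanGeometry

variable {ψ : VertexFunction} {N M : ℕ} {K : TwoComplex N} {u v w : E N} {W : Finset (E N)}

/-- Shrink all four arms to a common length `ε`. By the law of cosines the triangles are then
congruent. -/
theorem eval_triangle_congr (h : IsNull ψ) {K' : TwoComplex M} {u' v' w' : E M}
    (hK : K.IsBook u v {w}) (hK' : K'.IsBook u' v' {w'}) (ha : ∠ v' u' w' = ∠ v u w) :
    ψ.eval K' u' = ψ.eval K u := by
  have hv : 0 < dist v u := dist_pos.2 hK.ne.symm
  have hw : 0 < dist w u := dist_pos.2 (hK.ne_left (by simp))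
  have hv' : 0 < dist v' u' := dist_pos.2 hK'.ne.symm
  have hw' : 0 < dist w' u' := dist_pos.2 (hK'.ne_left (by simp))
  set ε := min (min (dist v u) (dist w u)) (min (dist v' u') (dist w' u')) with hε
  have hε0 : 0 < ε := lt_min (lt_min hv hw) (lt_min hv' hw')
  have e1 : ε ≤ dist v u := (min_le_left _ _).trans (min_le_left _ _)
  have e2 : ε ≤ dist w u := (min_le_left _ _).trans (min_le_right _ _)
  have e3 : ε ≤ dist v' u' := (min_le_right _ _).trans (min_le_left _ _)
  have e4 : ε ≤ dist w' u' := (min_le_right _ _).trans (min_le_right _ _)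
  have bd : ∀ {d : ℝ}, 0 < d → ε ≤ d → 0 < ε / d ∧ ε / d ≤ 1 := fun hd he =>
    ⟨div_pos hε0 hd, (div_le_one hd).2 he⟩
  obtain ⟨K₁, hK₁, hb₁, -⟩ := h.exists_shrink_book hK (s := ε / dist v u)
    (t := fun _ => ε / dist w u) (bd hv e1) (fun _ _ => bd hw e2)
  obtain ⟨K₂, hK₂, hb₂, -⟩ := h.exists_shrink_book hK' (s := ε / dist v' u')
    (t := fun _ => ε / dist w' u') (bd hv' e3) (fun _ _ => bd hw' e4)
  rw [Finset.image_singleton] at hb₁ hb₂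
  rw [← hK₁, ← hK₂]
  have dl : ∀ {n : ℕ} {x y : E n}, 0 < dist x y → dist (y + (ε / dist x y) • (x - y)) y = ε := by
    intro n x y hxy
    rw [dist_eq_norm, add_sub_cancel_left, norm_smul, ← dist_eq_norm,
      Real.norm_of_nonneg (div_pos hε0 hxy).le, div_mul_cancel₀ _ hxy.ne']
  have al : ∀ {n : ℕ} {x y z : E n}, 0 < dist x y → 0 < dist z y →
      ∠ (y + (ε / dist x y) • (x - y)) y (y + (ε / dist z y) • (z - y)) = ∠ x y z := by
    intro n x y z h1 h2
    rw [← angle_eq_of_sub_eq_smul (x := y + (ε / dist x y) • (x - y))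
      (y := y + (ε / dist z y) • (z - y)) (d := (ε / dist x y) • (x - y))
      (e := (ε / dist z y) • (z - y)) one_pos one_pos (by simp) (by simp)]
    simp only [angle, vsub_eq_sub, add_sub_cancel_left]
    rw [InnerProductGeometry.angle_smul_left_of_pos _ _ (div_pos hε0 h1),
      InnerProductGeometry.angle_smul_right_of_pos _ _ (div_pos hε0 h2)]
  refine h.eval_book_congr (g := fun _ => u' + (ε / dist w' u') • (w' - u')) hb₁
    (by rw [Finset.image_singleton]; exact hb₂) (by simp) ?_ ?_ ?_
  · rw [dist_comm, dl hv', dist_comm, dl hv]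
  · intro x hx
    rw [Finset.mem_singleton.1 hx, dist_comm, dl hw', dist_comm, dl hw]
  · intro x hx
    rw [Finset.mem_singleton.1 hx]
    have c1 := dist_sq_eq_dist_sq_add_dist_sq_sub_two_mul_dist_mul_dist_mul_cos_angle
      (u' + (ε / dist v' u') • (v' - u')) u' (u' + (ε / dist w' u') • (w' - u'))
    have c2 := dist_sq_eq_dist_sq_add_dist_sq_sub_two_mul_dist_mul_dist_mul_cos_angle
      (u + (ε / dist v u) • (v - u)) u (u + (ε / dist w u) • (w - u))
    rw [dl hv', dl hw', al hv' hw', ha] at c1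
    rw [dl hv, dl hw, al hv hw, ← c1] at c2
    exact (mul_self_inj dist_nonneg dist_nonneg).1 c2.symm

theorem eval_triangle (h : IsNull ψ) (hK : K.IsBook u v {w}) :
    ψ.eval K u = cornerValue ψ (∠ v u w) := by
  obtain ⟨h0, h1⟩ := hK.angle_pos (Finset.mem_singleton_self w)
  have hsin : Real.sin (∠ v u w - 0) ≠ 0 := by
    rw [sub_zero]
    exact (Real.sin_pos_of_pos_of_lt_pi h0 h1).ne'
  rw [cornerValue, dif_pos hsin]
  refine h.eval_triangle_congr (circleTriangle_isBook hsin) hK ?_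
  rw [angle_circlePoint (by linarith) (by linarith), sub_zero]

/-- Books whose pages have acute angles at `u` can be made isosceles. -/
theorem two_mul_eval_add_sum (h : IsNull ψ) (hK : K.IsBook u v W)
    (hac : ∀ w ∈ W, ∠ v u w < Real.pi / 2) :
    2 * ψ.eval K u + ∑ w ∈ W, cornerValue ψ (Real.pi - 2 * ∠ v u w) = 0 := by
  have hvn : 0 < ‖v - u‖ := norm_pos_iff.2 (sub_ne_zero.2 hK.ne.symm)
  have hinner : ∀ w ∈ W, 0 < inner ℝ (v - u) (w - u) := by
    intro w hw
    rw [← InnerProductGeometry.cos_angle_mul_norm_mul_norm]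
    refine mul_pos (Real.cos_pos_of_mem_Ioo ⟨?_, hac w hw⟩)
      (mul_pos hvn (norm_pos_iff.2 (sub_ne_zero.2 (hK.ne_left hw))))
    have := InnerProductGeometry.angle_nonneg (v - u) (w - u)
    linarith [Real.pi_pos]
  -- If the spine is scaled by `s`, then the page vertex scaled by `s * C w` is equidistant from
  -- both ends of the spine. Acuteness makes the inner product positive, so the factor is positive.
  set C : E N → ℝ := fun w => ‖v - u‖ ^ 2 / (2 * inner ℝ (v - u) (w - u)) with hC
  have hC0 : ∀ w ∈ W, 0 < C w := fun w hw =>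
    div_pos (pow_pos hvn 2) (mul_pos two_pos (hinner w hw))
  -- Small enough for all factors `s * C w` to be at most one.
  set s : ℝ := (1 + ∑ w ∈ W, C w)⁻¹ with hs
  have hsum : 0 ≤ ∑ w ∈ W, C w := Finset.sum_nonneg fun w hw => (hC0 w hw).le
  have hs0 : 0 < s := inv_pos.2 (by linarith)
  have hs1 : s ≤ 1 := inv_le_one_of_one_le₀ (by linarith)
  have ht : ∀ w ∈ W, 0 < s * C w ∧ s * C w ≤ 1 := by
    intro w hw
    refine ⟨mul_pos hs0 (hC0 w hw), ?_⟩
    rw [hs, inv_mul_le_iff₀ (by linarith), mul_one]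
    have := Finset.single_le_sum (fun x hx => (hC0 x hx).le) hw
    linarith
  obtain ⟨K', hK', hb, hinj⟩ := h.exists_shrink_book hK ⟨hs0, hs1⟩ ht
  set f : E N → E N := fun w => u + (s * C w) • (w - u) with hf
  set v' : E N := u + s • (v - u) with hv'
  have hdist : ∀ w ∈ W, dist v' (f w) = dist u (f w) := by
    intro w hw
    have e1 : v' - f w = s • (v - u) - (s * C w) • (w - u) := by
      simp only [hv', hf]; abel
    have e2 : u - f w = -((s * C w) • (w - u)) := by
      simp only [hf]; abel
    rw [dist_eq_norm, dist_eq_norm, e1, e2, norm_neg,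
      ← sq_eq_sq₀ (norm_nonneg _) (norm_nonneg _), norm_sub_sq_real, inner_smul_left,
      inner_smul_right, norm_smul, Real.norm_of_nonneg hs0.le]
    have h2 : C w * (2 * inner ℝ (v - u) (w - u)) = ‖v - u‖ ^ 2 :=
      div_mul_cancel₀ _ (mul_pos two_pos (hinner w hw)).ne'
    simp only [conj_trivial]
    linear_combination (-s ^ 2) * h2
  have hangle : ∀ w ∈ W, ∠ u (f w) v' = Real.pi - 2 * ∠ v u w := by
    intro w hw
    have h1 : ∠ v' u (f w) = ∠ v u w := by
      simp only [angle, vsub_eq_sub, hv', hf, add_sub_cancel_left]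
      rw [InnerProductGeometry.angle_smul_left_of_pos _ _ hs0,
        InnerProductGeometry.angle_smul_right_of_pos _ _ (ht w hw).1]
    have hv'u : v' ≠ u := hb.ne.symm
    have h3 := angle_add_angle_add_angle_eq_pi (f w) hv'u
    have h4 : ∠ (f w) u v' = ∠ (f w) v' u := by
      apply angle_eq_angle_of_dist_eq
      rw [dist_comm (f w) u, dist_comm (f w) v', hdist w hw]
    rw [angle_comm (f w) u v', h1] at h4
    rw [angle_comm u v' (f w), ← h4, angle_comm (f w) u v', h1] at h3
    rw [angle_comm u (f w) v']
    linarith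
  have h1 := h.book_sum hb
  -- Exchanging the ends of the spine is now an isometry of the book.
  have h2 : ψ.eval (K'.star u) v' = ψ.eval K' u := by
    refine h.eval_book_congr (g := id) hb (by rw [Finset.image_id]; exact hb.star_right)
      (Set.injOn_id _) (dist_comm _ _) ?_ ?_
    · intro x hx
      obtain ⟨w, hw, rfl⟩ := Finset.mem_image.1 hx
      exact hdist w hw
    · intro x hx
      obtain ⟨w, hw, rfl⟩ := Finset.mem_image.1 hx
      exact (hdist w hw).symm
  rw [h2, Finset.sum_image hinj, hK'] at h1
  have h3 : ∑ w ∈ W, ψ.eval (K'.star u) (f w) =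
      ∑ w ∈ W, cornerValue ψ (Real.pi - 2 * ∠ v u w) := by
    refine Finset.sum_congr rfl fun w hw => ?_
    rw [← hangle w hw, ← h.eval_triangle (hb.star_page (Finset.mem_image_of_mem f hw))]
  rw [h3] at h1
  linarith

end IsNull

/-! ### Splitting a triangle into a book with two pages -/

namespace IsNull

open TwoComplex EuclideanGeometry

variable {ψ : VertexFunction} {N M : ℕ} {K : TwoComplex N} {u v w p : E N} {W : Finset (E N)}
  {α β : ℝ}

/-- Subdividing a triangle by a segment from a vertex `w` to a point of the opposite edge gives a
book at `w`. -/
theorem split_isBook (hK : K.IsBook w u {v}) (hp : DividesEdge (K.star w) u v p α β) :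
    hp.stellar.IsBook w p {u, v} := by
  have hwu := hK.ne
  have hvw : v ≠ w := hK.ne_left (by simp)
  have hvu : v ≠ u := hK.ne_right (by simp)
  have hmem : ∀ t, t ∈ (K.star w).faces ↔ t.Nonempty ∧ t ⊆ {w, u, v} := by
    intro t
    rw [hK.mem_iff]
    simp only [Finset.mem_singleton, exists_eq_left]
    refine and_congr_right fun _ => ⟨fun h => h.elim (fun h => h.trans ?_) id, Or.inr⟩
    intro x
    simp only [Finset.mem_insert, Finset.mem_singleton]
    tauto
  have hw : {w} ∈ (K.star w).faces := (hmem _).2 ⟨by simp, by simp⟩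
  have hpw : w ≠ p := by
    rintro rfl
    exact hp.notMem_vertices hw
  have hpu := hp.ne_left
  have hpv := hp.ne_right
  refine ⟨hpw, by simp [hwu, hvw.symm], by simp [hpu, hpv], fun t => ?_⟩
  have key : ∀ t : Finset (E N), t ∈ hp.stellar.faces ↔
      t.Nonempty ∧ t ⊆ {w, p, u, v} ∧ ¬ {u, v} ⊆ t := by
    intro t
    have e : ∀ s : Finset (E N), ({u, v} ⊆ s.erase p ↔ {u, v} ⊆ s) := by
      intro s
      simp only [Finset.insert_subset_iff, Finset.singleton_subset_iff, Finset.mem_erase]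
      tauto
    rw [hp.mem_stellar, hmem, hmem, e]
    constructor
    · rintro (⟨⟨h1, h2⟩, h3⟩ | ⟨h1, h2, -, h3⟩)
      · refine ⟨h1, h2.trans ?_, h3⟩
        intro x
        simp only [Finset.mem_insert, Finset.mem_singleton]
        tauto
      · refine ⟨⟨p, h1⟩, fun x hx => ?_, h2⟩
        by_cases hxp : x = p
        · simp [hxp]
        · have := h3 (Finset.mem_insert_of_mem (Finset.mem_insert_of_mem
            (Finset.mem_erase.2 ⟨hxp, hx⟩)))
          simp only [Finset.mem_insert, Finset.mem_singleton] at this ⊢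
          tauto
    · rintro ⟨h1, h2, h3⟩
      by_cases hpt : p ∈ t
      · refine Or.inr ⟨hpt, h3, by simp, ?_⟩
        intro x hx
        simp only [Finset.mem_insert, Finset.mem_erase, Finset.mem_singleton] at hx ⊢
        rcases hx with hx | hx | ⟨hxp, hx⟩
        · tauto
        · tauto
        · have := h2 hx
          simp only [Finset.mem_insert, Finset.mem_singleton] at this
          tauto
      · refine Or.inl ⟨⟨h1, fun x hx => ?_⟩, h3⟩
        have := h2 hx
        have hxp : x ≠ p := fun hxp => hpt (hxp ▸ hx)
        simp only [Finset.mem_insert, Finset.mem_singleton] at this ⊢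
        tauto
  rw [mem_star, key, key]
  constructor
  · rintro ⟨⟨h1, h2, h3⟩, -⟩
    refine ⟨h1, Or.inr ?_⟩
    by_cases hu : u ∈ t
    · have hv : v ∉ t := fun hv => h3 (by simp [Finset.insert_subset_iff, hu, hv])
      refine ⟨u, by simp, fun x hx => ?_⟩
      have := h2 hx
      have hxv : x ≠ v := fun h => hv (h ▸ hx)
      simp only [Finset.mem_insert, Finset.mem_singleton] at this ⊢
      tauto
    · refine ⟨v, by simp, fun x hx => ?_⟩
      have := h2 hx
      have hxu : x ≠ u := fun h => hu (h ▸ hx)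
      simp only [Finset.mem_insert, Finset.mem_singleton] at this ⊢
      tauto
  · rintro ⟨h1, h2⟩
    have h3 : t ⊆ {w, p, u} ∨ t ⊆ {w, p, v} := by
      rcases h2 with h2 | ⟨x, hx, h2⟩
      · left
        refine h2.trans ?_
        intro x
        simp only [Finset.mem_insert, Finset.mem_singleton]
        tauto
      · rcases Finset.mem_insert.1 hx with rfl | hx
        · exact Or.inl h2
        · rw [Finset.mem_singleton.1 hx] at h2
          exact Or.inr h2
    have h4 : t ⊆ {w, p, u, v} := by
      intro x hx
      rcases h3 with h3 | h3 <;> have := h3 hx <;>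
        simp only [Finset.mem_insert, Finset.mem_singleton] at this ⊢ <;> tauto
    have h5 : ¬ (u ∈ t ∧ v ∈ t) := by
      rintro ⟨hu, hv⟩
      rcases h3 with h3 | h3
      · have := h3 hv
        simp only [Finset.mem_insert, Finset.mem_singleton] at this
        rcases this with h | h | h
        · exact hvw h
        · exact hpv h.symm
        · exact hvu h
      · have := h3 hu
        simp only [Finset.mem_insert, Finset.mem_singleton] at this
        rcases this with h | h | h
        · exact hwu h.symm
        · exact hpu h.symm
        · exact hvu h.symm
    refine ⟨⟨h1, h4, fun h => h5 ⟨h (by simp), h (by simp)⟩⟩, by simp,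
      Finset.insert_subset (by simp) h4, fun h => h5 ⟨?_, ?_⟩⟩
    · have := h (by simp : u ∈ {u, v})
      simpa [hwu.symm] using this
    · have := h (by simp : v ∈ {u, v})
      simpa [hvw] using this

/-- One corner can thus be viewed both as a triangle with the full angle and as a book with two
smaller angles; this leads to additivity. -/
theorem eval_split (h : IsNull ψ) (hK : K.IsBook w u {v})
    (hp : DividesEdge (K.star w) u v p α β) : ψ.eval hp.stellar w = ψ.eval K w := by
  rw [h.eval_subdivision hp.isSubdivision (K.mem_star_vertices ⟨w, hK.mem_vertices⟩)
    (split_isBook hK hp).mem_vertices, h.eval_star hK.mem_vertices]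

/-! ### The corner value vanishes -/

theorem sin_ne_zero {θ : ℝ} (h0 : 0 < θ) (h1 : θ < Real.pi) : Real.sin (θ - 0) ≠ 0 := by
  rw [sub_zero]
  exact (Real.sin_pos_of_pos_of_lt_pi h0 h1).ne'

theorem cornerValue_isosceles (h : IsNull ψ) {θ : ℝ} (h0 : 0 < θ) (h1 : θ < Real.pi / 2) :
    2 * cornerValue ψ θ + cornerValue ψ (Real.pi - 2 * θ) = 0 := by
  have hpi := Real.pi_pos
  have hb := circleTriangle_isBook (sin_ne_zero h0 (by linarith))
  have ha : ∠ (circlePoint θ) 0 (circlePoint 0) = θ := by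
    rw [angle_circlePoint (by linarith) (by linarith), sub_zero]
  have := h.two_mul_eval_add_sum hb (by
    intro w hw
    rw [Finset.mem_singleton.1 hw, ha]
    exact h1)
  rwa [Finset.sum_singleton, h.eval_triangle hb, ha] at this

/-- Split the corner with angle `θ₁ + θ₂` into a book with the angles `θ₁`, `θ₂`. Isosceles pages
give `2 c(θ₁ + θ₂) + c(π - 2θ₁) + c(π - 2θ₂) = 0`, and the last two terms are `-2 c(θ₁)` and `-2
c(θ₂)`. -/
theorem cornerValue_add (h : IsNull ψ) {θ₁ θ₂ : ℝ} (h1 : 0 < θ₁) (h1' : θ₁ < Real.pi / 2)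
    (h2 : 0 < θ₂) (h2' : θ₂ < Real.pi / 2) :
    cornerValue ψ (θ₁ + θ₂) = cornerValue ψ θ₁ + cornerValue ψ θ₂ := by
  have hpi := Real.pi_pos
  have hsin : Real.sin (θ₁ - -θ₂) ≠ 0 :=
    (Real.sin_pos_of_pos_of_lt_pi (by linarith) (by linarith)).ne'
  have hb := circleTriangle_isBook hsin
  have hs1 : 0 < Real.sin θ₁ := Real.sin_pos_of_pos_of_lt_pi h1 (by linarith)
  have hs2 : 0 < Real.sin θ₂ := Real.sin_pos_of_pos_of_lt_pi h2 (by linarith)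
  set S := Real.sin θ₁ + Real.sin θ₂ with hS
  have hS0 : 0 < S := add_pos hs1 hs2
  -- The division point is where the opposite side crosses the ray with polar angle `0`; the weights
  -- are those that cancel the second coordinate.
  have hdiv : DividesEdge ((circleTriangle θ₁ (-θ₂) hsin).star 0) (circlePoint θ₁)
      (circlePoint (-θ₂)) ((Real.sin (θ₁ + θ₂) / S) • circlePoint 0) (Real.sin θ₂ / S)
      (Real.sin θ₁ / S) := by
    refine ⟨circlePoint_ne hsin, ?_, div_pos hs2 hS0, div_pos hs1 hS0, ?_, ?_⟩
    · refine (hb.mem_iff _).2 ⟨by simp, Or.inr ⟨_, Finset.mem_singleton_self _, ?_⟩⟩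
      exact Finset.subset_insert _ _
    · rw [← add_div, add_comm, ← hS, div_self hS0.ne']
    · ext i
      fin_cases i
      · simp [circlePoint, Real.sin_add]
        ring
      · simp [circlePoint]
        ring
  have hsplit := split_isBook hb hdiv
  have hc : 0 < Real.sin (θ₁ + θ₂) / S :=
    div_pos (Real.sin_pos_of_pos_of_lt_pi (by linarith) (by linarith)) hS0
  have ha : ∀ x : E 2, ∠ ((Real.sin (θ₁ + θ₂) / S) • circlePoint 0) 0 x =
      ∠ (circlePoint 0) 0 x := by
    intro x
    simp only [angle, vsub_eq_sub, sub_zero]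
    exact InnerProductGeometry.angle_smul_left_of_pos _ _ hc
  have ha1 : ∠ ((Real.sin (θ₁ + θ₂) / S) • circlePoint 0) 0 (circlePoint θ₁) = θ₁ := by
    rw [ha, angle_comm, angle_circlePoint (by linarith) (by linarith), sub_zero]
  have ha2 : ∠ ((Real.sin (θ₁ + θ₂) / S) • circlePoint 0) 0 (circlePoint (-θ₂)) = θ₂ := by
    rw [ha, angle_circlePoint (by linarith) (by linarith), sub_neg_eq_add, zero_add]
  have key := h.two_mul_eval_add_sum hsplit (by
    intro w hw
    rcases Finset.mem_insert.1 hw with rfl | hw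
    · rw [ha1]; exact h1'
    · rw [Finset.mem_singleton.1 hw, ha2]; exact h2')
  rw [Finset.sum_pair (circlePoint_ne hsin), ha1, ha2, h.eval_split hb hdiv, h.eval_triangle hb,
    angle_circlePoint (by linarith) (by linarith), sub_neg_eq_add] at key
  linarith [h.cornerValue_isosceles h1 h1', h.cornerValue_isosceles h2 h2']

/-- At `θ = π / 4` the isosceles relation says `2 c(π / 4) = -c(π / 2)`, additivity says `2 c(π / 4)
= c(π / 2)`. -/
theorem cornerValue_pi_div_two (h : IsNull ψ) : cornerValue ψ (Real.pi / 2) = 0 := by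
  have hpi := Real.pi_pos
  have h1 := h.cornerValue_isosceles (θ := Real.pi / 4) (by linarith) (by linarith)
  have h2 := h.cornerValue_add (θ₁ := Real.pi / 4) (θ₂ := Real.pi / 4) (by linarith) (by linarith)
    (by linarith) (by linarith)
  rw [(by ring : Real.pi - 2 * (Real.pi / 4) = Real.pi / 2)] at h1
  rw [(by ring : Real.pi / 4 + Real.pi / 4 = Real.pi / 2)] at h2
  linarith

theorem cornerValue_dyadic (h : IsNull ψ) (n : ℕ) :
    cornerValue ψ (Real.pi / 2 / 2 ^ n) = 0 := by
  induction n with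
  | zero => simpa using h.cornerValue_pi_div_two
  | succ n ih =>
    have hpi := Real.pi_pos
    have h1 : 0 < Real.pi / 2 / 2 ^ (n + 1) := by positivity
    have h2 : Real.pi / 2 / 2 ^ (n + 1) < Real.pi / 2 :=
      div_lt_self (by linarith) (one_lt_pow₀ one_lt_two n.succ_ne_zero)
    have h3 := h.cornerValue_add h1 h2 h1 h2
    have h4 : Real.pi / 2 / 2 ^ (n + 1) + Real.pi / 2 / 2 ^ (n + 1) = Real.pi / 2 / 2 ^ n := by
      rw [pow_succ]; field_simp; ring
    rw [h4, ih] at h3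
    linarith

theorem cornerValue_nat_mul (h : IsNull ψ) {x : ℝ} (hx : 0 < x) (h0 : cornerValue ψ x = 0) (k : ℕ)
    (hk : ((k + 1 : ℕ) : ℝ) * x < Real.pi / 2) : cornerValue ψ (((k + 1 : ℕ) : ℝ) * x) = 0 := by
  induction k with
  | zero => simpa using h0
  | succ k ih =>
    have h1 : ((k + 1 : ℕ) : ℝ) * x + x = ((k + 1 + 1 : ℕ) : ℝ) * x := by push_cast; ring
    have h2 : 0 < ((k + 1 : ℕ) : ℝ) * x := by positivity
    rw [← h1] at hk ⊢
    rw [h.cornerValue_add h2 (by linarith) hx (by linarith), ih (by linarith), h0, add_zero]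

/-- Moves a single vertex along the unit circle; this is the combinatorial equivalence to which
continuity of `ψ` is applied. -/
theorem circleTriangle_iso {θ θ' : ℝ} (h : Real.sin (θ - 0) ≠ 0) (h' : Real.sin (θ' - 0) ≠ 0) :
    IsSimplicialIso (fun x => if x = circlePoint θ then circlePoint θ' else x)
      (circleTriangle θ 0 h) (circleTriangle θ' 0 h') := by
  have e0 := (circlePoint_ne_zero θ).symm
  have e1 := (circlePoint_ne h).symm
  have e0' := (circlePoint_ne_zero θ').symm
  have e1' := (circlePoint_ne h').symm
  set f : E 2 → E 2 := fun x => if x = circlePoint θ then circlePoint θ' else x with hf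
  have f0 : f 0 = 0 := if_neg e0
  have f1 : f (circlePoint 0) = circlePoint 0 := if_neg e1
  have f2 : f (circlePoint θ) = circlePoint θ' := if_pos rfl
  have himg : ({0, circlePoint θ', circlePoint 0} : Finset (E 2)) =
      ({0, circlePoint θ, circlePoint 0} : Finset (E 2)).image f := by
    rw [Finset.image_insert, Finset.image_insert, Finset.image_singleton, f0, f1, f2]
  refine ⟨fun x hx y hy hxy => ?_, fun t => ?_⟩
  · have hx' : ({x} : Finset (E 2)) ⊆ {0, circlePoint θ, circlePoint 0} := And.right hx
    have hy' : ({y} : Finset (E 2)) ⊆ {0, circlePoint θ, circlePoint 0} := And.right hy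
    rw [Finset.singleton_subset_iff] at hx' hy'
    simp only [Finset.mem_insert, Finset.mem_singleton] at hx' hy'
    rcases hx' with rfl | rfl | rfl <;> rcases hy' with rfl | rfl | rfl <;>
      simp only [f0, f1, f2] at hxy <;> try first | rfl | exact hxy
    · exact absurd hxy e0'
    · exact absurd hxy.symm e0'
    · exact absurd hxy.symm e1'
    · exact absurd hxy e1'
  · rw [circleTriangle, mem_ofSimplex, himg, Finset.subset_image_iff]
    constructor
    · rintro ⟨h1, s, hs, rfl⟩
      exact ⟨s, mem_ofSimplex.2 ⟨Finset.image_nonempty.1 h1, hs⟩, rfl⟩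
    · rintro ⟨s, hs, rfl⟩
      have hs' := mem_ofSimplex.1 hs
      exact ⟨Finset.image_nonempty.2 hs'.1, s, hs'.2, rfl⟩

theorem continuous_circlePoint : Continuous circlePoint := by
  unfold circlePoint
  refine (PiLp.continuous_toLp 2 _).comp (continuous_pi fun i => ?_)
  fin_cases i
  · exact Real.continuous_cos
  · exact Real.continuous_sin

theorem tendsto_cornerValue (h : IsNull ψ) {θ : ℝ} (hθ : 0 < θ ∧ θ < Real.pi) {x : ℕ → ℝ}
    (hx : ∀ n, 0 < x n ∧ x n < Real.pi) (hlim : Tendsto x atTop (𝓝 θ)) :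
    Tendsto (fun n => cornerValue ψ (x n)) atTop (𝓝 (cornerValue ψ θ)) := by
  have hs := sin_ne_zero hθ.1 hθ.2
  have hsn := fun n => sin_ne_zero (hx n).1 (hx n).2
  have hb := circleTriangle_isBook hs
  have hmem := hb.mem_vertices
  have e0 := (circlePoint_ne_zero θ).symm
  have key := h.continuous (circleTriangle θ 0 hs) (fun n => circleTriangle (x n) 0 (hsn n))
    (fun n => (circleTriangle_iso hs (hsn n)).toSimplicialEquiv) (by
      intro v
      simp only [IsSimplicialIso.toSimplicialEquiv_apply]
      split_ifs with hv
      · rw [hv]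
        exact (continuous_circlePoint.tendsto θ).comp hlim
      · exact tendsto_const_nhds) ⟨0, hmem⟩
  have e1 : cornerValue ψ θ = ψ (circleTriangle θ 0 hs) ⟨0, hmem⟩ := by
    rw [cornerValue, dif_pos hs, ψ.eval_of_mem hmem]
  rw [e1]
  refine key.congr fun n => ?_
  rw [cornerValue, dif_pos (hsn n), ψ.eval_of_mem (circleTriangle_isBook (hsn n)).mem_vertices]
  congr 1
  refine Subtype.ext ?_
  rw [IsSimplicialIso.toSimplicialEquiv_apply]
  exact if_neg e0

/-- Multiples of dyadic fractions of `π / 2` approach `θ` from below; the corner value vanishes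
there and is continuous. -/
theorem cornerValue_eq_zero_of_acute (h : IsNull ψ) {θ : ℝ} (h0 : 0 < θ) (h1 : θ < Real.pi / 2) :
    cornerValue ψ θ = 0 := by
  have hpi := Real.pi_pos
  set d : ℕ → ℝ := fun n => Real.pi / 2 / 2 ^ n with hd
  have hd0 : ∀ n, 0 < d n := fun n => by positivity
  have hdlim : Tendsto d atTop (𝓝 0) := by
    have := (tendsto_pow_atTop_nhds_zero_of_lt_one (r := (1 / 2 : ℝ)) (by norm_num)
      (by norm_num)).const_mul (Real.pi / 2)
    rw [mul_zero] at this
    refine this.congr fun n => ?_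
    simp only [hd]
    rw [one_div, inv_pow, div_eq_mul_inv (Real.pi / 2) (2 ^ n)]
  -- approximation of `θ` from below by multiples of `d n`
  set y : ℕ → ℝ := fun n => (⌊θ / d n⌋₊ : ℝ) * d n with hy
  have hyle : ∀ n, y n ≤ θ := fun n => by
    have := Nat.floor_le (div_pos h0 (hd0 n)).le
    rw [le_div_iff₀ (hd0 n)] at this
    exact this
  have hylt : ∀ n, θ - d n < y n := fun n => by
    have := Nat.lt_floor_add_one (θ / d n)
    rw [div_lt_iff₀ (hd0 n)] at this
    simp only [hy]
    linarith
  have hylim : Tendsto y atTop (𝓝 θ) := by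
    refine tendsto_of_tendsto_of_tendsto_of_le_of_le (g := fun n => θ - d n) ?_
      tendsto_const_nhds (fun n => (hylt n).le) hyle
    simpa using hdlim.const_sub θ
  obtain ⟨n₀, hn₀⟩ := (eventually_atTop.1 (hdlim.eventually (gt_mem_nhds h0)))
  have hypos : ∀ n, 0 < y (n + n₀) := fun n => by
    have h2 := hn₀ (n + n₀) (Nat.le_add_left _ _)
    have h3 := hylt (n + n₀)
    linarith
  have hzero : ∀ n, cornerValue ψ (y (n + n₀)) = 0 := by
    intro n
    obtain ⟨k, hk⟩ : ∃ k, ⌊θ / d (n + n₀)⌋₊ = k + 1 := by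
      refine Nat.exists_eq_succ_of_ne_zero fun hcon => ?_
      have := hypos n
      simp only [hy, hcon, Nat.cast_zero, zero_mul, lt_irrefl] at this
    have h4 := hyle (n + n₀)
    simp only [hy, hk] at h4 ⊢
    exact h.cornerValue_nat_mul (hd0 _) (h.cornerValue_dyadic _) k (by linarith)
  have hlim := h.tendsto_cornerValue ⟨h0, by linarith⟩ (x := fun n => y (n + n₀))
    (fun n => ⟨hypos n, by linarith [hyle (n + n₀)]⟩)
    (hylim.comp (tendsto_add_atTop_nat n₀))
  simp only [hzero] at hlim
  exact tendsto_nhds_unique hlim tendsto_const_nhds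

/-- Half of any angle below `π` is acute, so additivity reaches the right and obtuse angles. -/
theorem cornerValue_eq_zero (h : IsNull ψ) {θ : ℝ} (h0 : 0 < θ) (h1 : θ < Real.pi) :
    cornerValue ψ θ = 0 := by
  have h2 := h.cornerValue_add (θ₁ := θ / 2) (θ₂ := θ / 2) (by linarith) (by linarith)
    (by linarith) (by linarith)
  have h3 := h.cornerValue_eq_zero_of_acute (θ := θ / 2) (by linarith) (by linarith)
  rw [add_halves] at h2
  rw [h2, h3, add_zero]

/-! ### Vanishing on books and on all complexes -/

theorem eval_acute_book (h : IsNull ψ) (hK : K.IsBook u v W)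
    (hac : ∀ w ∈ W, ∠ v u w < Real.pi / 2) : ψ.eval K u = 0 := by
  have h1 := h.two_mul_eval_add_sum hK hac
  rw [Finset.sum_eq_zero] at h1
  · linarith
  · intro w hw
    have h2 := (hK.angle_pos hw).1
    have h3 := hac w hw
    exact h.cornerValue_eq_zero (by linarith) (by linarith)

/-- When all edges at `u` have the same length, every page is isosceles with apex `u`, and its
angles at the other end of the spine are acute whatever the angle at `u`. So that end and the page
vertices contribute nothing to the zero sum. -/
theorem eval_book (h : IsNull ψ) (hK : K.IsBook u v W) : ψ.eval K u = 0 := by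
  have hvn : 0 < ‖v - u‖ := norm_pos_iff.2 (sub_ne_zero.2 hK.ne.symm)
  have hwn : ∀ w ∈ W, 0 < ‖w - u‖ := fun w hw => norm_pos_iff.2 (sub_ne_zero.2 (hK.ne_left hw))
  -- shrink so that all edges at `u` have the length `ε`
  obtain ⟨ε, hε0, hεv, hεw⟩ : ∃ ε : ℝ, 0 < ε ∧ ε ≤ ‖v - u‖ ∧ ∀ w ∈ W, ε ≤ ‖w - u‖ := by
    have hne : (insert v W).Nonempty := Finset.insert_nonempty _ _
    obtain ⟨x, hx, hmin⟩ := Finset.exists_min_image (insert v W) (fun x => ‖x - u‖) hne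
    refine ⟨‖x - u‖, ?_, hmin v (by simp), fun w hw => hmin w (by simp [hw])⟩
    rcases Finset.mem_insert.1 hx with rfl | hx
    · exact hvn
    · exact hwn x hx
  obtain ⟨K', hK', hb, -⟩ := h.exists_shrink_book hK (s := ε / ‖v - u‖)
    (t := fun w => ε / ‖w - u‖) ⟨div_pos hε0 hvn, (div_le_one hvn).2 hεv⟩
    (fun w hw => ⟨div_pos hε0 (hwn w hw), (div_le_one (hwn w hw)).2 (hεw w hw)⟩)
  rw [← hK']
  have dl : ∀ x : E N, 0 < ‖x - u‖ → dist (u + (ε / ‖x - u‖) • (x - u)) u = ε := by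
    intro x hx
    rw [dist_eq_norm, add_sub_cancel_left, norm_smul, Real.norm_of_nonneg (div_pos hε0 hx).le,
      div_mul_cancel₀ _ hx.ne']
  have hpages : ∑ w ∈ W.image (fun w => u + (ε / ‖w - u‖) • (w - u)),
      ψ.eval (K'.star u) w = 0 := by
    refine Finset.sum_eq_zero fun w hw => ?_
    have h1 := hb.star_page hw
    have h2 := h1.angle_pos (Finset.mem_singleton_self _)
    rw [h.eval_triangle h1, h.cornerValue_eq_zero h2.1 h2.2]
  -- The two base angles of a page are equal, and with a positive apex angle their sum is less than
  -- `π`.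
  have hspine : ψ.eval (K'.star u) (u + (ε / ‖v - u‖) • (v - u)) = 0 := by
    refine h.eval_acute_book hb.star_right fun w' hw' => ?_
    obtain ⟨w, hw, rfl⟩ := Finset.mem_image.1 hw'
    have h3 := angle_add_angle_add_angle_eq_pi (u + (ε / ‖w - u‖) • (w - u)) hb.ne.symm
    have h4 := angle_eq_angle_of_dist_eq (p₁ := u) (p₂ := u + (ε / ‖v - u‖) • (v - u))
      (p₃ := u + (ε / ‖w - u‖) • (w - u))
      (by rw [dist_comm, dl v hvn, dist_comm, dl w (hwn w hw)])
    have h5 := (hb.angle_pos hw').1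
    rw [angle_comm _ u _] at h5
    rw [angle_comm (u + (ε / ‖w - u‖) • (w - u)) u] at h3
    rw [angle_comm _ u _] at h5
    rw [angle_comm u (u + (ε / ‖w - u‖) • (w - u))] at h4
    rw [h4]
    rw [angle_comm u (u + (ε / ‖v - u‖) • (v - u))] at h3 h4
    linarith
  have := h.book_sum hb
  rw [hpages, hspine] at this
  linarith

/-- Here dimension at most two enters: a face of the star of `x` within the star of `v`, joined with
`x` and `v`, has at most three vertices, so it adds at most one vertex to the spine. -/
theorem star_isBook {x : E N} (hx : x ∈ K.neighbors v) :
    (K.star v).IsBook x v ((K.neighbors v).filter fun w => w ≠ x ∧ {v, x, w} ∈ K.faces) := by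
  obtain ⟨hxv, hf⟩ := mem_neighbors.1 hx
  refine ⟨hxv, by simp, by simp [mem_neighbors], fun t => ?_⟩
  simp only [mem_star, Finset.mem_filter, mem_neighbors]
  constructor
  · rintro ⟨⟨h1, h2⟩, h3, h4⟩
    refine ⟨K.nonempty_of_mem h1, ?_⟩
    have hcard := K.card_le_three _ h4
    by_cases hsub : t ⊆ {x, v}
    · exact Or.inl hsub
    · right
      obtain ⟨w, hw, hwn⟩ := Finset.not_subset.1 hsub
      simp only [Finset.mem_insert, Finset.mem_singleton, not_or] at hwn
      have h5 : ({v, x, w} : Finset (E N)) ⊆ insert v (insert x t) := by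
        simp [Finset.insert_subset_iff, hw]
      have h6 : ({v, x, w} : Finset (E N)).card = 3 :=
        Finset.card_eq_three.2 ⟨v, x, w, hxv.symm, Ne.symm hwn.2, Ne.symm hwn.1, rfl⟩
      have h7 := Finset.eq_of_subset_of_card_le h5 (by omega)
      refine ⟨w, ⟨⟨hwn.2, K.down_closed h4 ?_ (by simp)⟩, hwn.1, h7 ▸ h4⟩, ?_⟩
      · simp [Finset.insert_subset_iff, hw]
      · intro z hz
        have : z ∈ ({v, x, w} : Finset (E N)) := h7 ▸ (by simp [hz])
        simp only [Finset.mem_insert, Finset.mem_singleton] at this ⊢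
        tauto
  · rintro ⟨h1, h2⟩
    obtain ⟨s, hs, hts, hvs, hxs⟩ : ∃ s ∈ K.faces, t ⊆ s ∧ v ∈ s ∧ x ∈ s := by
      rcases h2 with h2 | ⟨w, ⟨-, -, hw⟩, h2⟩
      · exact ⟨_, hf, h2.trans (Finset.pair_comm x v).subset, by simp, by simp⟩
      · refine ⟨_, hw, h2.trans (Finset.insert_comm x v _).subset, by simp, by simp⟩
    refine ⟨⟨K.down_closed hs hts h1, K.down_closed hs ?_ (by simp)⟩,
      K.down_closed hs ?_ (by simp), K.down_closed hs ?_ (by simp)⟩ <;>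
    simp [Finset.insert_subset_iff, hts, hvs, hxs]

/-- In the zero sum over the star of `v`, every vertex except `v` is an end of the spine of a book
and contributes zero. -/
theorem eq_zero (h : IsNull ψ) (hv : v ∈ K.vertices) : ψ.eval K v = 0 := by
  have := h.sum_eval (K := K.star v) (S := insert v (K.neighbors v)) (fun x => by
    rw [mem_star_vertices_iff hv, Finset.mem_insert])
  rw [Finset.sum_insert (by simp [mem_neighbors]), h.eval_star hv,
    Finset.sum_eq_zero fun x hx => h.eval_book (star_isBook hx), add_zero] at this
  exact this

/-- The function `Λ` cancels, so the same argument serves both characterizations. -/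
theorem of_sub {φ κ : VertexFunction} {Λ : ComplexFunction} (h1 : φ.InvariantUnderStarIsometry)
    (h2 : φ.InvariantUnderSubdivision) (h3 : φ.IsContinuous) (h4 : φ.SatisfiesDGB Λ)
    (k1 : κ.InvariantUnderStarIsometry) (k2 : κ.InvariantUnderSubdivision) (k3 : κ.IsContinuous)
    (k4 : κ.SatisfiesDGB Λ) : IsNull fun _ K v => φ K v - κ K v where
  star := fun N M K L v w hvw => by
    change φ K v - κ K v = φ L w - κ L w
    rw [h1 K L v w hvw, k1 K L v w hvw]
  subdivision := fun N K J hJ v hK hJ' => by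
    change φ K ⟨v, hK⟩ - κ K ⟨v, hK⟩ = φ J ⟨v, hJ'⟩ - κ J ⟨v, hJ'⟩
    rw [h2 K J hJ v hK hJ', k2 K J hJ v hK hJ']
  continuous := fun N K Ks e he v => (h3 K Ks e he v).sub (k3 K Ks e he v)
  sum_eq_zero := fun N K => by rw [Finset.sum_sub_distrib, h4 K, k4 K, sub_self]

theorem eq_of_properties {φ κ : VertexFunction} {Λ : ComplexFunction}
    (hφ : φ.InvariantUnderStarIsometry ∧ φ.InvariantUnderSubdivision ∧ φ.IsContinuous ∧
      φ.SatisfiesDGB Λ)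
    (hκ : κ.InvariantUnderStarIsometry ∧ κ.InvariantUnderSubdivision ∧ κ.IsContinuous ∧
      κ.SatisfiesDGB Λ) : φ = κ := by
  have h := of_sub hφ.1 hφ.2.1 hφ.2.2.1 hφ.2.2.2 hκ.1 hκ.2.1 hκ.2.2.1 hκ.2.2.2
  funext N K v
  have h1 := h.eq_zero v.2
  rw [VertexFunction.eval_of_mem _ v.2] at h1
  exact sub_eq_zero.1 h1

end IsNull

/-! ### The two characterizations -/

theorem standardCurvature_properties :
    standardCurvature.InvariantUnderStarIsometry ∧ standardCurvature.InvariantUnderSubdivision ∧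
      standardCurvature.IsContinuous ∧ standardCurvature.SatisfiesDGB eulerChar :=
  ⟨standardCurvature_invariantUnderStarIsometry, standardCurvature_invariantUnderSubdivision,
    standardCurvature_isContinuous, standardCurvature_satisfiesDGB⟩

theorem generalizedAngleDefect_properties (c : HomeoType → ℝ) :
    (generalizedAngleDefect c).InvariantUnderStarIsometry ∧
      (generalizedAngleDefect c).InvariantUnderSubdivision ∧
      (generalizedAngleDefect c).IsContinuous ∧
      (generalizedAngleDefect c).SatisfiesDGB (stratifiedEulerChar c) :=
  ⟨generalizedAngleDefect_invariantUnderStarIsometry c,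
    generalizedAngleDefect_invariantUnderSubdivision c, generalizedAngleDefect_isContinuous c,
    generalizedAngleDefect_satisfiesDGB c⟩

theorem theorem2p4 (φ : VertexFunction) :
    (φ = standardCurvature ↔
      φ.InvariantUnderStarIsometry ∧ φ.InvariantUnderSubdivision ∧ φ.IsContinuous ∧
        φ.SatisfiesDGB eulerChar) ∧
    ∀ c : HomeoType → ℝ,
      (φ = generalizedAngleDefect c ↔
        φ.InvariantUnderStarIsometry ∧ φ.InvariantUnderSubdivision ∧ φ.IsContinuous ∧
          φ.SatisfiesDGB (stratifiedEulerChar c)) := by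
  refine ⟨⟨?_, fun h => IsNull.eq_of_properties h standardCurvature_properties⟩, fun c =>
    ⟨?_, fun h => IsNull.eq_of_properties h (generalizedAngleDefect_properties c)⟩⟩
  · rintro rfl
    exact standardCurvature_properties
  · rintro rfl
    exact generalizedAngleDefect_properties c
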